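/- **Setting.** Let $d\ge 2$ and let $(U,Z)$ be a random pair, where $U$ takes values in a measurable space and $Z$ in $\mathbb R^d$. Assume that the support $S$ of $Z$ is compact and convex with diameter $\rho''$, and that $Z$ has a Lebesgue density $f_Z$ with $0<\rho\le f_Z\le\bar\rho$ on $S$. Let $S^*\subseteq S$ be a non-empty Borel set such that for some $\rho'>0$ every ball $B_d(z,\rho')$ with $z\in S^*$ is included in $S$. Let $g$ be a real-valued measurable function such that $g(U,Z)$ is square-integrable and $\mathrm{var}(g(U,Z)\mid Z)\le C_{\mathrm V}$ almost surely for a constant $C_{\mathrm V}>0$, let $G(z)=\mathbb E[g(U,Z)\mid Z=z]$, and $$\Psi=\mathbb E\Big[g(U,Z)\,\frac{1_{S^*}(Z)}{f_Z(Z)}\Big]=\int_{S^*}G(z)\,\mathrm dz .$$ For $l\in\mathbb N_0$, $0<\beta\le1$ and $C_{\mathrm H}>0$, let $\mathcal G(l,\beta,C_{\mathrm H})$ be the class of functions $h$ whose restriction to the interior of $S$ has continuous partial derivatives of order $\le l$ with $|\partial_\kappa h(z)-\partial_\kappa h(z')|\le C_{\mathrm H}\|z-z'\|^\beta$ for all $z,z'$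 in the interior of $S$ and all $\kappa\in\mathbb N_0^d$ with $|\kappa|=l$. **Estimator.** Let $(U_1,Z_1),\dots,(U_n,Z_n)$ be i.i.d. copies of $(U,Z)$. For $J\subseteq\{1,\dots,n\}$ with $\#J=K$ let $$C(J)=\{z\in S^*:\ \|z-Z_j\|<\|z-Z_k\|\ \text{ for all } j\in J,\ k\notin J\}.$$ With $\mathcal K=\{\kappa\in\mathbb N_0^d:|\kappa|\le L\}$ and $\xi(z,w)=\big(\prod_{k=1}^d(w_k-z_k)^{\kappa_k}\big)_{\kappa\in\mathcal K}$, put for $z\in C(J)$ $$\hat G(z)=\mathbf e_0^\top\Big(\sum_{j\in J}\xi(z,Z_j)\xi(z,Z_j)^\top\Big)^{-1}\sum_{j\in J}g(U_j,Z_j)\,\xi(z,Z_j),\qquad \hat\Psi(L,K)=\sum_{\#J=K}\int_{C(J)}\hat G(z)\,\mathrm dz,$$ where $\mathbf e_0$ is the unit vector for $\kappa=(0,\dots,0)$; thus $\hat G(z)$ is the value at $z$ of the least squares polynomial of degree $L$ fitted to the data with indices in $J$. Let $K^*=\#\mathcal K=\binom{d+L}{L}$ and $D=\sum_{m=1}^L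 m\binom{d+m-1}{m}$, and let $\sigma_Z$ be the $\sigma$-field generated by $Z_1,\dots,Z_n$. **Theorem.** Choose $L=l$. If $L=0$ let $K\ge1$, and if $L\ge1$ let $K\ge 2+(2D+1)K^*$. Then there is a constant $C>0$, which depends only on $L,K,\rho,\rho',\rho'',\bar\rho,d$ and $\lambda(S^*)$, such that for all $n\ge K$ the following holds. Almost surely, the inverse matrices exist for almost every $z$ in every cell and $\hat G$ is integrable on every cell; $\hat\Psi=\hat\Psi(L,K)$ is square-integrable; and $$\mathbb E\big[\mathrm{var}(\hat\Psi\mid\sigma_Z)\big]\le C_{\mathrm V}\,C\,n^{-1},$$ a bound that needs no smoothness of $G$. Moreover $$\sup_{G\in\mathcal G(l,\beta,C_{\mathrm H})}\mathbb E\big[|\mathbb E[\hat\Psi\mid\sigma_Z]-\Psi|^2\big]\le C_{\mathrm H}^2\,C\,n^{-2(l+\beta)/d}.$$ Hence, if $l+\beta\ge d/2$, $$\sup_{G\in\mathcal G(l,\beta,C_{\mathrm H})}\mathbb E\big[|\hat\Psi-\Psi|^2\big]\le (C_{\mathrm V}+C_{\mathrm H}^2)\,C\,n^{-1},$$ and if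 $l+\beta>d/2$ the squared bias is negligible: $n\cdot\sup_{G\in\mathcal G(l,\beta,C_{\mathrm H})}\mathbb E\big[|\mathbb E[\hat\Psi\mid\sigma_Z]-\Psi|^2\big]\to0$ as $n\to\infty$. The suprema are over all laws of $(U,Z)$, all $g$ and all sets $S,S^*$ as above, with the given constants, such that $G$ lies in the class. -/

import Mathlib

open MeasureTheory ProbabilityTheory

universe u v

/-- Multi-indices `κ ∈ ℕ₀^d` with `|κ| ≤ L`. (Every entry of such a `κ` is at most `L`.) -/
abbrev MultiIndex (d L : ℕ) : Type :=
  {κ : Fin d → Fin (L + 1) // ∑ k, (κ k : ℕ) ≤ L}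

/-- The multi-index `(0, …, 0)`. -/
def MultiIndex.zero (d L : ℕ) : MultiIndex d L :=
  ⟨fun _ => 0, by simp⟩

/-- `K^*(d, L)`, the number of multi-indices `κ ∈ ℕ₀^d` with `|κ| ≤ L`. -/
def numMonomials (d L : ℕ) : ℕ := Fintype.card (MultiIndex d L)

/-- `D(d, L) = ∑_{m=1}^L m * binom(d + m - 1, m)`. -/
def degreeSum (d L : ℕ) : ℕ := ∑ m ∈ Finset.Icc 1 L, m * (d + m - 1).choose m

/-- The centred monomials `ξ_κ(z, w) = ∏ₖ (wₖ - zₖ) ^ κₖ`, as a vector indexed by `κ`. -/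
noncomputable def monomialVector {d : ℕ} (L : ℕ) (z w : EuclideanSpace ℝ (Fin d)) :
    MultiIndex d L → ℝ :=
  fun κ => ∏ k, (w k - z k) ^ (κ.1 k : ℕ)

/-- The Voronoi cell `C(J)` in `Sstar` of an index set `J`, for the points `z₁, …, zₙ`. -/
def voronoiCell {d n : ℕ} (Sstar : Set (EuclideanSpace ℝ (Fin d)))
    (z : Fin n → EuclideanSpace ℝ (Fin d)) (J : Finset (Fin n)) :
    Set (EuclideanSpace ℝ (Fin d)) :=
  {x | x ∈ Sstar ∧ ∀ j ∈ J, ∀ k ∉ J, ‖x - z j‖ < ‖x - z k‖}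

/-- The design matrix `M_J(x) = ∑_{j ∈ J} ξ(x, zⱼ) ξ(x, zⱼ)ᵀ`. -/
noncomputable def designMatrix {d n : ℕ} (L : ℕ) (z : Fin n → EuclideanSpace ℝ (Fin d))
    (J : Finset (Fin n)) (x : EuclideanSpace ℝ (Fin d)) :
    Matrix (MultiIndex d L) (MultiIndex d L) ℝ :=
  ∑ j ∈ J, Matrix.vecMulVec (monomialVector L x (z j)) (monomialVector L x (z j))

/-- The value at `x` of the least squares polynomial of degree `L`, when regressing the
responses `yⱼ` on the `zⱼ` with `j ∈ J`, that is the entry with index `(0, …, 0)` of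
`M_J(x)⁻¹ ∑_{j ∈ J} yⱼ ξ(x, zⱼ)`. -/
noncomputable def localFit {d n : ℕ} (L : ℕ) (z : Fin n → EuclideanSpace ℝ (Fin d))
    (y : Fin n → ℝ) (J : Finset (Fin n)) (x : EuclideanSpace ℝ (Fin d)) : ℝ :=
  ((designMatrix L z J x)⁻¹.mulVec (∑ j ∈ J, y j • monomialVector L x (z j)))
    (MultiIndex.zero d L)

/-- The estimator `Ψ̂(L, K) = ∑_{#J = K} ∫_{C(J)} Ĝ(x) dx`. -/
noncomputable def estimator {d n : ℕ} (Sstar : Set (EuclideanSpace ℝ (Fin d))) (L K : ℕ)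
    (z : Fin n → EuclideanSpace ℝ (Fin d)) (y : Fin n → ℝ) : ℝ :=
  ∑ J ∈ Finset.powersetCard K Finset.univ, ∫ x in voronoiCell Sstar z J, localFit L z y J x

/-- The Hölder class on an open set `V`: functions with (continuous) partial derivatives of
order `≤ l`, all of whose partial derivatives of order `l` are `β`-Hölder with constant `CH`.
A sequence `s` of `l` coordinates stands for the partial derivative
`∂^l h / ∂x_{s 0} ⋯ ∂x_{s (l-1)}`. -/
def HolderClass {d : ℕ} (V : Set (EuclideanSpace ℝ (Fin d))) (l : ℕ) (β CH : ℝ)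
    (h : EuclideanSpace ℝ (Fin d) → ℝ) : Prop :=
  ContDiffOn ℝ l h V ∧
    ∀ s : Fin l → Fin d, ∀ x ∈ V, ∀ x' ∈ V,
      |iteratedFDeriv ℝ l h x (fun i => EuclideanSpace.single (s i) (1 : ℝ)) -
        iteratedFDeriv ℝ l h x' (fun i => EuclideanSpace.single (s i) (1 : ℝ))|
        ≤ CH * ‖x - x'‖ ^ β

/-- The law `ν` of the covariate has the compact convex support `S` of diameter `diamS`, and
a Lebesgue density `f` with values in `[ρ, ρbar]` on `S`. -/
structure IsDesign {d : ℕ} (ν : Measure (EuclideanSpace ℝ (Fin d)))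
    (f : EuclideanSpace ℝ (Fin d) → ℝ) (S : Set (EuclideanSpace ℝ (Fin d)))
    (ρ ρbar diamS : ℝ) : Prop where
  support_eq : ν.support = S
  isCompact : IsCompact S
  convex : Convex ℝ S
  diam_eq : Metric.diam S = diamS
  measurable : Measurable f
  nonneg : ∀ x, 0 ≤ f x
  density : ν = (volume : Measure (EuclideanSpace ℝ (Fin d))).withDensity
    (fun x => ENNReal.ofReal (f x))
  lower : ∀ x ∈ S, ρ ≤ f x
  upper : ∀ x ∈ S, f x ≤ ρbar

/-- `Sstar` is a non-empty Borel subset of `S` of Lebesgue measure `vol`, and the balls of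
radius `r` around its points are included in `S`. -/
structure IsInnerSet {d : ℕ} (S Sstar : Set (EuclideanSpace ℝ (Fin d))) (r vol : ℝ) :
    Prop where
  subset : Sstar ⊆ S
  nonempty : Sstar.Nonempty
  measurableSet : MeasurableSet Sstar
  volume_eq : (volume : Measure (EuclideanSpace ℝ (Fin d))).real Sstar = vol
  ball_subset : ∀ x ∈ Sstar, Metric.ball x r ⊆ S

/-- Under the law `P` of `(U, Z)`, `G` is the regression function of the square-integrable
variable `g(U, Z)` on `Z`, and the conditional variance of `g(U, Z)` given `Z` is at most
`CV`. -/
structure IsRegression {𝒰 : Type*} [MeasurableSpace 𝒰] {d : ℕ}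
    (P : Measure (𝒰 × EuclideanSpace ℝ (Fin d))) (g : 𝒰 × EuclideanSpace ℝ (Fin d) → ℝ)
    (G : EuclideanSpace ℝ (Fin d) → ℝ) (CV : ℝ) : Prop where
  measurable : Measurable g
  memLp : MemLp g 2 P
  condExp_eq :
    P[g | MeasurableSpace.comap (Prod.snd : 𝒰 × EuclideanSpace ℝ (Fin d) → _) inferInstance]
      =ᵐ[P] fun p => G p.2
  condVar_le : ∀ᵐ p ∂P,
    condVar (MeasurableSpace.comap (Prod.snd : 𝒰 × EuclideanSpace ℝ (Fin d) → _) inferInstance)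
      g P p ≤ CV

/-- All standing hypotheses on the population: `P` is the law of `(U, Z)`, `f` the density of
`Z`, `S` the support of `Z`, `Sstar` the domain of integration, `G` the regression function of
`g(U, Z)` on `Z`. Smoothness of `G` is not part of it. -/
structure IsPopulation {𝒰 : Type*} [MeasurableSpace 𝒰] {d : ℕ}
    (P : Measure (𝒰 × EuclideanSpace ℝ (Fin d))) (g : 𝒰 × EuclideanSpace ℝ (Fin d) → ℝ)
    (f G : EuclideanSpace ℝ (Fin d) → ℝ) (S Sstar : Set (EuclideanSpace ℝ (Fin d)))
    (ρ ρbar r diamS vol CV : ℝ) : Prop where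
  isProbabilityMeasure : IsProbabilityMeasure P
  design : IsDesign (P.map Prod.snd) f S ρ ρbar diamS
  inner : IsInnerSet S Sstar r vol
  regression : IsRegression P g G CV

/-- `Ψ = E[g(U, Z) 1_{Sstar}(Z) / f(Z)]`. -/
noncomputable def targetFunctional {𝒰 : Type*} [MeasurableSpace 𝒰] {d : ℕ}
    (P : Measure (𝒰 × EuclideanSpace ℝ (Fin d))) (g : 𝒰 × EuclideanSpace ℝ (Fin d) → ℝ)
    (f : EuclideanSpace ℝ (Fin d) → ℝ) (Sstar : Set (EuclideanSpace ℝ (Fin d))) : ℝ :=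
  ∫ p, g p * (Sstar.indicator (fun _ => (1 : ℝ)) p.2 / f p.2) ∂P

/-- `(U₁, Z₁), …, (Uₙ, Zₙ)` are independent and identically distributed with law `P`. -/
structure IsSample {Ω 𝒰 : Type*} [MeasurableSpace Ω] [MeasurableSpace 𝒰] {d n : ℕ}
    (μ : Measure Ω) (U : Fin n → Ω → 𝒰) (Z : Fin n → Ω → EuclideanSpace ℝ (Fin d))
    (P : Measure (𝒰 × EuclideanSpace ℝ (Fin d))) : Prop where
  measurable_U : ∀ j, Measurable (U j)
  measurable_Z : ∀ j, Measurable (Z j)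
  indep : iIndepFun (fun j ω => (U j ω, Z j ω)) μ
  law : ∀ j, μ.map (fun ω => (U j ω, Z j ω)) = P

/-- The `σ`-field generated by `Z₁, …, Zₙ`. -/
abbrev sigmaZ {Ω : Type*} {d n : ℕ} (Z : Fin n → Ω → EuclideanSpace ℝ (Fin d)) :
    MeasurableSpace Ω :=
  MeasurableSpace.comap (fun ω j => Z j ω) inferInstance

/-- The estimator as a random variable: the responses are `g(Uⱼ, Zⱼ)`. -/
noncomputable def sampleEstimator {Ω 𝒰 : Type*} {d n : ℕ}
    (Sstar : Set (EuclideanSpace ℝ (Fin d))) (L K : ℕ)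
    (g : 𝒰 × EuclideanSpace ℝ (Fin d) → ℝ)
    (U : Fin n → Ω → 𝒰) (Z : Fin n → Ω → EuclideanSpace ℝ (Fin d)) : Ω → ℝ :=
  fun ω => estimator Sstar L K (fun j => Z j ω) (fun j => g (U j ω, Z j ω))

/-- The estimator is well-defined almost surely: for almost every `x` in each cell `C(J)` the
design matrix is invertible, and the fitted function is integrable on each cell. -/
def EstimatorWellDefined {Ω 𝒰 : Type*} [MeasurableSpace Ω] {d n : ℕ} (μ : Measure Ω)
    (Sstar : Set (EuclideanSpace ℝ (Fin d))) (L K : ℕ)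
    (g : 𝒰 × EuclideanSpace ℝ (Fin d) → ℝ)
    (U : Fin n → Ω → 𝒰) (Z : Fin n → Ω → EuclideanSpace ℝ (Fin d)) : Prop :=
  ∀ᵐ ω ∂μ, ∀ J ∈ Finset.powersetCard K (Finset.univ : Finset (Fin n)),
    (∀ᵐ x ∂((volume : Measure (EuclideanSpace ℝ (Fin d))).restrict
        (voronoiCell Sstar (fun j => Z j ω) J)),
      IsUnit (designMatrix L (fun j => Z j ω) J x).det) ∧
    IntegrableOn (localFit L (fun j => Z j ω) (fun j => g (U j ω, Z j ω)) J)
      (voronoiCell Sstar (fun j => Z j ω) J) volume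

open scoped ENNReal

/-! Given the covariates, the estimator is linear in the responses, with weights `Wⱼ =
estimatorWeight`, the integrals of the local least squares weights over the cells. The conditional
variance is then controlled by `CV * ∑ⱼ Wⱼ²`, and the conditional bias is the integrated error of
the local fit to noise-free responses. Both reduce to one quantity at a fixed point `x`: the sum of
squared weights of the fit (`fitRisk`), times a power of `1 + lam * R`, where `R` is the distance to
the farthest of the `K` nearest neighbours and `lam = n^(1/d)`. The core is
`exists_lintegral_cellMoment_le`: the expectation of this quantity is bounded uniformly in `n` and
in `x ∈ Sstar`.

The difficulty is that the design matrix may be nearly singular. By the Gauss–Markov argument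
(`sum_fitWeight_sq_le`), least squares does no worse than interpolation through any unisolvent
subset of `K*` neighbours, and by Cramer's rule the latter costs at most a constant times `Δ⁻²`,
where `Δ` is the determinant of the monomials at the rescaled points (`fitRisk_le_monomialDet`). The
function `Δ⁻²` need not be integrable. However, `Δ` is a non-zero polynomial of total degree at most
`D`, so `|Δ|^(-s)` is locally integrable when `s * D < 1`
(`MvPolynomial.lintegral_eval_rpow_ne_top`). A geometric mean of the bounds from `2D + 1` disjoint
groups of neighbours (`fitRisk_le_prod`) replaces the exponent `2` by `2 / (2D + 1)` in every group.
The two further neighbours required of `K` stay outside the groups: one is the farthest neighbour,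
whose distance fixes the scale, the other an observation that may carry an extra weight such as
`g²`, which is needed for square-integrability.

Once the farthest neighbour `m` is fixed, the groups, the other neighbours and the remaining
observations are independent, and the expectation factorises (`lintegral_momentMajorant`). The
neighbours other than `m` contribute a power `R^(d(K-1))`, the observations outside the ball at most
`exp(-c R^d)` each, and the number of index sets is at most `n^K`. The substitution `t = lam * R`
turns this into an integrable radial profile whose integral does not depend on `n`.

For the variance, `sum_estimatorWeight_sq_le` applies Cauchy–Schwarz with the weight `(1 + lam * ‖x
- Zⱼ‖)^(d+1)`. The integral of its reciprocal is of order `1/n`, and this is the whole gain; no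
bound on the size or number of the cells that involve `Zⱼ` is needed. For the bias, the weights
reproduce polynomials of degree `l`, so that only the Taylor remainder, of order `R^(l+β)`, is left
(`HolderClass.localFit_sub_sq_le`, `bias_sq_le`). Its square is `n^(-2(l+β)/d)` times a power of
`lam * R`, which the same moments control. -/

/-! ### Negative moments of polynomials -/

/-- The integral of a negative power of the distance to a point of the line, over `[-1, 1]`. -/
theorem exists_lintegral_enorm_sub_rpow_le (α : ℝ) (h0 : 0 ≤ α) (h1 : α < 1) :
    ∃ C : ℝ≥0∞, C ≠ ∞ ∧ ∀ b : ℝ, ∫⁻ t in Set.Icc (-1 : ℝ) 1, ‖t - b‖ₑ ^ (-α) ≤ C := by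
  have hfin : ∫⁻ t in Set.Icc (-1 : ℝ) 1, ‖t‖ₑ ^ (-α) ≠ ∞ := by
    have hI : IntegrableOn (fun t : ℝ => |t| ^ (-α)) (Set.Ioc (-1) 1) volume := by
      rw [← intervalIntegrable_iff_integrableOn_Ioc_of_le (by norm_num)]
      have h2 : IntervalIntegrable (fun t : ℝ => |t| ^ (-α)) volume 0 1 := by
        refine (intervalIntegral.intervalIntegrable_rpow' (a := 0) (b := 1)
          (by linarith : -1 < -α)).congr ?_
        intro t ht
        rw [Set.uIoc_of_le zero_le_one] at ht
        simp [abs_of_pos ht.1]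
      have h3 : IntervalIntegrable (fun t : ℝ => |t| ^ (-α)) volume (-1) 0 := by
        have := (IntervalIntegrable.comp_sub_left h2 0)
        simpa using this.symm
      exact h3.trans h2
    rw [← setLIntegral_congr (Ioc_ae_eq_Icc (α := ℝ) (a := -1) (b := 1) (μ := volume))]
    have := hI.2
    rw [hasFiniteIntegral_iff_enorm] at this
    refine ne_of_lt (lt_of_le_of_lt (lintegral_mono_ae ?_) this)
    have hz : ∀ᵐ t ∂(volume.restrict (Set.Ioc (-1 : ℝ) 1)), t ≠ 0 :=
      ae_restrict_of_ae (by simp [ae_iff])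
    filter_upwards [hz] with t ht
    rw [← ofReal_norm, ENNReal.ofReal_rpow_of_pos (by simpa using ht), Real.norm_eq_abs,
      ← ofReal_norm, Real.norm_of_nonneg (by positivity)]
  -- Where `t - b` lies in `[-1, 1]`, translation reduces to the singularity at the origin.
  -- Elsewhere the integrand is at most `1`, which gives the length `2` of the interval.
  refine ⟨(∫⁻ t in Set.Icc (-1 : ℝ) 1, ‖t‖ₑ ^ (-α)) + 2,
    ENNReal.add_ne_top.2 ⟨hfin, by simp⟩, fun b => ?_⟩
  have hm : Measurable fun t : ℝ => ‖t‖ₑ ^ (-α) := by fun_prop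
  rw [← lintegral_indicator measurableSet_Icc]
  calc ∫⁻ t, (Set.Icc (-1 : ℝ) 1).indicator (fun t => ‖t - b‖ₑ ^ (-α)) t
      ≤ ∫⁻ t, ((fun t => (Set.Icc (-1 : ℝ) 1).indicator (fun t => ‖t‖ₑ ^ (-α)) t) (t - b)
          + (Set.Icc (-1 : ℝ) 1).indicator 1 t) := by
        refine lintegral_mono fun t => ?_
        by_cases ht : t ∈ Set.Icc (-1 : ℝ) 1
        · rw [Set.indicator_of_mem ht]
          by_cases hb : t - b ∈ Set.Icc (-1 : ℝ) 1
          · simp [Set.indicator_of_mem hb]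
          · simp only [Set.indicator_of_notMem hb, Set.indicator_of_mem ht, zero_add]
            have : (1 : ℝ≥0∞) ≤ ‖t - b‖ₑ := by
              rw [← ofReal_norm, ← ENNReal.ofReal_one]
              apply ENNReal.ofReal_le_ofReal
              by_contra! hlt
              rw [Real.norm_eq_abs] at hlt
              exact hb ⟨by linarith [neg_abs_le (t - b)], by linarith [le_abs_self (t - b)]⟩
            rw [ENNReal.rpow_neg, ENNReal.inv_le_iff_inv_le]
            simpa using ENNReal.rpow_le_rpow this h0
        · simp [Set.indicator_of_notMem ht]
    _ = _ := by
        rw [lintegral_add_right _ (measurable_one.indicator measurableSet_Icc),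
          lintegral_sub_right_eq_self
            (fun t => (Set.Icc (-1 : ℝ) 1).indicator (fun t => ‖t‖ₑ ^ (-α)) t) b,
          lintegral_indicator measurableSet_Icc, lintegral_indicator measurableSet_Icc]
        simp
        norm_num

/-- A negative power of the product of the distances to `m` points. -/
theorem exists_lintegral_prod_sub_rpow_le (s : ℝ) (m : ℕ) (hs : 0 ≤ s) (h1 : s * m < 1) :
    ∃ C : ℝ≥0∞, C ≠ ∞ ∧ ∀ b : Multiset ℝ, b.card = m →
      ∫⁻ t in Set.Icc (-1 : ℝ) 1, (b.map fun r => ‖t - r‖ₑ ^ (-s)).prod ≤ C := by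
  obtain ⟨C, hC, hb⟩ := exists_lintegral_enorm_sub_rpow_le (s * m) (by positivity) h1
  refine ⟨m * C + 2, by finiteness, fun b hcard => ?_⟩
  rcases Nat.eq_zero_or_pos m with rfl | hm
  · rw [Multiset.card_eq_zero] at hcard
    subst hcard
    simp
    norm_num
  -- The product of `m` factors is at most the `m`-th power of the largest, hence at most the sum of
  -- all `m`-th powers. This separates the roots, at the price of the exponent `s * m < 1`.
  have key : ∀ t : ℝ, (b.map fun r => ‖t - r‖ₑ ^ (-s)).prod
      ≤ (b.map fun r => ‖t - r‖ₑ ^ (-(s * m))).sum := by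
    intro t
    have hne : b ≠ 0 := by
      rintro rfl; simp at hcard; omega
    obtain ⟨r, hr, hmax⟩ := Multiset.exists_max_image (fun r => ‖t - r‖ₑ ^ (-s)) hne
    have h1 : (b.map fun r => ‖t - r‖ₑ ^ (-s)).prod ≤ (‖t - r‖ₑ ^ (-s)) ^ m := by
      have := Multiset.prod_le_pow_card (b.map fun r => ‖t - r‖ₑ ^ (-s)) (‖t - r‖ₑ ^ (-s))
        (by
          intro x hx
          obtain ⟨r', hr', rfl⟩ := Multiset.mem_map.1 hx
          exact hmax r' hr')
      simpa [hcard] using this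
    refine h1.trans ?_
    rw [← ENNReal.rpow_natCast, ← ENNReal.rpow_mul, neg_mul]
    exact Multiset.single_le_sum (fun _ _ => zero_le) _ (Multiset.mem_map_of_mem _ hr)
  have hsum : ∀ b : Multiset ℝ, ∫⁻ t in Set.Icc (-1 : ℝ) 1,
      (b.map fun r => ‖t - r‖ₑ ^ (-(s * m))).sum ≤ b.card * C := by
    intro b
    induction b using Multiset.induction with
    | empty => simp
    | cons r b ih =>
      simp only [Multiset.map_cons, Multiset.sum_cons, Multiset.card_cons]
      rw [lintegral_add_left (by fun_prop), add_comm]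
      push_cast
      rw [add_mul, one_mul]
      exact add_le_add ih (hb r)
  calc _ ≤ ∫⁻ t in Set.Icc (-1 : ℝ) 1, (b.map fun r => ‖t - r‖ₑ ^ (-(s * m))).sum :=
        lintegral_mono key
    _ ≤ b.card * C := hsum b
    _ ≤ _ := by rw [hcard]; exact le_self_add

/-- A real polynomial is bounded below through the real parts of its complex roots. -/
theorem Polynomial.exists_enorm_eval_ge (p : Polynomial ℝ) :
    ∃ b : Multiset ℝ, b.card = p.natDegree ∧
      ∀ t : ℝ, ‖p.leadingCoeff‖ₑ * (b.map fun r => ‖t - r‖ₑ).prod ≤ ‖p.eval t‖ₑ := by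
  set q := p.map (algebraMap ℝ ℂ) with hq
  have hsp : q.Splits := IsAlgClosed.splits q
  refine ⟨q.roots.map Complex.re, ?_, fun t => ?_⟩
  · rw [Multiset.card_map, ← hsp.natDegree_eq_card_roots, hq,
      Polynomial.natDegree_map]
  · have h1 : ((p.eval t : ℝ) : ℂ) = q.leadingCoeff * (q.roots.map fun a => (t : ℂ) - a).prod := by
      rw [← hsp.eval_eq_prod_roots, hq, Polynomial.eval_map_algebraMap]
      exact (Polynomial.aeval_algebraMap_apply_eq_algebraMap_eval t p).symm
    have h2 : ‖p.eval t‖ₑ = ‖((p.eval t : ℝ) : ℂ)‖ₑ := by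
      simp [← ofReal_norm]
    have hlc : ‖q.leadingCoeff‖ₑ = ‖p.leadingCoeff‖ₑ := by
      rw [hq, Polynomial.leadingCoeff_map]
      simp [← ofReal_norm]
    -- For real `t`, replacing a complex root by its real part can only decrease the distance to
    -- `t`.
    have hpr : ∀ m : Multiset ℂ, ((m.map Complex.re).map fun r => ‖t - r‖ₑ).prod
        ≤ ‖(m.map fun a => (t : ℂ) - a).prod‖ₑ := by
      intro m
      induction m using Multiset.induction with
      | empty => simp
      | cons a m ih =>
        simp only [Multiset.map_cons, Multiset.prod_cons, enorm_mul]
        refine mul_le_mul' ?_ ih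
        rw [← ofReal_norm, ← ofReal_norm]
        apply ENNReal.ofReal_le_ofReal
        have := Complex.abs_re_le_norm ((t : ℂ) - a)
        simpa using this
    rw [h2, h1, enorm_mul, hlc]
    exact mul_le_mul_right (hpr _) _

/-- Negative moments of a univariate polynomial, in terms of the leading coefficient. -/
theorem Polynomial.exists_lintegral_eval_rpow_le (s : ℝ) (m : ℕ) (hs : 0 < s) (h1 : s * m < 1) :
    ∃ C : ℝ≥0∞, C ≠ ∞ ∧ ∀ p : Polynomial ℝ, p.natDegree = m →
      ∫⁻ t in Set.Icc (-1 : ℝ) 1, ‖p.eval t‖ₑ ^ (-s) ≤ ‖p.leadingCoeff‖ₑ ^ (-s) * C := by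
  obtain ⟨C, hC, hb⟩ := exists_lintegral_prod_sub_rpow_le s m hs.le h1
  refine ⟨C, hC, fun p hp => ?_⟩
  obtain ⟨b, hcard, hle⟩ := p.exists_enorm_eval_ge
  have hprod : ∀ (t : ℝ) (b : Multiset ℝ), (b.map fun r => ‖t - r‖ₑ).prod ^ (-s)
      = (b.map fun r => ‖t - r‖ₑ ^ (-s)).prod := by
    intro t b
    induction b using Multiset.induction with
    | empty => simp
    | cons a m ih =>
      simp only [Multiset.map_cons, Multiset.prod_cons]
      rw [ENNReal.mul_rpow_of_ne_top (by finiteness), ih]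
      have : ∀ m : Multiset ℝ, (m.map fun r => ‖t - r‖ₑ).prod ≠ ∞ := by
        intro m
        induction m using Multiset.induction with
        | empty => simp
        | cons a m ih =>
          simp only [Multiset.map_cons, Multiset.prod_cons]
          finiteness
      exact this m
  have hanti : ∀ a c : ℝ≥0∞, a ≤ c → c ^ (-s) ≤ a ^ (-s) := by
    intro a c hac
    rw [ENNReal.rpow_neg, ENNReal.rpow_neg]
    exact ENNReal.inv_le_inv.2 (ENNReal.rpow_le_rpow hac hs.le)
  have hfin : ∀ t : ℝ, (b.map fun r => ‖t - r‖ₑ).prod ≠ ∞ := by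
    intro t
    generalize b = b
    induction b using Multiset.induction with
    | empty => simp
    | cons a m ih =>
      simp only [Multiset.map_cons, Multiset.prod_cons]
      finiteness
  have hmeas : ∀ b : Multiset ℝ, Measurable fun t : ℝ => (b.map fun r => ‖t - r‖ₑ ^ (-s)).prod := by
    intro b
    induction b using Multiset.induction with
    | empty => simp
    | cons a m ih =>
      simp only [Multiset.map_cons, Multiset.prod_cons]
      exact Measurable.mul (by fun_prop) ih
  calc ∫⁻ t in Set.Icc (-1 : ℝ) 1, ‖p.eval t‖ₑ ^ (-s)
      ≤ ∫⁻ t in Set.Icc (-1 : ℝ) 1, ‖p.leadingCoeff‖ₑ ^ (-s)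
          * (b.map fun r => ‖t - r‖ₑ ^ (-s)).prod := by
        refine lintegral_mono fun t => ?_
        refine (hanti _ _ (hle t)).trans (le_of_eq ?_)
        rw [ENNReal.mul_rpow_of_ne_top (by finiteness) (hfin t), hprod]
    _ = ‖p.leadingCoeff‖ₑ ^ (-s)
          * ∫⁻ t in Set.Icc (-1 : ℝ) 1, (b.map fun r => ‖t - r‖ₑ ^ (-s)).prod :=
        lintegral_const_mul _ (hmeas b)
    _ ≤ _ := by gcongr; exact hb b (hcard.trans hp)

/-- Small negative moments of a non-zero polynomial over a cube are finite. -/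
theorem MvPolynomial.lintegral_eval_rpow_ne_top {n : ℕ} (p : MvPolynomial (Fin n) ℝ) (hp : p ≠ 0)
    (s : ℝ) (hs : 0 < s) (h1 : s * p.totalDegree < 1) :
    ∫⁻ x in Set.univ.pi fun _ => Set.Icc (-1 : ℝ) 1, ‖MvPolynomial.eval x p‖ₑ ^ (-s) ≠ ∞ := by
  induction n with
  | zero =>
    obtain ⟨c, rfl⟩ := MvPolynomial.C_surjective (Fin 0) p
    have hc : c ≠ 0 := by rintro rfl; simp at hp
    simp only [MvPolynomial.eval_C, lintegral_const]
    refine ENNReal.mul_ne_top (ENNReal.rpow_ne_top_of_ne_zero (by simpa using hc) (by finiteness)) ?_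
    simp
  | succ n ih =>
    -- The polynomial is regarded as univariate in the first variable. Integrating that variable
    -- leaves the same negative power of the leading coefficient, a polynomial in fewer variables.
    -- Its total degree and the degree in the first variable add up to at most `p.totalDegree`, so
    -- both conditions on `s` are inherited.
    set q := MvPolynomial.finSuccEquiv ℝ n p with hq
    have hq0 : q ≠ 0 := by simpa [hq] using hp
    have hlc : q.leadingCoeff ≠ 0 := by simpa using hq0
    have hdeg : q.leadingCoeff.totalDegree + q.natDegree ≤ p.totalDegree :=
      MvPolynomial.totalDegree_coeff_finSuccEquiv_add_le p _ hlc
    have hdeg' : ((q.leadingCoeff.totalDegree : ℕ) : ℝ) + q.natDegree ≤ p.totalDegree := by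
      exact_mod_cast hdeg
    have hn : s * q.natDegree < 1 := by
      refine lt_of_le_of_lt ?_ h1
      gcongr
      linarith [(Nat.cast_nonneg q.leadingCoeff.totalDegree : (0 : ℝ) ≤ _)]
    obtain ⟨C, hC, hle⟩ := Polynomial.exists_lintegral_eval_rpow_le s q.natDegree hs hn
    have hI := ih q.leadingCoeff hlc (by
      refine lt_of_le_of_lt ?_ h1
      gcongr
      linarith [(Nat.cast_nonneg q.natDegree : (0 : ℝ) ≤ _)])
    have hmp := (volume_preserving_piFinSuccAbove (fun _ : Fin (n + 1) => ℝ) 0).symm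
    rw [← lintegral_indicator (MeasurableSet.univ_pi fun _ => measurableSet_Icc),
      ← hmp.lintegral_comp ?_]
    swap
    · refine Measurable.indicator ?_ (MeasurableSet.univ_pi fun _ => measurableSet_Icc)
      have : Measurable fun x : Fin (n + 1) → ℝ => MvPolynomial.eval x p :=
        (MvPolynomial.continuous_eval p).measurable
      fun_prop
    rw [Measure.volume_eq_prod, lintegral_prod_symm]
    swap
    · refine (Measurable.comp (Measurable.indicator ?_ (MeasurableSet.univ_pi fun _ =>
        measurableSet_Icc)) hmp.measurable).aemeasurable
      have : Measurable fun x : Fin (n + 1) → ℝ => MvPolynomial.eval x p :=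
        (MvPolynomial.continuous_eval p).measurable
      fun_prop
    -- Where the leading coefficient vanishes, the right side is infinite and nothing is to be
    -- shown. This needs a non-zero factor, hence `C + 2` instead of `C`.
    have key : ∀ y : Fin n → ℝ, ∫⁻ t : ℝ, (Set.univ.pi fun _ => Set.Icc (-1 : ℝ) 1).indicator
        (fun x => ‖MvPolynomial.eval x p‖ₑ ^ (-s)) (Fin.cons t y : Fin (n + 1) → ℝ)
        ≤ (Set.univ.pi fun _ => Set.Icc (-1 : ℝ) 1).indicator
          (fun y => ‖MvPolynomial.eval y q.leadingCoeff‖ₑ ^ (-s)) y * (C + 2) := by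
      intro y
      by_cases hy : y ∈ Set.univ.pi fun _ : Fin n => Set.Icc (-1 : ℝ) 1
      · rw [Set.indicator_of_mem hy]
        by_cases h0 : MvPolynomial.eval y q.leadingCoeff = 0
        · rw [h0]
          simp only [enorm_zero]
          rw [ENNReal.zero_rpow_of_neg (by linarith), ENNReal.top_mul (by simp)]
          exact le_top
        · have hmapdeg := Polynomial.natDegree_map_of_leadingCoeff_ne_zero
            (MvPolynomial.eval y) h0
          have := hle (q.map (MvPolynomial.eval y)) hmapdeg
          rw [Polynomial.leadingCoeff_map_of_leadingCoeff_ne_zero _ h0] at this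
          refine le_trans ?_ (this.trans (mul_le_mul_right le_self_add _))
          rw [← lintegral_indicator measurableSet_Icc]
          refine lintegral_mono fun t => ?_
          by_cases ht : t ∈ Set.Icc (-1 : ℝ) 1
          · rw [Set.indicator_of_mem ht]
            refine (Set.indicator_le_self _ _ _).trans (le_of_eq ?_)
            rw [MvPolynomial.eval_eq_eval_mv_eval']
          · rw [Set.indicator_of_notMem ht, Set.indicator_of_notMem]
            intro h
            exact ht (by simpa using h 0 trivial)
      · rw [Set.indicator_of_notMem hy, zero_mul]
        refine le_of_eq ?_
        convert lintegral_zero with t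
        rw [Set.indicator_of_notMem]
        intro h
        refine hy fun i _ => ?_
        simpa using h i.succ trivial
    refine ne_of_lt (lt_of_le_of_lt (b := ∫⁻ y : Fin n → ℝ,
      (Set.univ.pi fun _ => Set.Icc (-1 : ℝ) 1).indicator
        (fun y => ‖MvPolynomial.eval y q.leadingCoeff‖ₑ ^ (-s)) y * (C + 2))
      (lintegral_mono fun y => ?_) ?_)
    · refine le_trans (le_of_eq ?_) (key y)
      refine lintegral_congr fun t => ?_
      simp [MeasurableEquiv.piFinSuccAbove_symm_apply, Fin.insertNthEquiv]
    · rw [lintegral_mul_const' _ _ (by finiteness),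
        lintegral_indicator (MeasurableSet.univ_pi fun _ => measurableSet_Icc)]
      exact ENNReal.mul_lt_top (lt_top_iff_ne_top.2 hI) (by finiteness)

/-! ### The determinant of monomials as a polynomial -/

/-- The total degree of the product of all monomials of degree at most `L`. -/
theorem sum_multiIndex_le_degreeSum (d L : ℕ) :
    ∑ κ : MultiIndex d L, ∑ k, (κ.1 k : ℕ) ≤ degreeSum d L := by
  classical
  have hfib : ∀ m ∈ Finset.Icc 1 L,
      (Finset.univ.filter fun κ : MultiIndex d L => ∑ k, (κ.1 k : ℕ) = m).card
        ≤ (d + m - 1).choose m := by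
    intro m _
    have := Finset.card_finsuppAntidiag_nat_eq_choose (s := (Finset.univ : Finset (Fin d))) m
    rw [Finset.card_univ, Fintype.card_fin] at this
    rw [← this]
    refine Finset.card_le_card_of_injOn
      (fun κ => Finsupp.equivFunOnFinite.symm fun k => (κ.1 k : ℕ)) ?_ ?_
    · intro κ hκ
      simp only [Finset.coe_filter, Finset.mem_univ, true_and, Set.mem_ofPred_eq] at hκ
      simp [Finset.mem_finsuppAntidiag, hκ]
    · intro κ _ κ' _ h
      have h' := Finsupp.equivFunOnFinite.symm.injective h
      ext k
      exact congrFun h' k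
  calc ∑ κ : MultiIndex d L, ∑ k, (κ.1 k : ℕ)
      = ∑ κ ∈ Finset.univ.filter (fun κ : MultiIndex d L => ∑ k, (κ.1 k : ℕ) ≠ 0),
          ∑ k, (κ.1 k : ℕ) := by
        rw [Finset.sum_filter_ne_zero]
    _ = ∑ m ∈ Finset.Icc 1 L, ∑ κ ∈ (Finset.univ.filter
          (fun κ : MultiIndex d L => ∑ k, (κ.1 k : ℕ) ≠ 0)) with ∑ k, (κ.1 k : ℕ) = m,
          ∑ k, (κ.1 k : ℕ) := by
        rw [Finset.sum_fiberwise_of_maps_to]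
        intro κ hκ
        simp only [Finset.mem_filter, Finset.mem_univ, true_and] at hκ
        exact Finset.mem_Icc.2 ⟨Nat.one_le_iff_ne_zero.2 hκ, κ.2⟩
    _ ≤ ∑ m ∈ Finset.Icc 1 L, m * (d + m - 1).choose m := by
        refine Finset.sum_le_sum fun m hm => ?_
        rw [Finset.sum_congr rfl (g := fun _ => m) (fun κ hκ => (Finset.mem_filter.1 hκ).2),
          Finset.sum_const, smul_eq_mul, mul_comm]
        refine Nat.mul_le_mul_left _ (le_trans (Finset.card_le_card ?_) (hfib m hm))
        intro κ hκ
        simp only [Finset.mem_filter, Finset.mem_univ, true_and] at hκ ⊢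
        exact hκ.2

/-- The determinant of the generic matrix of all monomials of degree at most `L`. -/
noncomputable def vandermondePoly (d L : ℕ) : MvPolynomial (MultiIndex d L × Fin d) ℝ :=
  Matrix.det (Matrix.of fun a κ : MultiIndex d L =>
    ∏ k, (MvPolynomial.X (a, k) : MvPolynomial (MultiIndex d L × Fin d) ℝ) ^ (κ.1 k : ℕ))

/-- Every term of the Leibniz expansion uses each monomial exactly once, so its degree is at most
the sum of `|κ|` over all multi-indices. -/
theorem vandermondePoly_totalDegree_le (d L : ℕ) :
    (vandermondePoly d L).totalDegree ≤ degreeSum d L := by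
  refine le_trans ?_ (sum_multiIndex_le_degreeSum d L)
  rw [vandermondePoly, Matrix.det_apply]
  refine MvPolynomial.totalDegree_finsetSum_le fun σ _ => ?_
  refine (MvPolynomial.totalDegree_smul_le _ _).trans ?_
  refine (MvPolynomial.totalDegree_finsetProd _ _).trans (Finset.sum_le_sum fun κ _ => ?_)
  rw [Matrix.of_apply]
  refine (MvPolynomial.totalDegree_finsetProd _ _).trans (Finset.sum_le_sum fun k _ => ?_)
  simp

/-- There is no cancellation in the Leibniz expansion: the exponents of the variables of the point
`a` spell out the multi-index `σ⁻¹ a`, so distinct permutations give distinct monomials. The one of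
the identity therefore has coefficient `1`. -/
theorem vandermondePoly_ne_zero (d L : ℕ) : vandermondePoly d L ≠ 0 := by
  classical
  let mon : Equiv.Perm (MultiIndex d L) → (MultiIndex d L × Fin d →₀ ℕ) := fun σ =>
    Finsupp.equivFunOnFinite.symm fun p => ((σ.symm p.1).1 p.2 : ℕ)
  have hprod : ∀ σ : Equiv.Perm (MultiIndex d L),
      ∏ κ : MultiIndex d L, ∏ k, (MvPolynomial.X (σ κ, k) :
        MvPolynomial (MultiIndex d L × Fin d) ℝ) ^ (κ.1 k : ℕ)
        = MvPolynomial.monomial (mon σ) 1 := by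
    intro σ
    rw [← MvPolynomial.prod_X_pow_eq_monomial, ← Equiv.prod_comp σ.symm]
    simp only [Equiv.apply_symm_apply]
    rw [← Fintype.prod_prod_type' fun a k => (MvPolynomial.X (a, k) :
        MvPolynomial (MultiIndex d L × Fin d) ℝ) ^ ((σ.symm a).1 k : ℕ)]
    symm
    refine Finset.prod_subset (Finset.subset_univ _) fun p _ hp => ?_
    have : mon σ p = 0 := by simpa using hp
    rw [this, pow_zero]
  have hcoeff : MvPolynomial.coeff (mon 1) (vandermondePoly d L) = 1 := by
    rw [vandermondePoly, Matrix.det_apply, MvPolynomial.coeff_sum]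
    rw [Finset.sum_eq_single 1]
    · simp only [Matrix.of_apply, hprod]
      simp
    · intro σ _ hσ
      simp only [Matrix.of_apply, hprod]
      have : mon σ ≠ mon 1 := by
        intro h
        apply hσ
        have h' := Finsupp.equivFunOnFinite.symm.injective h
        have : σ.symm = 1 := by
          ext a k
          exact congrFun h' (a, k)
        calc σ = (σ.symm).symm := rfl
          _ = 1 := by rw [this]; rfl
      rw [MvPolynomial.coeff_smul, MvPolynomial.coeff_monomial, if_neg this, smul_zero]
    · simp
  intro h
  rw [h] at hcoeff
  simp at hcoeff

/-- The determinant of the values of all monomials of degree at most `L` at given points. -/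
noncomputable def monomialDet {d : ℕ} (L : ℕ) (u : MultiIndex d L → EuclideanSpace ℝ (Fin d)) :
    ℝ :=
  Matrix.det (Matrix.of fun a => monomialVector L 0 (u a))

theorem eval_vandermondePoly {d L : ℕ} (u : MultiIndex d L → EuclideanSpace ℝ (Fin d)) :
    MvPolynomial.eval (fun p => u p.1 p.2) (vandermondePoly d L) = monomialDet L u := by
  rw [vandermondePoly, monomialDet, RingHom.map_det]
  congr 1
  ext a κ
  simp [monomialVector]

theorem continuous_monomialDet {d : ℕ} (L : ℕ) : Continuous (monomialDet (d := d) L) := by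
  have : monomialDet (d := d) L = fun u : MultiIndex d L → EuclideanSpace ℝ (Fin d) =>
      MvPolynomial.eval (fun p : MultiIndex d L × Fin d => u p.1 p.2) (vandermondePoly d L) := by
    funext u
    exact (eval_vandermondePoly u).symm
  rw [this]
  refine (MvPolynomial.continuous_eval _).comp ?_
  fun_prop

theorem measurable_monomialDet_rpow {d : ℕ} (L : ℕ) (s : ℝ) :
    Measurable fun u : MultiIndex d L → EuclideanSpace ℝ (Fin d) =>
      ‖monomialDet L u‖ₑ ^ (-s) := by
  have := (continuous_monomialDet (d := d) L).measurable
  fun_prop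

theorem measurePreserving_uncurry_pi {α δ X : Type*} [Fintype α] [Fintype δ] [MeasurableSpace X]
    (μ : Measure X) [SigmaFinite μ] :
    MeasurePreserving (fun (z : α → δ → X) (p : α × δ) => z p.1 p.2)
      (Measure.pi fun _ => Measure.pi fun _ => μ) (Measure.pi fun _ => μ) := by
  refine ⟨by fun_prop, ?_⟩
  symm
  refine Measure.pi_eq fun s hs => ?_
  rw [Measure.map_apply (by fun_prop) (MeasurableSet.univ_pi hs)]
  have : (fun (z : α → δ → X) (p : α × δ) => z p.1 p.2) ⁻¹' (Set.univ.pi s)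
      = Set.univ.pi fun a => Set.univ.pi fun k => s (a, k) := by
    ext z
    simp [Set.mem_pi]
  rw [this, Measure.pi_pi]
  simp_rw [Measure.pi_pi]
  rw [← Finset.univ_product_univ, Finset.prod_product]

/-- Small negative moments of the determinant of monomials over the unit ball are finite. -/
theorem lintegral_monomialDet_rpow_ne_top {d : ℕ} (L : ℕ) (s : ℝ) (hs : 0 < s)
    (h1 : s * degreeSum d L < 1) :
    ∫⁻ u : MultiIndex d L → EuclideanSpace ℝ (Fin d),
      (∏ a, (Metric.closedBall (0 : EuclideanSpace ℝ (Fin d)) 1).indicator 1 (u a))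
        * ‖monomialDet L u‖ₑ ^ (-s) ≠ ∞ := by
  classical
  let e : Fin (Fintype.card (MultiIndex d L × Fin d)) ≃ MultiIndex d L × Fin d :=
    (Fintype.equivFin _).symm
  set p := MvPolynomial.rename e.symm (vandermondePoly d L) with hp
  have hp0 : p ≠ 0 := by
    rw [hp, Ne, ← map_zero (MvPolynomial.rename e.symm),
      (MvPolynomial.rename_injective _ e.symm.injective).eq_iff]
    exact vandermondePoly_ne_zero d L
  have hdeg : s * p.totalDegree < 1 := by
    refine lt_of_le_of_lt ?_ h1
    gcongr
    exact (MvPolynomial.totalDegree_rename_le _ _).trans (vandermondePoly_totalDegree_le d L)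
  have hfin := p.lintegral_eval_rpow_ne_top hp0 s hs hdeg
  have m1 : MeasurePreserving (fun (u : MultiIndex d L → EuclideanSpace ℝ (Fin d)) a =>
      WithLp.ofLp (u a)) volume volume :=
    volume_preserving_pi fun _ => EuclideanSpace.volume_preserving_symm_measurableEquiv_toLp _
  have m2 := (measurePreserving_uncurry_pi (α := MultiIndex d L) (δ := Fin d)
    (volume : Measure ℝ)).comp m1
  have m3 := (volume_measurePreserving_piCongrLeft (fun _ => ℝ) e.symm).comp m2
  rw [← lintegral_indicator (MeasurableSet.univ_pi fun _ => measurableSet_Icc)] at hfin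
  rw [← m3.lintegral_comp] at hfin
  swap
  · refine Measurable.indicator ?_ (MeasurableSet.univ_pi fun _ => measurableSet_Icc)
    have := (MvPolynomial.continuous_eval p).measurable
    fun_prop
  have hval : ∀ (u : MultiIndex d L → EuclideanSpace ℝ (Fin d)) i,
      ((MeasurableEquiv.piCongrLeft (fun _ => ℝ) e.symm) ∘
        (fun (z : MultiIndex d L → Fin d → ℝ) p => z p.1 p.2) ∘
        fun u a => WithLp.ofLp (u a)) u i = u (e i).1 (e i).2 := by
    intro u i
    obtain ⟨p, rfl⟩ := e.symm.surjective i
    simp only [Function.comp_apply, MeasurableEquiv.coe_piCongrLeft,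
      Equiv.piCongrLeft_apply_apply, Equiv.apply_symm_apply]
  -- The Euclidean unit ball is contained in the cube `[-1, 1]^d`, so the integral over a product of
  -- balls is dominated by the one over the cube.
  refine ne_of_lt (lt_of_le_of_lt (lintegral_mono fun u => ?_) (lt_top_iff_ne_top.2 hfin))
  by_cases hu : ∀ a, u a ∈ Metric.closedBall (0 : EuclideanSpace ℝ (Fin d)) 1
  · rw [Finset.prod_eq_one (fun a _ => by rw [Set.indicator_of_mem (hu a)]; rfl), one_mul,
      Set.indicator_of_mem]
    · refine le_of_eq ?_
      congr 2
      rw [hp, MvPolynomial.eval_rename, ← eval_vandermondePoly]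
      congr 2
      funext p
      simpa using (hval u (e.symm p)).symm
    · intro i _
      rw [hval]
      have h1 := hu (e i).1
      rw [mem_closedBall_zero_iff] at h1
      have h3 : ‖u (e i).1 (e i).2‖ ≤ 1 := (PiLp.norm_apply_le _ _).trans h1
      exact ⟨(abs_le.1 h3).1, (abs_le.1 h3).2⟩
  · push Not at hu
    obtain ⟨a, ha⟩ := hu
    rw [Finset.prod_eq_zero (Finset.mem_univ a) (Set.indicator_of_notMem ha _), zero_mul]
    exact zero_le

/-! ### Product measures with bounded densities, and rescaling -/

/-- `OuterMeasure.pi` is the largest outer measure that is at most the product of the factors on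
boxes, so a comparison on boxes suffices. Only the smaller factors have to be σ-finite. -/
theorem MeasureTheory.Measure.pi_le_pi {ι : Type*} [Fintype ι] {X : ι → Type*}
    [∀ i, MeasurableSpace (X i)] {μ ν : ∀ i, Measure (X i)} [∀ i, SigmaFinite (μ i)]
    (h : ∀ i, μ i ≤ ν i) : Measure.pi μ ≤ Measure.pi ν := by
  have hle : (Measure.pi μ).toOuterMeasure ≤ OuterMeasure.pi fun i => (ν i).toOuterMeasure := by
    rw [OuterMeasure.le_pi]
    intro s _
    refine le_trans (le_of_eq (Measure.pi_pi μ s)) ?_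
    exact Finset.prod_le_prod' fun i _ => h i (s i)
  refine Measure.le_iff.2 fun s hs => ?_
  refine (hle s).trans (le_of_eq ?_)
  rw [Measure.pi, toMeasure_apply _ _ hs]

theorem MeasureTheory.Measure.pi_const_smul {ι X : Type*} [Fintype ι] [MeasurableSpace X]
    (μ : Measure X) [SigmaFinite μ] (c : NNReal) :
    Measure.pi (fun _ : ι => c • μ) = (c ^ Fintype.card ι) • Measure.pi fun _ : ι => μ := by
  refine Measure.pi_eq fun s _ => ?_
  rw [Measure.smul_apply, Measure.pi_pi]
  simp only [Measure.smul_apply, ENNReal.smul_def, smul_eq_mul]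
  rw [Finset.prod_mul_distrib]
  simp

/-- A change of variables for product measures with a bounded Lebesgue density. -/
theorem lintegral_pi_rescale_le {ι : Type*} [Fintype ι] {d : ℕ}
    (ν : Measure (EuclideanSpace ℝ (Fin d))) [SigmaFinite ν] (A : NNReal) (hν : ν ≤ A • volume)
    (x : EuclideanSpace ℝ (Fin d)) {R : ℝ} (hR : 0 < R)
    (F : (ι → EuclideanSpace ℝ (Fin d)) → ℝ≥0∞) (hF : Measurable F) :
    ∫⁻ z, F (fun a => R⁻¹ • (z a - x)) ∂(Measure.pi fun _ => ν)
      ≤ (A * ENNReal.ofReal (R ^ d)) ^ Fintype.card ι * ∫⁻ u, F u := by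
  have h1 : ∫⁻ z, F (fun a => R⁻¹ • (z a - x)) ∂(Measure.pi fun _ => ν)
      ≤ ∫⁻ z, F (fun a => R⁻¹ • (z a - x)) ∂(Measure.pi fun _ => A • volume) :=
    lintegral_mono' (Measure.pi_le_pi fun _ => hν) le_rfl
  refine h1.trans ?_
  rw [Measure.pi_const_smul, lintegral_smul_measure, ← volume_pi, mul_pow, mul_assoc,
    ENNReal.smul_def, smul_eq_mul, ENNReal.coe_pow]
  refine mul_le_mul_right (le_of_eq ?_) _
  have h2 : ∫⁻ z : ι → EuclideanSpace ℝ (Fin d), F (fun a => R⁻¹ • (z a - x))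
      = ∫⁻ z : ι → EuclideanSpace ℝ (Fin d), F (R⁻¹ • z) :=
    lintegral_sub_right_eq_self (fun z : ι → EuclideanSpace ℝ (Fin d) => F (R⁻¹ • z)) fun _ => x
  have h3 : ∫⁻ z : ι → EuclideanSpace ℝ (Fin d), F (R⁻¹ • z)
      = ∫⁻ u, F u ∂(Measure.map (R⁻¹ • ·) (volume : Measure (ι → EuclideanSpace ℝ (Fin d)))) :=
    (lintegral_map hF (measurable_const_smul _)).symm
  rw [h2, h3, Measure.map_addHaar_smul _ (inv_ne_zero hR.ne'), lintegral_smul_measure,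
    Module.finrank_pi_fintype]
  simp only [finrank_euclideanSpace, Fintype.card_fin, Finset.sum_const, Finset.card_univ,
    smul_eq_mul]
  congr 1
  rw [inv_pow, inv_inv, abs_of_pos (by positivity), mul_comm, pow_mul,
    ENNReal.ofReal_pow (by positivity)]

/-- The rescaled determinant of monomials under a product measure with bounded density. -/
theorem lintegral_monomialDet_rescale_le {d : ℕ} (L : ℕ) (s : ℝ)
    (ν : Measure (EuclideanSpace ℝ (Fin d))) [SigmaFinite ν] (A : NNReal) (hν : ν ≤ A • volume)
    (x : EuclideanSpace ℝ (Fin d)) {R : ℝ} (hR : 0 < R) :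
    ∫⁻ z : MultiIndex d L → EuclideanSpace ℝ (Fin d),
      (∏ a, (Metric.closedBall x R).indicator 1 (z a))
        * ‖monomialDet L fun a => R⁻¹ • (z a - x)‖ₑ ^ (-s) ∂(Measure.pi fun _ => ν)
    ≤ (A * ENNReal.ofReal (R ^ d)) ^ Fintype.card (MultiIndex d L) *
      ∫⁻ u : MultiIndex d L → EuclideanSpace ℝ (Fin d),
        (∏ a, (Metric.closedBall (0 : EuclideanSpace ℝ (Fin d)) 1).indicator 1 (u a))
          * ‖monomialDet L u‖ₑ ^ (-s) := by
  have hm : Measurable fun u : MultiIndex d L → EuclideanSpace ℝ (Fin d) =>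
      (∏ a, (Metric.closedBall (0 : EuclideanSpace ℝ (Fin d)) 1).indicator 
        (1 : EuclideanSpace ℝ (Fin d) → ℝ≥0∞) (u a))
          * ‖monomialDet L u‖ₑ ^ (-s) := by
    refine Measurable.mul (Finset.measurable_prod _ fun a _ => ?_) (measurable_monomialDet_rpow L s)
    exact (measurable_one.indicator Metric.isClosed_closedBall.measurableSet).comp
      (measurable_pi_apply a)
  refine le_trans (le_of_eq ?_) (lintegral_pi_rescale_le ν A hν x hR _ hm)
  refine lintegral_congr fun z => ?_
  congr 1
  refine Finset.prod_congr rfl fun a _ => ?_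
  have : z a ∈ Metric.closedBall x R ↔ R⁻¹ • (z a - x) ∈ Metric.closedBall 0 1 := by
    rw [mem_closedBall_iff_norm, mem_closedBall_zero_iff, norm_smul, norm_inv,
      Real.norm_of_nonneg hR.le, inv_mul_le_one₀ hR]
  by_cases h : z a ∈ Metric.closedBall x R
  · rw [Set.indicator_of_mem h, Set.indicator_of_mem (this.1 h)]; rfl
  · rw [Set.indicator_of_notMem h, Set.indicator_of_notMem (fun h' => h (this.2 h'))]

/-! ### Weights of the least squares fit -/

/-- The weight of the `j`-th response in the local fit at `x`. -/
noncomputable def fitWeight {d n : ℕ} (L : ℕ) (z : Fin n → EuclideanSpace ℝ (Fin d))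
    (J : Finset (Fin n)) (x : EuclideanSpace ℝ (Fin d)) (j : Fin n) : ℝ :=
  ((designMatrix L z J x)⁻¹.mulVec (monomialVector L x (z j))) (MultiIndex.zero d L)

theorem localFit_eq_sum {d n : ℕ} (L : ℕ) (z : Fin n → EuclideanSpace ℝ (Fin d))
    (y : Fin n → ℝ) (J : Finset (Fin n)) (x : EuclideanSpace ℝ (Fin d)) :
    localFit L z y J x = ∑ j ∈ J, y j * fitWeight L z J x j := by
  simp [localFit, fitWeight, Matrix.mulVec_sum, Matrix.mulVec_smul, Finset.sum_apply]

theorem designMatrix_mulVec {d n : ℕ} (L : ℕ) (z : Fin n → EuclideanSpace ℝ (Fin d))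
    (J : Finset (Fin n)) (x : EuclideanSpace ℝ (Fin d)) (c : MultiIndex d L → ℝ) :
    (designMatrix L z J x).mulVec c
      = ∑ j ∈ J, (monomialVector L x (z j) ⬝ᵥ c) • monomialVector L x (z j) := by
  rw [designMatrix, Matrix.sum_mulVec]
  refine Finset.sum_congr rfl fun j _ => ?_
  rw [Matrix.vecMulVec_mulVec]
  ext κ
  simp [mul_comm]

/-- The weights reproduce polynomials of degree at most `L` at the point `x`. -/
theorem sum_fitWeight_mul_monomialVector {d n : ℕ} {L : ℕ} {z : Fin n → EuclideanSpace ℝ (Fin d)}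
    {J : Finset (Fin n)} {x : EuclideanSpace ℝ (Fin d)}
    (h : IsUnit (designMatrix L z J x).det) (κ : MultiIndex d L) :
    ∑ j ∈ J, fitWeight L z J x j * monomialVector L x (z j) κ
      = if κ = MultiIndex.zero d L then 1 else 0 := by
  have h1 : ((designMatrix L z J x)⁻¹ * designMatrix L z J x) (MultiIndex.zero d L) κ
      = if κ = MultiIndex.zero d L then 1 else 0 := by
    rw [Matrix.nonsing_inv_mul _ h, Matrix.one_apply]
    simp [eq_comm]
  rw [← h1]
  suffices hA : ∀ A : Matrix (MultiIndex d L) (MultiIndex d L) ℝ,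
      ∑ j ∈ J, (A.mulVec (monomialVector L x (z j))) (MultiIndex.zero d L)
        * monomialVector L x (z j) κ
        = (A * designMatrix L z J x) (MultiIndex.zero d L) κ from hA _
  intro A
  rw [designMatrix, Matrix.mul_sum, Matrix.sum_apply]
  refine Finset.sum_congr rfl fun j _ => ?_
  rw [Matrix.mul_apply, Matrix.mulVec, dotProduct, Finset.sum_mul]
  refine Finset.sum_congr rfl fun a _ => ?_
  simp [Matrix.vecMulVec_apply, mul_assoc]

/-- The weights have the least sum of squares among the weights that reproduce polynomials. -/
theorem sum_fitWeight_sq_le {d n : ℕ} {L : ℕ} {z : Fin n → EuclideanSpace ℝ (Fin d)}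
    {J : Finset (Fin n)} {x : EuclideanSpace ℝ (Fin d)}
    (h : IsUnit (designMatrix L z J x).det) {α : Type*} [Fintype α] (e : α → Fin n)
    (he : Function.Injective e) (hJ : ∀ a, e a ∈ J) (y : α → ℝ)
    (hy : ∀ κ, ∑ a, y a * monomialVector L x (z (e a)) κ
      = if κ = MultiIndex.zero d L then 1 else 0) :
    ∑ j ∈ J, fitWeight L z J x j ^ 2 ≤ ∑ a, y a ^ 2 := by
  classical
  set c : MultiIndex d L → ℝ := fun κ => (designMatrix L z J x)⁻¹ (MultiIndex.zero d L) κ with hc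
  have hw : ∀ j, fitWeight L z J x j = ∑ κ, c κ * monomialVector L x (z j) κ := fun j => rfl
  -- The least squares weights are linear combinations `⟨c, ξⱼ⟩` of the monomials, so their inner
  -- product with any reproducing weights is `c₀`. Applied to themselves and to `y`, this makes `y -
  -- fitWeight` orthogonal to the least squares weights, and the claim is Pythagoras, up to the
  -- non-negative terms outside the range of `e`.
  have h1 : ∑ j ∈ J, fitWeight L z J x j ^ 2 = c (MultiIndex.zero d L) := by
    calc ∑ j ∈ J, fitWeight L z J x j ^ 2
        = ∑ j ∈ J, ∑ κ, c κ * (fitWeight L z J x j * monomialVector L x (z j) κ) := by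
          refine Finset.sum_congr rfl fun j _ => ?_
          rw [sq]
          nth_rewrite 2 [hw]
          rw [Finset.mul_sum]
          exact Finset.sum_congr rfl fun κ _ => by ring
      _ = ∑ κ, c κ * ∑ j ∈ J, fitWeight L z J x j * monomialVector L x (z j) κ := by
          rw [Finset.sum_comm]
          simp_rw [Finset.mul_sum]
      _ = _ := by
          simp_rw [sum_fitWeight_mul_monomialVector h]
          simp
  have h2 : ∑ a, y a * fitWeight L z J x (e a) = c (MultiIndex.zero d L) := by
    calc ∑ a, y a * fitWeight L z J x (e a)
        = ∑ a, ∑ κ, c κ * (y a * monomialVector L x (z (e a)) κ) := by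
          refine Finset.sum_congr rfl fun j _ => ?_
          rw [hw, Finset.mul_sum]
          exact Finset.sum_congr rfl fun κ _ => by ring
      _ = ∑ κ, c κ * ∑ a, y a * monomialVector L x (z (e a)) κ := by
          rw [Finset.sum_comm]
          simp_rw [Finset.mul_sum]
      _ = _ := by
          simp_rw [hy]
          simp
  have h3 : ∑ a, fitWeight L z J x (e a) ^ 2 ≤ ∑ j ∈ J, fitWeight L z J x j ^ 2 := by
    rw [← Finset.sum_image (s := Finset.univ) (g := e)
      (f := fun j => fitWeight L z J x j ^ 2) (fun a _ b _ hab => he hab)]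
    refine Finset.sum_le_sum_of_subset_of_nonneg ?_ fun _ _ _ => sq_nonneg _
    intro j hj
    obtain ⟨a, _, rfl⟩ := Finset.mem_image.1 hj
    exact hJ a
  have h4 : 0 ≤ ∑ a, (y a - fitWeight L z J x (e a)) ^ 2 :=
    Finset.sum_nonneg fun _ _ => sq_nonneg _
  have h5 : ∑ a, (y a - fitWeight L z J x (e a)) ^ 2
      = ∑ a, y a ^ 2 - 2 * ∑ a, y a * fitWeight L z J x (e a)
        + ∑ a, fitWeight L z J x (e a) ^ 2 := by
    rw [Finset.mul_sum, ← Finset.sum_sub_distrib, ← Finset.sum_add_distrib]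
    exact Finset.sum_congr rfl fun a _ => by ring
  linarith

theorem monomialVector_rescale {d : ℕ} (L : ℕ) (x w : EuclideanSpace ℝ (Fin d)) {R : ℝ}
    (hR : R ≠ 0) (κ : MultiIndex d L) :
    monomialVector L x w κ
      = R ^ (∑ k, (κ.1 k : ℕ)) * monomialVector L 0 (R⁻¹ • (w - x)) κ := by
  simp only [monomialVector]
  rw [← Finset.prod_pow_eq_pow_sum, ← Finset.prod_mul_distrib]
  refine Finset.prod_congr rfl fun k _ => ?_
  rw [← mul_pow]
  congr 1
  simp
  field_simp

theorem abs_monomialVector_zero_le_one {d : ℕ} (L : ℕ) {u : EuclideanSpace ℝ (Fin d)}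
    (hu : ‖u‖ ≤ 1) (κ : MultiIndex d L) : |monomialVector L 0 u κ| ≤ 1 := by
  rw [monomialVector, Finset.abs_prod]
  refine Finset.prod_le_one (fun _ _ => abs_nonneg _) fun k _ => ?_
  rw [abs_pow]
  refine pow_le_one₀ (abs_nonneg _) ?_
  have := (PiLp.norm_apply_le u k).trans hu
  simpa using this

/-- The design matrix is a Gram matrix: a kernel vector gives the coefficients of a polynomial that
vanishes at all `zⱼ` with `j ∈ J`. Rescaled, it lies in the kernel of the monomial matrix of the
subset `e`, whose determinant is non-zero. -/
theorem isUnit_det_designMatrix {d n : ℕ} {L : ℕ} {z : Fin n → EuclideanSpace ℝ (Fin d)}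
    {J : Finset (Fin n)} {x : EuclideanSpace ℝ (Fin d)} (e : MultiIndex d L → Fin n)
    (hJ : ∀ a, e a ∈ J) {R : ℝ} (hR : R ≠ 0)
    (h : monomialDet L (fun a => R⁻¹ • (z (e a) - x)) ≠ 0) :
    IsUnit (designMatrix L z J x).det := by
  rw [isUnit_iff_ne_zero]
  intro h0
  obtain ⟨c, hc0, hc⟩ := Matrix.exists_mulVec_eq_zero_iff.2 h0
  have h1 : ∑ j ∈ J, (monomialVector L x (z j) ⬝ᵥ c) ^ 2 = 0 := by
    have : c ⬝ᵥ (designMatrix L z J x).mulVec c = 0 := by rw [hc, dotProduct_zero]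
    rw [designMatrix_mulVec, dotProduct_sum] at this
    rw [← this]
    refine Finset.sum_congr rfl fun j _ => ?_
    rw [dotProduct_smul, smul_eq_mul, dotProduct_comm c, sq]
  rw [Finset.sum_eq_zero_iff_of_nonneg fun _ _ => sq_nonneg _] at h1
  apply hc0
  have h2 : (Matrix.of fun a => monomialVector L 0 (R⁻¹ • (z (e a) - x))).mulVec
      (fun κ => R ^ (∑ k, (κ.1 k : ℕ)) * c κ) = 0 := by
    ext a
    have := pow_eq_zero_iff (two_ne_zero) |>.1 (h1 (e a) (hJ a))
    rw [Pi.zero_apply, ← this]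
    simp only [Matrix.mulVec, dotProduct, Matrix.of_apply]
    refine Finset.sum_congr rfl fun κ _ => ?_
    rw [monomialVector_rescale L x (z (e a)) hR]
    ring
  have h3 : (fun κ : MultiIndex d L => R ^ (∑ k, (κ.1 k : ℕ)) * c κ) = 0 := by
    by_contra hne
    exact h (Matrix.exists_mulVec_eq_zero_iff.1 ⟨_, hne, h2⟩)
  funext κ
  have := congrFun h3 κ
  simpa [hR] using this

open Classical in
/-- The sum of squared weights of the local fit, infinite if the fit does not exist. -/
noncomputable def fitRisk {d n : ℕ} (L : ℕ) (z : Fin n → EuclideanSpace ℝ (Fin d))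
    (J : Finset (Fin n)) (x : EuclideanSpace ℝ (Fin d)) : ℝ≥0∞ :=
  if IsUnit (designMatrix L z J x).det then
    ENNReal.ofReal (∑ j ∈ J, fitWeight L z J x j ^ 2) else ∞

/-- The constant in the bound of the sum of squared weights by a determinant. -/
noncomputable def fitRiskConst (d L : ℕ) : ℝ≥0∞ :=
  ENNReal.ofReal (numMonomials d L * ((numMonomials d L).factorial : ℝ) ^ 2)

/-- Polynomial interpolation through the points of one group gives reproducing weights, namely a row
of the inverse of the rescaled monomial matrix. Least squares has no larger sum of squares, and
Cramer's rule bounds that row by the reciprocal determinant. A vanishing determinant makes the right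
side infinite. -/
theorem fitRisk_le_monomialDet {d n : ℕ} {L : ℕ} {z : Fin n → EuclideanSpace ℝ (Fin d)}
    {J : Finset (Fin n)} {x : EuclideanSpace ℝ (Fin d)} (e : MultiIndex d L → Fin n)
    (he : Function.Injective e) (hJ : ∀ a, e a ∈ J) {R : ℝ} (hR : 0 < R)
    (hball : ∀ a, z (e a) ∈ Metric.closedBall x R) :
    fitRisk L z J x ≤ fitRiskConst d L
      * ‖monomialDet L (fun a => R⁻¹ • (z (e a) - x))‖ₑ ^ (-2 : ℝ) := by
  classical
  have hcard : (1 : ℝ) ≤ numMonomials d L := by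
    have : 0 < Fintype.card (MultiIndex d L) := Fintype.card_pos_iff.2 ⟨MultiIndex.zero d L⟩
    exact_mod_cast this
  set Δ := monomialDet L (fun a => R⁻¹ • (z (e a) - x)) with hΔ
  by_cases h0 : Δ = 0
  · rw [h0, enorm_zero, ENNReal.zero_rpow_of_neg (by norm_num), ENNReal.mul_top]
    · exact le_top
    · rw [fitRiskConst, Ne, ENNReal.ofReal_eq_zero, not_le]
      have : (0 : ℝ) < (numMonomials d L).factorial := by exact_mod_cast Nat.factorial_pos _
      positivity
  have hu := isUnit_det_designMatrix (J := J) e hJ hR.ne' h0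
  rw [fitRisk, if_pos hu]
  set V : Matrix (MultiIndex d L) (MultiIndex d L) ℝ :=
    Matrix.of fun a => monomialVector L 0 (R⁻¹ • (z (e a) - x)) with hV
  have hdet : V.det = Δ := rfl
  have hVu : IsUnit V.det := by rw [hdet]; exact isUnit_iff_ne_zero.2 h0
  have hent : ∀ a κ, |V a κ| ≤ 1 := by
    intro a κ
    refine abs_monomialVector_zero_le_one L ?_ κ
    have := hball a
    rw [mem_closedBall_iff_norm] at this
    rw [norm_smul, norm_inv, Real.norm_of_nonneg hR.le, inv_mul_le_one₀ hR]
    exact this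
  -- A cofactor is a determinant with entries in `[-1, 1]`, hence at most the number of
  -- permutations. The entries are bounded because the points are rescaled into the unit ball.
  have hadj : ∀ a κ, |V.adjugate κ a| ≤ (numMonomials d L).factorial := by
    intro a κ
    rw [Matrix.adjugate_apply]
    have := Matrix.det_le (A := V.updateRow a (Pi.single κ 1)) (abv := AbsoluteValue.abs)
      (x := (1 : ℝ)) (fun i j => by
        rw [Matrix.updateRow_apply]
        split_ifs
        · by_cases hj : j = κ
          · subst hj; simp
          · simp [Pi.single_eq_of_ne hj]
        · exact hent i j)
    simpa [numMonomials] using this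
  -- The row for the zero multi-index is insensitive to the rescaling: the factor `R ^ |κ|` equals
  -- `1` for `κ = 0` and multiplies zero for every other `κ`.
  have hle := sum_fitWeight_sq_le hu e he hJ (fun a => V⁻¹ (MultiIndex.zero d L) a) (by
    intro κ
    have h1 : (V⁻¹ * V) (MultiIndex.zero d L) κ
        = if κ = MultiIndex.zero d L then 1 else 0 := by
      rw [Matrix.nonsing_inv_mul _ hVu, Matrix.one_apply]
      simp [eq_comm]
    simp_rw [monomialVector_rescale L x _ hR.ne']
    have h2 : ∑ a, V⁻¹ (MultiIndex.zero d L) a *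
        (R ^ (∑ k, (κ.1 k : ℕ)) * monomialVector L 0 (R⁻¹ • (z (e a) - x)) κ)
        = R ^ (∑ k, (κ.1 k : ℕ)) * (V⁻¹ * V) (MultiIndex.zero d L) κ := by
      rw [Matrix.mul_apply, Finset.mul_sum]
      refine Finset.sum_congr rfl fun a _ => ?_
      rw [hV, Matrix.of_apply]
      ring
    rw [h2, h1]
    split_ifs with hκ
    · subst hκ; simp [MultiIndex.zero]
    · simp)
  have hy : ∀ a, V⁻¹ (MultiIndex.zero d L) a ^ 2
      ≤ ((numMonomials d L).factorial : ℝ) ^ 2 * (Δ ^ 2)⁻¹ := by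
    intro a
    rw [Matrix.inv_def, hdet, Matrix.smul_apply, Ring.inverse_eq_inv', smul_eq_mul, mul_pow,
      mul_comm, inv_pow]
    refine mul_le_mul_of_nonneg_right ?_ (by positivity)
    exact sq_le_sq.2 ((hadj a _).trans (le_abs_self _))
  have hle2 : ∑ j ∈ J, fitWeight L z J x j ^ 2
      ≤ (numMonomials d L * ((numMonomials d L).factorial : ℝ) ^ 2) * (Δ ^ 2)⁻¹ := by
    refine hle.trans ((Finset.sum_le_sum fun a _ => hy a).trans (le_of_eq ?_))
    rw [Finset.sum_const, Finset.card_univ, nsmul_eq_mul, numMonomials, mul_assoc]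
  refine (ENNReal.ofReal_le_ofReal hle2).trans (le_of_eq ?_)
  rw [ENNReal.ofReal_mul (by positivity), fitRiskConst]
  congr 1
  rw [← ofReal_norm, ENNReal.ofReal_rpow_of_pos (by simpa using h0)]
  congr 1
  rw [Real.rpow_neg (norm_nonneg _), Real.norm_eq_abs]
  norm_cast
  rw [sq_abs]

/-- The sum of squared weights is bounded by a geometric mean over disjoint groups of points. -/
theorem fitRisk_le_prod {d n : ℕ} {L T : ℕ} {z : Fin n → EuclideanSpace ℝ (Fin d)}
    {J : Finset (Fin n)} {x : EuclideanSpace ℝ (Fin d)} (hT : T ≠ 0)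
    (e : Fin T → MultiIndex d L → Fin n)
    (he : ∀ g, Function.Injective (e g)) (hJ : ∀ g a, e g a ∈ J) {R : ℝ} (hR : 0 < R)
    (hball : ∀ g a, z (e g a) ∈ Metric.closedBall x R) :
    fitRisk L z J x ≤ fitRiskConst d L
      * ∏ g, ‖monomialDet L (fun a => R⁻¹ • (z (e g a) - x))‖ₑ ^ (-(2 / T) : ℝ) := by
  have hT' : (T : ℝ) ≠ 0 := Nat.cast_ne_zero.2 hT
  -- The risk is split into `T` equal factors so that each can be bounded through its own group; the
  -- exponent `-2` thereby becomes `-2/T`.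
  have hpow : ∀ q : ℝ≥0∞, ∏ _g : Fin T, q ^ (1 / T : ℝ) = q := by
    intro q
    rw [Finset.prod_const, Finset.card_univ, Fintype.card_fin, ← ENNReal.rpow_natCast,
      ← ENNReal.rpow_mul, one_div_mul_cancel hT', ENNReal.rpow_one]
  calc fitRisk L z J x = ∏ _g : Fin T, fitRisk L z J x ^ (1 / T : ℝ) := (hpow _).symm
    _ ≤ ∏ g : Fin T, (fitRiskConst d L
        * ‖monomialDet L (fun a => R⁻¹ • (z (e g a) - x))‖ₑ ^ (-2 : ℝ)) ^ (1 / T : ℝ) := by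
        refine Finset.prod_le_prod' fun g _ => ENNReal.rpow_le_rpow ?_ (by positivity)
        exact fitRisk_le_monomialDet (e g) (he g) (hJ g) hR (hball g)
    _ = (∏ _g : Fin T, fitRiskConst d L ^ (1 / T : ℝ)) *
        ∏ g, ‖monomialDet L (fun a => R⁻¹ • (z (e g a) - x))‖ₑ ^ (-(2 / T) : ℝ) := by
        rw [← Finset.prod_mul_distrib]
        refine Finset.prod_congr rfl fun g _ => ?_
        rw [ENNReal.mul_rpow_of_nonneg _ _ (by positivity), ← ENNReal.rpow_mul]
        congr 2
        ring
    _ = _ := by rw [hpow]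

/-- A local average exists and has weights with sum of squares at most one. -/
theorem fitRisk_zero_le_one {d n : ℕ} {z : Fin n → EuclideanSpace ℝ (Fin d)}
    {J : Finset (Fin n)} {x : EuclideanSpace ℝ (Fin d)} (hJ : J.Nonempty) :
    fitRisk 0 z J x ≤ 1 := by
  classical
  obtain ⟨j, hj⟩ := hJ
  have hsub : ∀ κ : MultiIndex d 0, κ = MultiIndex.zero d 0 := by
    intro κ
    apply Subtype.ext
    funext k
    exact Subsingleton.elim (α := Fin 1) _ _
  have : Unique (MultiIndex d 0) := ⟨⟨MultiIndex.zero d 0⟩, hsub⟩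
  have hdet : monomialDet 0 (fun _ : MultiIndex d 0 => (1 : ℝ)⁻¹ • (z j - x)) ≠ 0 := by
    rw [monomialDet, Matrix.det_unique]
    simp [monomialVector]
  have hu := isUnit_det_designMatrix (L := 0) (J := J) (fun _ => j) (fun _ => hj) one_ne_zero hdet
  rw [fitRisk, if_pos hu, ← ENNReal.ofReal_one]
  apply ENNReal.ofReal_le_ofReal
  -- For degree zero, weight one on a single observation already reproduces the constants.
  have := sum_fitWeight_sq_le hu (fun _ : Unit => j) (fun _ _ _ => rfl) (fun _ => hj)
    (fun _ => 1) (by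
      intro κ
      rw [if_pos (hsub κ)]
      simp [monomialVector])
  simpa using this

/-! ### Tonelli for coordinates and blocks of a product measure -/

section ProductMeasures

variable {ι X : Type*} [Fintype ι] [MeasurableSpace X] (P : Measure X) [IsProbabilityMeasure P]

/-- Replacing one coordinate by an independent copy preserves a product measure. -/
theorem measurePreserving_update [DecidableEq ι] (m : ι) :
    MeasurePreserving (fun p : (ι → X) × X => Function.update p.1 m p.2)
      ((Measure.pi fun _ : ι => P).prod P) (Measure.pi fun _ : ι => P) := by
  have hm : Measurable fun p : (ι → X) × X => Function.update p.1 m p.2 := by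
    refine measurable_pi_lambda _ fun i => ?_
    by_cases h : i = m
    · subst h; simpa using measurable_snd
    · simp only [Function.update_of_ne h]; fun_prop
  refine ⟨hm, ?_⟩
  symm
  refine Measure.pi_eq fun s hs => ?_
  rw [Measure.map_apply hm (MeasurableSet.univ_pi hs)]
  have : (fun p : (ι → X) × X => Function.update p.1 m p.2) ⁻¹' (Set.univ.pi s)
      = (Set.univ.pi fun i => if i = m then Set.univ else s i) ×ˢ s m := by
    ext ⟨p, a⟩
    simp only [Set.mem_preimage, Set.mem_pi, Set.mem_univ, true_implies, Set.mem_prod]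
    constructor
    · intro h
      refine ⟨fun i => ?_, by simpa using h m⟩
      split_ifs with hi
      · trivial
      · simpa [Function.update_of_ne hi] using h i
    · rintro ⟨h1, h2⟩ i
      by_cases hi : i = m
      · subst hi; simpa using h2
      · have := h1 i
        rw [if_neg hi] at this
        simpa [Function.update_of_ne hi] using this
  rw [this, Measure.prod_prod, Measure.pi_pi, ← Finset.mul_prod_erase _ _ (Finset.mem_univ m),
    ← Finset.mul_prod_erase Finset.univ (fun i => P (s i)) (Finset.mem_univ m)]
  simp only [if_true, measure_univ, one_mul]
  rw [mul_comm]
  congr 1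
  exact Finset.prod_congr rfl fun i hi => by rw [if_neg (Finset.ne_of_mem_erase hi)]

theorem lintegral_pi_eq_lintegral_update [DecidableEq ι] (m : ι) (F : (ι → X) → ℝ≥0∞)
    (hF : Measurable F) :
    ∫⁻ p, F p ∂(Measure.pi fun _ : ι => P)
      = ∫⁻ a, ∫⁻ p, F (Function.update p m a) ∂(Measure.pi fun _ : ι => P) ∂P := by
  have h := measurePreserving_update P m
  rw [← h.lintegral_comp hF]
  exact lintegral_prod_symm _ (hF.comp h.measurable).aemeasurable

/-- Selecting distinct coordinates maps a product measure to a product measure. -/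
theorem measurePreserving_comp_injective {κ : Type*} [Fintype κ] (g : κ → ι)
    (hg : Function.Injective g) :
    MeasurePreserving (fun (p : ι → X) k => p (g k)) (Measure.pi fun _ => P)
      (Measure.pi fun _ => P) := by
  classical
  have hm : Measurable fun (p : ι → X) (k : κ) => p (g k) := by fun_prop
  refine ⟨hm, ?_⟩
  symm
  refine Measure.pi_eq fun s hs => ?_
  rw [Measure.map_apply hm (MeasurableSet.univ_pi hs)]
  have : (fun (p : ι → X) (k : κ) => p (g k)) ⁻¹' (Set.univ.pi s)
      = Set.univ.pi fun i => ⋂ k, ⋂ (_ : g k = i), s k := by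
    ext p
    simp only [Set.mem_preimage, Set.mem_pi, Set.mem_univ, true_implies, Set.mem_iInter]
    exact ⟨fun h i k hk => hk ▸ h k, fun h k => h _ k rfl⟩
  rw [this, Measure.pi_pi]
  have hval : ∀ k, (⋂ k', ⋂ (_ : g k' = g k), s k') = s k := by
    intro k
    ext x
    simp only [Set.mem_iInter]
    exact ⟨fun h => h k rfl, fun h k' hk' => hg hk' ▸ h⟩
  calc ∏ i, P (⋂ k, ⋂ (_ : g k = i), s k)
      = ∏ i ∈ Finset.univ.image g, P (⋂ k, ⋂ (_ : g k = i), s k) := by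
        symm
        refine Finset.prod_subset (Finset.subset_univ _) fun i _ hi => ?_
        have : (⋂ k, ⋂ (_ : g k = i), s k) = Set.univ := by
          refine Set.eq_univ_of_forall fun x => ?_
          simp only [Set.mem_iInter]
          intro k hk
          exact absurd (Finset.mem_image.2 ⟨k, Finset.mem_univ _, hk⟩) hi
        rw [this, measure_univ]
    _ = ∏ k, P (s k) := by
        rw [Finset.prod_image fun a _ b _ h => hg h]
        exact Finset.prod_congr rfl fun k _ => by rw [hval]

theorem lintegral_pi_prod_eq {κ : Type*} [Fintype κ] {Y : κ → Type*} [∀ k, MeasurableSpace (Y k)]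
    (Q : ∀ k, Measure (Y k)) [∀ k, IsProbabilityMeasure (Q k)] (φ : ∀ k, Y k → ℝ≥0∞)
    (hφ : ∀ k, Measurable (φ k)) :
    ∫⁻ p, ∏ k, φ k (p k) ∂(Measure.pi Q) = ∏ k, ∫⁻ a, φ k a ∂(Q k) := by
  have hind : iIndepFun (fun k (p : ∀ k, Y k) => φ k (p k)) (Measure.pi Q) :=
    iIndepFun_pi (X := φ) fun k => (hφ k).aemeasurable
  have h := lintegral_prod_eq_prod_lintegral_of_indepFun Finset.univ
    (fun k (p : ∀ k, Y k) => φ k (p k)) hind fun k => (hφ k).comp (measurable_pi_apply k)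
  rw [h]
  refine Finset.prod_congr rfl fun k _ => ?_
  exact (measurePreserving_eval Q k).lintegral_comp (hφ k)

/-- Tonelli's theorem for a product of functions of disjoint groups of coordinates. -/
theorem lintegral_pi_blocks {α β : Type*} [Fintype α] [Fintype β] (e : β → α → ι)
    (he : Function.Injective fun p : β × α => e p.1 p.2) (s : Finset ι)
    (hs : ∀ b a, e b a ∉ s) (Φ : β → (α → X) → ℝ≥0∞) (hΦ : ∀ b, Measurable (Φ b))
    (φ : ι → X → ℝ≥0∞) (hφ : ∀ c, Measurable (φ c)) :
    ∫⁻ p, (∏ b, Φ b fun a => p (e b a)) * ∏ c ∈ s, φ c (p c) ∂(Measure.pi fun _ : ι => P)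
      = (∏ b, ∫⁻ q, Φ b q ∂(Measure.pi fun _ : α => P)) * ∏ c ∈ s, ∫⁻ x, φ c x ∂P := by
  let g : (β × α) ⊕ s → ι := Sum.elim (fun p => e p.1 p.2) fun c => c
  have hg : Function.Injective g := by
    refine Function.Injective.sumElim he Subtype.val_injective fun p c h => ?_
    exact hs p.1 p.2 (h ▸ c.2)
  have m1 := measurePreserving_comp_injective P g hg
  have m2 := (measurePreserving_sumPiEquivProdPi fun _ : (β × α) ⊕ s => P).comp m1
  let F : ((β × α) → X) × (s → X) → ℝ≥0∞ := fun q =>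
    (∏ b, Φ b fun a => q.1 (b, a)) * ∏ c : s, φ c (q.2 c)
  have hF1 : Measurable fun q : (β × α) → X => ∏ b, Φ b fun a => q (b, a) :=
    Finset.measurable_prod _ fun b _ => (hΦ b).comp (by fun_prop)
  have hF2 : Measurable fun q : s → X => ∏ c : s, φ c (q c) :=
    Finset.measurable_prod _ fun c _ => (hφ c).comp (by fun_prop)
  have hF : Measurable F := (hF1.comp measurable_fst).mul (hF2.comp measurable_snd)
  have h1 := m2.lintegral_comp hF
  have h2 : ∀ p : ι → X, (∏ b, Φ b fun a => p (e b a)) * ∏ c ∈ s, φ c (p c)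
      = F (((MeasurableEquiv.sumPiEquivProdPi fun _ : (β × α) ⊕ s => X) ∘
        fun (p : ι → X) k => p (g k)) p) := by
    intro p
    simp only [F, Function.comp_apply]
    rw [← Finset.prod_coe_sort s]
    rfl
  rw [lintegral_congr h2, h1, lintegral_prod_mul hF1.aemeasurable hF2.aemeasurable,
    lintegral_pi_prod_eq (fun _ => P) (fun c : s => φ c) fun c => hφ c,
    Finset.prod_coe_sort s fun c => ∫⁻ x, φ c x ∂P]
  congr 1
  have m3 := measurePreserving_uncurry_pi (α := β) (δ := α) P
  rw [← m3.lintegral_comp hF1]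
  exact lintegral_pi_prod_eq (fun _ : β => Measure.pi fun _ : α => P) Φ hΦ

end ProductMeasures

/-! ### Groups of neighbours -/

/-- The number of disjoint groups of points used to bound the weights of a local fit. -/
def groupCount (d L : ℕ) : ℕ := if L = 0 then 0 else 2 * degreeSum d L + 1

/-- The contribution of a group of points in the ball of radius `R` to the bound of the weights. -/
noncomputable def groupDensity {d : ℕ} (L : ℕ) (x : EuclideanSpace ℝ (Fin d)) (R : ℝ)
    (q : MultiIndex d L → EuclideanSpace ℝ (Fin d)) : ℝ≥0∞ :=
  (∏ a, (Metric.closedBall x R).indicator 1 (q a))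
    * ‖monomialDet L fun a => R⁻¹ • (q a - x)‖ₑ ^ (-(2 / (groupCount d L : ℝ)))

/-- The integral of the contribution of a group of points over the unit ball. -/
noncomputable def groupIntegral (d L : ℕ) : ℝ≥0∞ :=
  ∫⁻ u : MultiIndex d L → EuclideanSpace ℝ (Fin d), groupDensity L 0 1 u

/-- The number `2D + 1` of groups is chosen for this: `2 / (2D + 1) * D < 1`, so the negative moment
of the determinant is finite. For `L = 0` there are no groups and the power is empty. -/
theorem groupIntegral_pow_ne_top (d L : ℕ) : groupIntegral d L ^ groupCount d L ≠ ∞ := by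
  by_cases hL : L = 0
  · simp [groupCount, hL]
  · refine ENNReal.pow_ne_top ?_
    have hc : (groupCount d L : ℝ) = 2 * degreeSum d L + 1 := by simp [groupCount, hL]
    have h := lintegral_monomialDet_rpow_ne_top (d := d) L (2 / (groupCount d L : ℝ))
      (by rw [hc]; positivity) (by
        rw [hc, div_mul_eq_mul_div, div_lt_one (by positivity)]
        linarith)
    simpa [groupIntegral, groupDensity] using h

/-- The form of the bound that covers all degrees. For `L = 0` the product is empty, and the summand
`1` in the constant accounts for the local average. -/
theorem fitRisk_le_prod_groupDensity {d n : ℕ} {L : ℕ} {z : Fin n → EuclideanSpace ℝ (Fin d)}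
    {J : Finset (Fin n)} {x : EuclideanSpace ℝ (Fin d)} (hJne : J.Nonempty)
    (e : Fin (groupCount d L) → MultiIndex d L → Fin n)
    (he : ∀ g, Function.Injective (e g)) (hJ : ∀ g a, e g a ∈ J) {R : ℝ} (hR : 0 < R)
    (hball : ∀ g a, z (e g a) ∈ Metric.closedBall x R) :
    fitRisk L z J x ≤ (fitRiskConst d L + 1) * ∏ g, groupDensity L x R fun a => z (e g a) := by
  by_cases hL : L = 0
  · subst hL
    refine (fitRisk_zero_le_one hJne).trans ?_
    have : IsEmpty (Fin (groupCount d 0)) := by simp [groupCount, Fin.isEmpty]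
    simp
  · have hT : groupCount d L ≠ 0 := by simp [groupCount, hL]
    refine (fitRisk_le_prod hT e he hJ hR hball).trans ?_
    refine mul_le_mul' le_self_add (le_of_eq (Finset.prod_congr rfl fun g _ => ?_))
    rw [groupDensity, Finset.prod_eq_one (fun a _ => by rw [Set.indicator_of_mem (hball g a)]; rfl),
      one_mul]

theorem measurable_closedBall_indicator {X E : Type*} [MeasurableSpace X] [NormedAddCommGroup E]
    [MeasurableSpace E] [BorelSpace E] [SecondCountableTopology E] (x : E) {f : X → ℝ} {g : X → E}
    (hf : Measurable f) (hg : Measurable g) :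
    Measurable fun p => (Metric.closedBall x (f p)).indicator (1 : E → ℝ≥0∞) (g p) := by
  classical
  simp only [Set.indicator_apply, Metric.mem_closedBall]
  exact Measurable.ite (measurableSet_le (hg.dist measurable_const) hf) measurable_const
    measurable_const

theorem measurable_compl_closedBall_indicator {X E : Type*} [MeasurableSpace X]
    [NormedAddCommGroup E]
    [MeasurableSpace E] [BorelSpace E] [SecondCountableTopology E] (x : E) {f : X → ℝ} {g : X → E}
    (hf : Measurable f) (hg : Measurable g) :
    Measurable fun p => (Metric.closedBall x (f p))ᶜ.indicator (1 : E → ℝ≥0∞) (g p) := by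
  classical
  simp only [Set.indicator_apply, Set.mem_compl_iff, Metric.mem_closedBall]
  exact Measurable.ite (measurableSet_le (hg.dist measurable_const) hf).compl measurable_const
    measurable_const

theorem measurable_groupDensity {X : Type*} [MeasurableSpace X] {d : ℕ} (L : ℕ)
    (x : EuclideanSpace ℝ (Fin d)) {f : X → ℝ} {g : X → MultiIndex d L → EuclideanSpace ℝ (Fin d)}
    (hf : Measurable f) (hg : Measurable g) :
    Measurable fun p => groupDensity L x (f p) (g p) := by
  unfold groupDensity
  refine Measurable.mul (Finset.measurable_prod _ fun a _ => ?_) ?_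
  · exact measurable_closedBall_indicator x hf ((measurable_pi_apply a).comp hg)
  · refine (measurable_monomialDet_rpow (d := d) L _).comp (measurable_pi_lambda _ fun a => ?_)
    exact hf.inv.smul (((measurable_pi_apply a).comp hg).sub_const x)

/-! ### Moments of the local fit and their majorants -/

/-- The distance from `x` to the farthest point with index in `J`. -/
noncomputable def cellRadius {d n : ℕ} (z : Fin n → EuclideanSpace ℝ (Fin d))
    (J : Finset (Fin n)) (x : EuclideanSpace ℝ (Fin d)) : ℝ :=
  ((J.sup fun j => ‖z j - x‖₊ : NNReal) : ℝ)

theorem norm_sub_le_cellRadius {d n : ℕ} (z : Fin n → EuclideanSpace ℝ (Fin d))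
    {J : Finset (Fin n)} (x : EuclideanSpace ℝ (Fin d)) {j : Fin n} (hj : j ∈ J) :
    ‖z j - x‖ ≤ cellRadius z J x := by
  have := Finset.le_sup (f := fun j => ‖z j - x‖₊) hj
  exact_mod_cast this

theorem exists_cellRadius_eq {d n : ℕ} (z : Fin n → EuclideanSpace ℝ (Fin d))
    {J : Finset (Fin n)} (x : EuclideanSpace ℝ (Fin d)) (hJ : J.Nonempty) :
    ∃ m ∈ J, cellRadius z J x = ‖z m - x‖ := by
  obtain ⟨m, hm, h⟩ := Finset.exists_mem_eq_sup J hJ fun j => ‖z j - x‖₊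
  exact ⟨m, hm, by rw [cellRadius, h]; rfl⟩

theorem cellRadius_nonneg {d n : ℕ} (z : Fin n → EuclideanSpace ℝ (Fin d))
    (J : Finset (Fin n)) (x : EuclideanSpace ℝ (Fin d)) : 0 ≤ cellRadius z J x :=
  NNReal.coe_nonneg _

/-- The sum of squared weights of the local fit at `x`, weighted by a function of the distance to
the farthest of the `K` nearest neighbours. -/
noncomputable def cellMoment {d n : ℕ} (L K : ℕ) (h : ℝ → ℝ≥0∞)
    (z : Fin n → EuclideanSpace ℝ (Fin d)) (x : EuclideanSpace ℝ (Fin d)) : ℝ≥0∞ :=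
  ∑ J ∈ Finset.powersetCard K Finset.univ,
    (voronoiCell Set.univ z J).indicator (fun y => fitRisk L z J y * h (cellRadius z J y)) x

section Majorant

variable {X : Type*} {d n : ℕ}

/-- The indices that are neither `m` nor in one of the groups. -/
def otherIndices {α β : Type*} [Fintype α] [Fintype β] (e : β → α → Fin n) (m : Fin n) :
    Finset (Fin n) :=
  Finset.univ.filter fun c => c ≠ m ∧ ∀ g a, e g a ≠ c

theorem mem_otherIndices {α β : Type*} [Fintype α] [Fintype β] {e : β → α → Fin n} {m c : Fin n} :
    c ∈ otherIndices e m ↔ c ≠ m ∧ ∀ g a, e g a ≠ c := by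
  simp [otherIndices]

open Classical in
/-- The indicator of the ball or of its complement, according to whether the index is in `J`. -/
noncomputable def sideIndicator (J : Finset (Fin n)) (x : EuclideanSpace ℝ (Fin d)) (R : ℝ)
    (c : Fin n) : EuclideanSpace ℝ (Fin d) → ℝ≥0∞ :=
  if c ∈ J then (Metric.closedBall x R).indicator 1 else (Metric.closedBall x R)ᶜ.indicator 1

/-- The part of the majorant of the moments in which `m` is the farthest neighbour. -/
noncomputable def momentMajorant (π : X → EuclideanSpace ℝ (Fin d)) (L : ℕ) (h : ℝ → ℝ≥0∞)
    (ω : Fin n → X → ℝ≥0∞) (J : Finset (Fin n)) (m : Fin n)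
    (e : Fin (groupCount d L) → MultiIndex d L → Fin n) (x : EuclideanSpace ℝ (Fin d))
    (p : Fin n → X) : ℝ≥0∞ :=
  (ω m (p m) * h ‖π (p m) - x‖) *
    ((∏ g, groupDensity L x ‖π (p m) - x‖ fun a => π (p (e g a))) *
      ∏ c ∈ otherIndices e m, (ω c (p c) * sideIndicator J x ‖π (p m) - x‖ c (π (p c))))

variable [MeasurableSpace X]

theorem measurable_sideIndicator {Y : Type*} [MeasurableSpace Y] (J : Finset (Fin n))
    (x : EuclideanSpace ℝ (Fin d)) {f : Y → ℝ} {g : Y → EuclideanSpace ℝ (Fin d)}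
    (hf : Measurable f) (hg : Measurable g) (c : Fin n) :
    Measurable fun p => sideIndicator J x (f p) c (g p) := by
  unfold sideIndicator
  split_ifs
  · exact measurable_closedBall_indicator x hf hg
  · exact measurable_compl_closedBall_indicator x hf hg

theorem measurable_momentMajorant {π : X → EuclideanSpace ℝ (Fin d)} (hπ : Measurable π) (L : ℕ)
    {h : ℝ → ℝ≥0∞} (hh : Measurable h) {ω : Fin n → X → ℝ≥0∞} (hω : ∀ c, Measurable (ω c))
    (J : Finset (Fin n)) (m : Fin n) (e : Fin (groupCount d L) → MultiIndex d L → Fin n)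
    (x : EuclideanSpace ℝ (Fin d)) : Measurable (momentMajorant π L h ω J m e x) := by
  have hp : ∀ c, Measurable fun p : Fin n → X => π (p c) := fun c =>
    hπ.comp (measurable_pi_apply c)
  have hR : Measurable fun p : Fin n → X => ‖π (p m) - x‖ := ((hp m).sub_const x).norm
  unfold momentMajorant
  refine Measurable.mul (((hω m).comp (measurable_pi_apply m)).mul (hh.comp hR)) (Measurable.mul
    (Finset.measurable_prod _ fun g _ => ?_) (Finset.measurable_prod _ fun c _ => ?_))
  · exact measurable_groupDensity L x hR (measurable_pi_lambda _ fun a => hp _)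
  · exact ((hω c).comp (measurable_pi_apply c)).mul (measurable_sideIndicator J x hR (hp c) c)

/-- The radius depends on observation `m` alone. With that observation held fixed, the groups and
the remaining single observations are disjoint blocks of independent coordinates, and the integral
factorises. The hypothesis `hm` keeps the farthest point out of the groups. -/
theorem lintegral_momentMajorant (P : Measure X) [IsProbabilityMeasure P]
    {π : X → EuclideanSpace ℝ (Fin d)} (hπ : Measurable π) (L : ℕ)
    {h : ℝ → ℝ≥0∞} (hh : Measurable h) {ω : Fin n → X → ℝ≥0∞} (hω : ∀ c, Measurable (ω c))
    (J : Finset (Fin n)) (m : Fin n) (e : Fin (groupCount d L) → MultiIndex d L → Fin n)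
    (he : Function.Injective fun q : Fin (groupCount d L) × MultiIndex d L => e q.1 q.2)
    (hm : ∀ g a, e g a ≠ m) (x : EuclideanSpace ℝ (Fin d)) :
    ∫⁻ p, momentMajorant π L h ω J m e x p ∂(Measure.pi fun _ => P)
      = ∫⁻ a, (ω m a * h ‖π a - x‖) *
          ((∫⁻ q, groupDensity L x ‖π a - x‖ q ∂(Measure.pi fun _ => P.map π)) ^ groupCount d L *
            ∏ c ∈ otherIndices e m, ∫⁻ b, ω c b * sideIndicator J x ‖π a - x‖ c (π b) ∂P) ∂P := by
  classical
  have hprob : IsProbabilityMeasure (P.map π) := Measure.isProbabilityMeasure_map hπ.aemeasurable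
  rw [lintegral_pi_eq_lintegral_update P m _ (measurable_momentMajorant hπ L hh hω J m e x)]
  refine lintegral_congr fun a => ?_
  have hsplit : ∀ p : Fin n → X, momentMajorant π L h ω J m e x (Function.update p m a)
      = (ω m a * h ‖π a - x‖) *
        ((∏ g, groupDensity L x ‖π a - x‖ fun a => π (p (e g a))) *
          ∏ c ∈ otherIndices e m, (ω c (p c) * sideIndicator J x ‖π a - x‖ c (π (p c)))) := by
    intro p
    unfold momentMajorant
    rw [Function.update_self]
    congr 2
    · refine Finset.prod_congr rfl fun g _ => ?_
      congr 1
      funext b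
      rw [Function.update_of_ne (hm g b)]
    · refine Finset.prod_congr rfl fun c hc => ?_
      rw [Function.update_of_ne (mem_otherIndices.1 hc).1]
  have hΦ : Measurable fun q : MultiIndex d L → X =>
      groupDensity L x ‖π a - x‖ fun b => π (q b) :=
    measurable_groupDensity L x measurable_const
      (measurable_pi_lambda _ fun b => hπ.comp (measurable_pi_apply b))
  have hφ : ∀ c, Measurable fun b => ω c b * sideIndicator J x ‖π a - x‖ c (π b) := fun c =>
    (hω c).mul (measurable_sideIndicator J x measurable_const hπ c)
  rw [lintegral_congr hsplit, lintegral_const_mul]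
  swap
  · refine Measurable.mul (Finset.measurable_prod _ fun g _ => ?_)
      (Finset.measurable_prod _ fun c _ => (hφ c).comp (measurable_pi_apply c))
    exact hΦ.comp (measurable_pi_lambda _ fun b => measurable_pi_apply _)
  have hblocks := lintegral_pi_blocks P e he (otherIndices e m)
    (fun b a' hmem => (mem_otherIndices.1 hmem).2 b a' rfl)
    (fun _ q => groupDensity L x ‖π a - x‖ fun b => π (q b)) (fun _ => hΦ)
    (fun c b => ω c b * sideIndicator J x ‖π a - x‖ c (π b)) hφ
  rw [hblocks, Finset.prod_const, Finset.card_univ, Fintype.card_fin]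
  congr 3
  rw [← Measure.pi_map_pi (μ := fun _ : MultiIndex d L => P) (f := fun _ => π)
    fun _ => hπ.aemeasurable, lintegral_map]
  · exact measurable_groupDensity L x measurable_const measurable_id
  · exact measurable_pi_lambda _ fun b => hπ.comp (measurable_pi_apply b)

end Majorant

theorem exists_disjoint_groups {n T : ℕ} {α : Type*} [Fintype α] (s : Finset (Fin n))
    (h : T * Fintype.card α ≤ s.card) :
    ∃ e : Fin T → α → Fin n, (Function.Injective fun q : Fin T × α => e q.1 q.2) ∧
      ∀ g a, e g a ∈ s := by
  have hc : Fintype.card (Fin T × α) ≤ Fintype.card s := by simpa using h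
  obtain ⟨f⟩ := Function.Embedding.nonempty_of_card_le hc
  refine ⟨fun g a => f (g, a), fun q q' hq => ?_, fun g a => (f (g, a)).2⟩
  exact f.injective (Subtype.ext hq)

section Majorant

variable {X : Type*} {d n : ℕ}

open Classical in
/-- The weight `ψ` on the coordinate `j`. -/
noncomputable def coordWeight (j : Fin n) (ψ : X → ℝ≥0∞) (c : Fin n) : X → ℝ≥0∞ :=
  if c = j then ψ else 1

/-- On the cell of `J` with farthest neighbour `m`, all ball indicators equal one: the points of `J`
lie in the closed ball through `π (p m)`, and all others lie strictly outside by the definition of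
the cell. The factor `ψ (p j)` occurs exactly once, as `j` is either `m` or one of the other
indices, but never in a group. -/
theorem mul_indicator_le_momentMajorant {π : X → EuclideanSpace ℝ (Fin d)} {L : ℕ} {h : ℝ → ℝ≥0∞}
    (j : Fin n) (ψ : X → ℝ≥0∞) {J : Finset (Fin n)} {m : Fin n} (hmJ : m ∈ J)
    {e : Fin (groupCount d L) → MultiIndex d L → Fin n}
    (he : Function.Injective fun q : Fin (groupCount d L) × MultiIndex d L => e q.1 q.2)
    (heJ : ∀ g a, e g a ∈ J) (hej : ∀ g a, e g a ≠ j) {x : EuclideanSpace ℝ (Fin d)}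
    {p : Fin n → X} (hx : π (p m) ≠ x)
    (hcell : x ∈ voronoiCell Set.univ (fun i => π (p i)) J)
    (hmax : cellRadius (fun i => π (p i)) J x = ‖π (p m) - x‖) :
    ψ (p j) * (fitRisk L (fun i => π (p i)) J x * h (cellRadius (fun i => π (p i)) J x))
      ≤ (fitRiskConst d L + 1) * momentMajorant π L h (coordWeight j ψ) J m e x p := by
  classical
  have hR : 0 < ‖π (p m) - x‖ := norm_pos_iff.2 (sub_ne_zero.2 hx)
  have hball : ∀ c ∈ J, π (p c) ∈ Metric.closedBall x ‖π (p m) - x‖ := fun c hc => by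
    rw [mem_closedBall_iff_norm, ← hmax]
    exact norm_sub_le_cellRadius (fun i => π (p i)) x hc
  have hout : ∀ c ∉ J, π (p c) ∈ (Metric.closedBall x ‖π (p m) - x‖)ᶜ := fun c hc => by
    rw [Set.mem_compl_iff, mem_closedBall_iff_norm, not_le, norm_sub_rev, norm_sub_rev (π (p c))]
    exact hcell.2 m hmJ c hc
  have h1 := fitRisk_le_prod_groupDensity (L := L) (z := fun i => π (p i)) (x := x) ⟨m, hmJ⟩ e
    (fun g a b hab => (Prod.mk.inj (he (a₁ := (g, a)) (a₂ := (g, b)) hab)).2) heJ hR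
    fun g a => hball _ (heJ g a)
  have hside : ∀ c, sideIndicator J x ‖π (p m) - x‖ c (π (p c)) = 1 := by
    intro c
    unfold sideIndicator
    split_ifs with hc
    · rw [Set.indicator_of_mem (hball c hc)]; rfl
    · rw [Set.indicator_of_mem (hout c hc)]; rfl
  have hω : ψ (p j) = coordWeight j ψ m (p m) *
      ∏ c ∈ otherIndices e m, coordWeight j ψ c (p c) := by
    unfold coordWeight
    by_cases hm : m = j
    · rw [if_pos hm, Finset.prod_eq_one, mul_one, hm]
      intro c hc
      rw [if_neg]
      · rfl
      · rintro rfl; exact (mem_otherIndices.1 hc).1 hm.symm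
    · rw [if_neg hm, Pi.one_apply, one_mul, Finset.prod_eq_single j]
      · rw [if_pos rfl]
      · intro c _ hc
        rw [if_neg hc]; rfl
      · intro hj
        exact absurd (mem_otherIndices.2 ⟨fun h => hm h.symm, hej⟩) hj
  unfold momentMajorant
  simp only [hside, mul_one]
  rw [hmax]
  calc ψ (p j) * (fitRisk L (fun i => π (p i)) J x * h ‖π (p m) - x‖)
      ≤ ψ (p j) * (((fitRiskConst d L + 1) *
          ∏ g, groupDensity L x ‖π (p m) - x‖ fun a => π (p (e g a))) * h ‖π (p m) - x‖) := by
        gcongr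
    _ = _ := by
        rw [hω]
        ring

variable [MeasurableSpace X]

theorem lintegral_groupDensity_le (L : ℕ) {ν : Measure (EuclideanSpace ℝ (Fin d))} [SigmaFinite ν]
    {A : NNReal} (hν : ν ≤ A • volume) (x : EuclideanSpace ℝ (Fin d)) {R : ℝ} (hR : 0 < R) :
    ∫⁻ q, groupDensity L x R q ∂(Measure.pi fun _ => ν)
      ≤ (A * ENNReal.ofReal (R ^ d)) ^ numMonomials d L * groupIntegral d L := by
  refine (lintegral_monomialDet_rescale_le L (2 / (groupCount d L : ℝ)) ν A hν x hR).trans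
    (le_of_eq ?_)
  simp [numMonomials, groupIntegral, groupDensity]

/-- A crude bound of the majorant, which suffices for finiteness. -/
theorem lintegral_momentMajorant_le_crude (P : Measure X) [IsProbabilityMeasure P]
    {π : X → EuclideanSpace ℝ (Fin d)} (hπ : Measurable π) (L : ℕ) {A : NNReal}
    (hν : P.map π ≤ A • volume) {ψ : X → ℝ≥0∞} (hψ : Measurable ψ) (j : Fin n)
    (J : Finset (Fin n)) (m : Fin n) (e : Fin (groupCount d L) → MultiIndex d L → Fin n)
    (he : Function.Injective fun q : Fin (groupCount d L) × MultiIndex d L => e q.1 q.2)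
    (hm : ∀ g a, e g a ≠ m) (hej : ∀ g a, e g a ≠ j)
    (x : EuclideanSpace ℝ (Fin d)) {D : ℝ} (hD : ∀ᵐ a ∂P, π a ≠ x ∧ ‖π a - x‖ ≤ D) :
    ∫⁻ p, momentMajorant π L 1 (coordWeight j ψ) J m e x p ∂(Measure.pi fun _ => P)
      ≤ ((A * ENNReal.ofReal (D ^ d)) ^ numMonomials d L * groupIntegral d L) ^ groupCount d L
        * ∫⁻ a, ψ a ∂P := by
  classical
  have hprob : IsProbabilityMeasure (P.map π) := Measure.isProbabilityMeasure_map hπ.aemeasurable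
  have hω : ∀ c, Measurable (coordWeight j ψ c) := by
    intro c; unfold coordWeight; split_ifs
    · exact hψ
    · exact measurable_one
  rw [lintegral_momentMajorant P hπ L measurable_one hω J m e he hm x]
  set B := ((A * ENNReal.ofReal (D ^ d)) ^ numMonomials d L * groupIntegral d L) ^ groupCount d L
  -- All information on the positions of the single observations is discarded. The resulting bound
  -- grows with the sample size, which does not matter for finiteness.
  have hprod : ∀ R, ∏ c ∈ otherIndices e m,
      ∫⁻ b, coordWeight j ψ c b * sideIndicator J x R c (π b) ∂P
      ≤ ∏ c ∈ otherIndices e m, ∫⁻ b, coordWeight j ψ c b ∂P := by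
    intro R
    refine Finset.prod_le_prod' fun c _ => lintegral_mono fun b => ?_
    refine mul_le_of_le_one_right' ?_
    unfold sideIndicator
    split_ifs <;> exact Set.indicator_le_self _ _ _
  calc _ ≤ ∫⁻ a, B * (coordWeight j ψ m a *
        ∏ c ∈ otherIndices e m, ∫⁻ b, coordWeight j ψ c b ∂P) ∂P := by
        refine lintegral_mono_ae ?_
        filter_upwards [hD] with a ha
        have hR : 0 < ‖π a - x‖ := norm_pos_iff.2 (sub_ne_zero.2 ha.1)
        have h2 : (∫⁻ q, groupDensity L x ‖π a - x‖ q ∂(Measure.pi fun _ => P.map π))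
            ^ groupCount d L ≤ B := by
          refine pow_le_pow_left' ((lintegral_groupDensity_le L hν x hR).trans ?_) _
          gcongr
          exact ha.2
        calc _ ≤ (coordWeight j ψ m a * 1) *
            (B * ∏ c ∈ otherIndices e m, ∫⁻ b, coordWeight j ψ c b ∂P) := by
              exact mul_le_mul' le_rfl (mul_le_mul' h2 (hprod _))
          _ = _ := by ring
    _ = B * ((∫⁻ a, coordWeight j ψ m a ∂P) *
        ∏ c ∈ otherIndices e m, ∫⁻ b, coordWeight j ψ c b ∂P) := by
        rw [lintegral_const_mul _ ((hω m).mul_const _), lintegral_mul_const _ (hω m)]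
    _ ≤ _ := by
        refine mul_le_mul_right (le_of_eq ?_) B
        have hInt : ∀ c, ∫⁻ b, coordWeight j ψ c b ∂P = if c = j then ∫⁻ b, ψ b ∂P else 1 := by
          intro c; unfold coordWeight; split_ifs
          · rfl
          · simp
        simp_rw [hInt]
        by_cases hmj : m = j
        · rw [if_pos hmj, Finset.prod_eq_one, mul_one]
          intro c hc
          rw [if_neg]
          rintro rfl; exact (mem_otherIndices.1 hc).1 hmj.symm
        · rw [if_neg hmj, one_mul, Finset.prod_eq_single j]
          · rw [if_pos rfl]
          · intro c _ hc; rw [if_neg hc]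
          · intro hj
            exact absurd (mem_otherIndices.2 ⟨fun h => hmj h.symm, hej⟩) hj

/-- The majorant as a radial integral. -/
theorem lintegral_momentMajorant_le (P : Measure X) [IsProbabilityMeasure P]
    {π : X → EuclideanSpace ℝ (Fin d)} (hπ : Measurable π) (L : ℕ) {A : NNReal}
    (hν : P.map π ≤ A • volume) {h : ℝ → ℝ≥0∞} (hh : Measurable h) (j : Fin n)
    {J : Finset (Fin n)} {m : Fin n} (hmJ : m ∈ J)
    (e : Fin (groupCount d L) → MultiIndex d L → Fin n)
    (he : Function.Injective fun q : Fin (groupCount d L) × MultiIndex d L => e q.1 q.2)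
    (heJ : ∀ g a, e g a ∈ J) (hm : ∀ g a, e g a ≠ m)
    (x : EuclideanSpace ℝ (Fin d)) (hx : ∀ᵐ a ∂P, π a ≠ x) :
    ∫⁻ p, momentMajorant π L h (coordWeight j 1) J m e x p ∂(Measure.pi fun _ => P)
      ≤ groupIntegral d L ^ groupCount d L *
        (volume (Metric.closedBall (0 : EuclideanSpace ℝ (Fin d)) 1) + 1) ^ J.card *
        ∫⁻ a, h ‖π a - x‖ * ((A * ENNReal.ofReal (‖π a - x‖ ^ d)) ^ (J.card - 1) *
          (P.map π) (Metric.closedBall x ‖π a - x‖)ᶜ ^ (n - J.card)) ∂P := by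
  classical
  have hprob : IsProbabilityMeasure (P.map π) := Measure.isProbabilityMeasure_map hπ.aemeasurable
  have hω1 : ∀ c : Fin n, coordWeight j (1 : X → ℝ≥0∞) c = 1 := by
    intro c; unfold coordWeight; split_ifs <;> rfl
  rw [lintegral_momentMajorant P hπ L hh (fun c => by rw [hω1]; exact measurable_one) J m e he hm x]
  simp only [hω1, Pi.one_apply, one_mul]
  set V := volume (Metric.closedBall (0 : EuclideanSpace ℝ (Fin d)) 1) with hV
  have hVfin : V ≠ ∞ := measure_closedBall_lt_top.ne
  set I := groupIntegral d L
  have hIfin : I ^ groupCount d L ≠ ∞ := groupIntegral_pow_ne_top d L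
  rw [← lintegral_const_mul' _ _ (ENNReal.mul_ne_top hIfin (by finiteness))]
  refine lintegral_mono_ae ?_
  filter_upwards [hx] with a ha
  set R := ‖π a - x‖ with hRdef
  have hR : 0 < R := norm_pos_iff.2 (sub_ne_zero.2 ha)
  set q : ℝ≥0∞ := A * ENNReal.ofReal (R ^ d) with hq
  have hside : ∀ c, ∫⁻ b, sideIndicator J x R c (π b) ∂P
      = if c ∈ J then (P.map π) (Metric.closedBall x R)
        else (P.map π) (Metric.closedBall x R)ᶜ := by
    intro c
    have hmb : MeasurableSet (Metric.closedBall x R) := Metric.isClosed_closedBall.measurableSet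
    unfold sideIndicator
    split_ifs
    · rw [← lintegral_map (measurable_one.indicator hmb) hπ, lintegral_indicator_one hmb]
    · rw [← lintegral_map (measurable_one.indicator hmb.compl) hπ,
        lintegral_indicator_one hmb.compl]
  have hball : (P.map π) (Metric.closedBall x R) ≤ q * (V + 1) := by
    refine (hν _).trans ?_
    rw [Measure.smul_apply, Measure.addHaar_closedBall _ _ hR.le, finrank_euclideanSpace,
      Fintype.card_fin, ENNReal.smul_def, smul_eq_mul, ← mul_assoc]
    gcongr
    exact (measure_mono Metric.ball_subset_closedBall).trans le_self_add
  have himg : (Finset.univ.image fun g : Fin (groupCount d L) × MultiIndex d L => e g.1 g.2).card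
      = groupCount d L * numMonomials d L := by
    rw [Finset.card_image_of_injective _ he, Finset.card_univ, Fintype.card_prod,
      Fintype.card_fin, numMonomials]
  -- The groups and the remaining neighbours together make up `J` without `m`. Each contributes one
  -- factor `q`, of order `R ^ d`, whence the exponent `J.card - 1`.
  have hin : ((otherIndices e m).filter (· ∈ J)).card + groupCount d L * numMonomials d L = J.card - 1 := by
    rw [← himg, ← Finset.card_erase_of_mem hmJ, ← Finset.card_union_of_disjoint]
    · congr 1
      ext c
      simp only [Finset.mem_union, Finset.mem_filter, mem_otherIndices, Finset.mem_image,
        Finset.mem_univ, true_and, Prod.exists, Finset.mem_erase]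
      constructor
      · rintro (⟨⟨h1, h2⟩, h3⟩ | ⟨g, b, rfl⟩)
        · exact ⟨h1, h3⟩
        · exact ⟨hm g b, heJ g b⟩
      · rintro ⟨h1, h3⟩
        by_cases hc : ∃ g b, e g b = c
        · exact Or.inr hc
        · push Not at hc
          exact Or.inl ⟨⟨h1, hc⟩, h3⟩
    · rw [Finset.disjoint_left]
      rintro c hc hc'
      obtain ⟨g, _, rfl⟩ := Finset.mem_image.1 hc'
      exact (mem_otherIndices.1 (Finset.mem_filter.1 hc).1).2 g.1 g.2 rfl
  have hout : ((otherIndices e m).filter (· ∉ J)).card = n - J.card := by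
    have : (otherIndices e m).filter (· ∉ J) = Jᶜ := by
      ext c
      simp only [Finset.mem_filter, mem_otherIndices, Finset.mem_compl, and_iff_right_iff_imp]
      exact fun hc => ⟨fun h => hc (h ▸ hmJ), fun g b h => hc (h ▸ heJ g b)⟩
    rw [this, Finset.card_compl, Fintype.card_fin]
  have hprod : ∏ c ∈ otherIndices e m, ∫⁻ b, sideIndicator J x R c (π b) ∂P
      ≤ (q * (V + 1)) ^ ((otherIndices e m).filter (· ∈ J)).card
        * (P.map π) (Metric.closedBall x R)ᶜ ^ (n - J.card) := by
    rw [← Finset.prod_filter_mul_prod_filter_not (otherIndices e m) (· ∈ J), ← hout]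
    refine mul_le_mul' ?_ ?_
    · rw [← Finset.prod_const]
      refine Finset.prod_le_prod' fun c hc => ?_
      rw [hside, if_pos (Finset.mem_filter.1 hc).2]
      exact hball
    · rw [← Finset.prod_const]
      refine Finset.prod_le_prod' fun c hc => ?_
      rw [hside, if_neg (Finset.mem_filter.1 hc).2]
  have hgroup : (∫⁻ p, groupDensity L x R p ∂(Measure.pi fun _ => P.map π)) ^ groupCount d L
      ≤ (q ^ numMonomials d L * I) ^ groupCount d L :=
    pow_le_pow_left' (lintegral_groupDensity_le L hν x hR) _
  set k := ((otherIndices e m).filter (· ∈ J)).card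
  set B := (P.map π) (Metric.closedBall x R)ᶜ ^ (n - J.card)
  clear_value q
  calc h R * ((∫⁻ p, groupDensity L x R p ∂(Measure.pi fun _ => P.map π)) ^ groupCount d L
        * ∏ c ∈ otherIndices e m, ∫⁻ b, sideIndicator J x R c (π b) ∂P)
      ≤ h R * ((q ^ numMonomials d L * I) ^ groupCount d L * ((q * (V + 1)) ^ k * B)) :=
        mul_le_mul' le_rfl (mul_le_mul' hgroup hprod)
    _ = I ^ groupCount d L * (V + 1) ^ k * (h R * (q ^ (J.card - 1) * B)) := by
        rw [← hin, mul_pow, mul_pow, ← pow_mul, pow_add, mul_comm (numMonomials d L) (groupCount d L)]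
        ring
    _ ≤ _ := by
        have hk : k ≤ J.card := by omega
        have hV1 : (V + 1) ^ k ≤ (V + 1) ^ J.card := pow_le_pow_right₀ le_add_self hk
        gcongr

end Majorant

section CellMoment

variable {X : Type*} [MeasurableSpace X] {d n : ℕ}

/-- Bounds of the majorants for the single cells carry over to the moment of the local fit. -/
theorem lintegral_mul_cellMoment_le (P : Measure X) [IsProbabilityMeasure P]
    {π : X → EuclideanSpace ℝ (Fin d)} (hπ : Measurable π) {L K : ℕ} (hK : 1 ≤ K)
    (hc : L = 0 ∨ groupCount d L * numMonomials d L + 2 ≤ K) {h : ℝ → ℝ≥0∞} (hh : Measurable h)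
    {ψ : X → ℝ≥0∞} (hψ : Measurable ψ) (j : Fin n)
    (x : EuclideanSpace ℝ (Fin d)) (hx : ∀ᵐ a ∂P, π a ≠ x) (B : ℝ≥0∞)
    (hB : ∀ (J : Finset (Fin n)) (m : Fin n)
      (e : Fin (groupCount d L) → MultiIndex d L → Fin n), J.card = K → m ∈ J →
      (Function.Injective fun q : Fin (groupCount d L) × MultiIndex d L => e q.1 q.2) →
      (∀ g a, e g a ∈ J) → (∀ g a, e g a ≠ m) → (∀ g a, e g a ≠ j) →
      ∫⁻ p, momentMajorant π L h (coordWeight j ψ) J m e x p ∂(Measure.pi fun _ => P) ≤ B) :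
    ∫⁻ p, ψ (p j) * cellMoment L K h (fun i => π (p i)) x ∂(Measure.pi fun _ : Fin n => P)
      ≤ (n : ℝ≥0∞) ^ K * (K * ((fitRiskConst d L + 1) * B)) := by
  classical
  have hω : ∀ c, Measurable (coordWeight j ψ c) := by
    intro c; unfold coordWeight; split_ifs
    · exact hψ
    · exact measurable_one
  -- Removing the farthest neighbour `m` and the weighted observation `j` costs at most two points
  -- of `J`. This is the summand `2` in the lower bound on `K`.
  have hex : ∀ (J : Finset (Fin n)) (m : Fin n), ∃ e : Fin (groupCount d L) → MultiIndex d L → Fin n,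
      J.card = K → m ∈ J →
      (Function.Injective fun q : Fin (groupCount d L) × MultiIndex d L => e q.1 q.2) ∧
        (∀ g a, e g a ∈ J) ∧ (∀ g a, e g a ≠ m) ∧ (∀ g a, e g a ≠ j) := by
    intro J m
    by_cases hJ : J.card = K
    · have hcard : groupCount d L * Fintype.card (MultiIndex d L) ≤ ((J.erase m).erase j).card := by
        rcases hc with rfl | hc
        · simp [groupCount]
        · have h1 := Finset.pred_card_le_card_erase (s := J) (a := m)
          have h2 := Finset.pred_card_le_card_erase (s := J.erase m) (a := j)
          change groupCount d L * numMonomials d L ≤ _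
          omega
      obtain ⟨e, he, hes⟩ := exists_disjoint_groups _ hcard
      refine ⟨e, fun _ _ => ⟨he, fun g a => ?_, fun g a => ?_, fun g a => ?_⟩⟩
      · exact Finset.mem_of_mem_erase (Finset.mem_of_mem_erase (hes g a))
      · exact Finset.ne_of_mem_erase (Finset.mem_of_mem_erase (hes g a))
      · exact Finset.ne_of_mem_erase (hes g a)
    · exact ⟨fun _ _ => m, fun h => absurd h hJ⟩
  choose e he using hex
  have hae : ∀ᵐ p ∂(Measure.pi fun _ : Fin n => P), ∀ m, π (p m) ≠ x := by
    rw [ae_all_iff]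
    intro m
    exact (measurePreserving_eval (fun _ : Fin n => P) m).quasiMeasurePreserving.ae hx
  have hRfin : fitRiskConst d L + 1 ≠ ∞ := by unfold fitRiskConst; finiteness
  calc ∫⁻ p, ψ (p j) * cellMoment L K h (fun i => π (p i)) x ∂(Measure.pi fun _ : Fin n => P)
      ≤ ∫⁻ p, ∑ J ∈ Finset.powersetCard K Finset.univ, ∑ m ∈ J, (fitRiskConst d L + 1) *
          momentMajorant π L h (coordWeight j ψ) J m (e J m) x p
          ∂(Measure.pi fun _ : Fin n => P) := by
        refine lintegral_mono_ae ?_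
        filter_upwards [hae] with p hp
        rw [cellMoment, Finset.mul_sum]
        refine Finset.sum_le_sum fun J hJ => ?_
        have hJK := (Finset.mem_powersetCard.1 hJ).2
        by_cases hcell : x ∈ voronoiCell Set.univ (fun i => π (p i)) J
        · rw [Set.indicator_of_mem hcell]
          -- Which neighbour is farthest depends on the sample, so its majorant is replaced by the
          -- sum over all `m ∈ J`.
          obtain ⟨m, hmJ, hmax⟩ := exists_cellRadius_eq (fun i => π (p i)) x
            (Finset.card_pos.1 (by omega : 0 < J.card))
          obtain ⟨h1, h2, _, h4⟩ := he J m hJK hmJ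
          refine (mul_indicator_le_momentMajorant j ψ hmJ h1 h2 h4 (hp m) hcell hmax).trans ?_
          exact Finset.single_le_sum (f := fun m => (fitRiskConst d L + 1) *
            momentMajorant π L h (coordWeight j ψ) J m (e J m) x p) (fun _ _ => zero_le) hmJ
        · rw [Set.indicator_of_notMem hcell, mul_zero]
          exact zero_le
    _ = ∑ J ∈ Finset.powersetCard K Finset.univ, ∑ m ∈ J, (fitRiskConst d L + 1) *
          ∫⁻ p, momentMajorant π L h (coordWeight j ψ) J m (e J m) x p
          ∂(Measure.pi fun _ : Fin n => P) := by
        have hm : ∀ J m, Measurable fun p : Fin n → X => (fitRiskConst d L + 1) *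
            momentMajorant π L h (coordWeight j ψ) J m (e J m) x p := fun J m =>
          (measurable_momentMajorant hπ L hh hω J m (e J m) x).const_mul _
        rw [lintegral_finsetSum _ fun J _ => Finset.measurable_sum _ fun m _ => hm J m]
        refine Finset.sum_congr rfl fun J _ => ?_
        rw [lintegral_finsetSum _ fun m _ => hm J m]
        refine Finset.sum_congr rfl fun m _ => ?_
        rw [lintegral_const_mul' _ _ hRfin]
    _ ≤ ∑ J ∈ Finset.powersetCard K (Finset.univ : Finset (Fin n)),
          K * ((fitRiskConst d L + 1) * B) := by
        refine Finset.sum_le_sum fun J hJ => ?_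
        have hJK := (Finset.mem_powersetCard.1 hJ).2
        refine (Finset.sum_le_card_nsmul J _ ((fitRiskConst d L + 1) * B) fun m hm => ?_).trans
          (le_of_eq (by rw [hJK, nsmul_eq_mul]))
        obtain ⟨h1, h2, h3, h4⟩ := he J m hJK hm
        gcongr
        exact hB J m _ hJK hm h1 h2 h3 h4
    _ ≤ _ := by
        rw [Finset.sum_const, Finset.card_powersetCard, Finset.card_univ, Fintype.card_fin,
          nsmul_eq_mul]
        gcongr
        exact_mod_cast Nat.choose_le_pow n K

/-- Moments weighted by a function of one observation are finite. -/
theorem lintegral_mul_cellMoment_le_crude (P : Measure X) [IsProbabilityMeasure P]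
    {π : X → EuclideanSpace ℝ (Fin d)} (hπ : Measurable π) {L K : ℕ} (hK : 1 ≤ K)
    (hc : L = 0 ∨ groupCount d L * numMonomials d L + 2 ≤ K) {A : NNReal}
    (hν : P.map π ≤ A • volume) {ψ : X → ℝ≥0∞} (hψ : Measurable ψ) (j : Fin n)
    (x : EuclideanSpace ℝ (Fin d)) {D : ℝ} (hD : ∀ᵐ a ∂P, π a ≠ x ∧ ‖π a - x‖ ≤ D) :
    ∫⁻ p, ψ (p j) * cellMoment L K 1 (fun i => π (p i)) x ∂(Measure.pi fun _ : Fin n => P)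
      ≤ (n : ℝ≥0∞) ^ K * (K * ((fitRiskConst d L + 1) *
        (((A * ENNReal.ofReal (D ^ d)) ^ numMonomials d L * groupIntegral d L) ^ groupCount d L
        * ∫⁻ a, ψ a ∂P))) :=
  lintegral_mul_cellMoment_le P hπ hK hc measurable_one hψ j x (hD.mono fun _ h => h.1) _
    fun J m e _ _ he _ hm hej =>
      lintegral_momentMajorant_le_crude P hπ L hν hψ j J m e he hm hej x hD

end CellMoment

/-! ### Radial integrals and the uniform moment bound -/

theorem exists_one_add_pow_mul_exp_le (N d : ℕ) (hd : 1 ≤ d) {c : ℝ} (hc : 0 < c) :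
    ∃ C : ℝ, 0 < C ∧ ∀ t : ℝ, 0 ≤ t → (1 + t) ^ N * Real.exp (-(c * t ^ d)) ≤ C := by
  refine ⟨2 ^ N + 2 ^ N * (N.factorial / c ^ N), by positivity, fun t ht => ?_⟩
  have hle1 : Real.exp (-(c * t ^ d)) ≤ 1 := by
    rw [Real.exp_le_one_iff]
    have : 0 ≤ c * t ^ d := by positivity
    linarith
  rcases le_total t 1 with h1 | h1
  · calc (1 + t) ^ N * Real.exp (-(c * t ^ d)) ≤ 2 ^ N * 1 := by
          gcongr
          linarith
      _ ≤ _ := by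
          rw [mul_one]
          have : (0 : ℝ) ≤ 2 ^ N * (N.factorial / c ^ N) := by positivity
          linarith
  · have h2 : t ≤ t ^ d := le_self_pow₀ h1 (by omega)
    have h3 := Real.pow_div_factorial_le_exp (c * t ^ d) (by positivity) N
    rw [div_le_iff₀ (by positivity), mul_pow] at h3
    have h4 : (t ^ d) ^ N ≤ (N.factorial / c ^ N) * Real.exp (c * t ^ d) := by
      rw [div_mul_eq_mul_div, le_div_iff₀ (by positivity)]
      linarith
    calc (1 + t) ^ N * Real.exp (-(c * t ^ d))
        ≤ (2 * t ^ d) ^ N * Real.exp (-(c * t ^ d)) := by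
          gcongr
          linarith
      _ ≤ (2 ^ N * ((N.factorial / c ^ N) * Real.exp (c * t ^ d))) * Real.exp (-(c * t ^ d)) := by
          rw [mul_pow]
          gcongr
      _ = 2 ^ N * (N.factorial / c ^ N) := by
          rw [Real.exp_neg]
          field_simp
      _ ≤ _ := by
          have : (0 : ℝ) ≤ 2 ^ N := by positivity
          linarith

/-- The integral of an integrable decreasing radial function. -/
noncomputable def radialIntegral (d : ℕ) : ℝ≥0∞ :=
  ∫⁻ y : EuclideanSpace ℝ (Fin d), ENNReal.ofReal ((1 + ‖y‖) ^ (-((d : ℝ) + 1)))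

theorem radialIntegral_ne_top (d : ℕ) : radialIntegral d ≠ ∞ := by
  refine (finite_integral_one_add_norm (E := EuclideanSpace ℝ (Fin d)) (μ := volume) ?_).ne
  rw [finrank_euclideanSpace, Fintype.card_fin]
  linarith

theorem lintegral_radial_rescale {d : ℕ} (x : EuclideanSpace ℝ (Fin d)) {lam : ℝ} (hl : 0 < lam) :
    ∫⁻ y : EuclideanSpace ℝ (Fin d), ENNReal.ofReal ((1 + lam * ‖y - x‖) ^ (-((d : ℝ) + 1)))
      = (ENNReal.ofReal (lam ^ d))⁻¹ * radialIntegral d := by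
  have h2 := lintegral_sub_right_eq_self (μ := (volume : Measure (EuclideanSpace ℝ (Fin d))))
    (fun y => ENNReal.ofReal ((1 + lam * ‖y‖) ^ (-((d : ℝ) + 1)))) x
  rw [h2]
  have hF : Measurable fun y : EuclideanSpace ℝ (Fin d) =>
      ENNReal.ofReal ((1 + ‖y‖) ^ (-((d : ℝ) + 1))) := by fun_prop
  have h3 := lintegral_map (μ := (volume : Measure (EuclideanSpace ℝ (Fin d)))) hF
    (measurable_const_smul lam)
  rw [Measure.map_addHaar_smul _ hl.ne', lintegral_smul_measure, finrank_euclideanSpace,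
    Fintype.card_fin, smul_eq_mul] at h3
  simp only [norm_smul, Real.norm_of_nonneg hl.le] at h3
  rw [← h3, radialIntegral, abs_of_pos (by positivity), ENNReal.ofReal_inv_of_pos (by positivity)]

/-- With `t = lam * R` and `lam ^ d = n`, the factor `n ^ K * (R ^ d) ^ (K - 1)` becomes `n * t ^ (d
* (K - 1))`. The exponential in `t ^ d` absorbs every power of `1 + t`, including `d + 1` extra ones
that leave an integrable profile. One factor `n` remains, to be cancelled by the integration. -/
theorem radial_weight_le (d K p : ℕ) (hd : 1 ≤ d) (hK : 1 ≤ K) {c D : ℝ} (hc : 0 < c) :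
    ∃ C : ℝ, 0 < C ∧ ∀ n : ℕ, K ≤ n → ∀ lam R : ℝ, 0 < lam → lam ^ d = n → 0 ≤ R → R ≤ D →
      (n : ℝ) ^ K * ((1 + lam * R) ^ p * ((R ^ d) ^ (K - 1)
        * Real.exp (-(c * R ^ d)) ^ (n - K)))
        ≤ n * (C * (1 + lam * R) ^ (-((d : ℝ) + 1))) := by
  obtain ⟨C, hC, hle⟩ := exists_one_add_pow_mul_exp_le (p + d * (K - 1) + (d + 1)) d hd hc
  -- The second factor pays for replacing `n - K` by `n` in the exponent, which is possible because
  -- `R ≤ D`.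
  refine ⟨C * Real.exp (c * (K * D ^ d)), by positivity, fun n hn lam R hl hln hR hRD => ?_⟩
  set t := lam * R with ht
  have ht0 : 0 ≤ t := by positivity
  have htd : t ^ d = n * R ^ d := by rw [ht, mul_pow, hln]
  have h1 : Real.exp (-(c * R ^ d)) ^ (n - K)
      ≤ Real.exp (-(c * t ^ d)) * Real.exp (c * (K * D ^ d)) := by
    rw [← Real.exp_nat_mul, ← Real.exp_add, Nat.cast_sub hn]
    apply Real.exp_le_exp.2
    rw [htd]
    have : c * (K * R ^ d) ≤ c * (K * D ^ d) := by gcongr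
    linarith [show ((n : ℝ) - K) * -(c * R ^ d) = -(c * (n * R ^ d)) + c * (K * R ^ d) by ring]
  have h2 : (n : ℝ) ^ K * (R ^ d) ^ (K - 1) = n * t ^ (d * (K - 1)) := by
    rw [pow_mul, htd, mul_pow, ← mul_assoc, ← pow_succ']
    congr 2
    omega
  have h3 := hle t ht0
  have hpos : 0 < 1 + t := by positivity
  calc (n : ℝ) ^ K * ((1 + t) ^ p * ((R ^ d) ^ (K - 1) * Real.exp (-(c * R ^ d)) ^ (n - K)))
      = (n * t ^ (d * (K - 1))) * ((1 + t) ^ p * Real.exp (-(c * R ^ d)) ^ (n - K)) := by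
        rw [← h2]; ring
    _ ≤ (n * (1 + t) ^ (d * (K - 1))) * ((1 + t) ^ p *
        (Real.exp (-(c * t ^ d)) * Real.exp (c * (K * D ^ d)))) := by
        gcongr
        linarith
    _ = n * Real.exp (c * (K * D ^ d)) * (((1 + t) ^ (p + d * (K - 1) + (d + 1))
        * Real.exp (-(c * t ^ d))) * (1 + t) ^ (-((d : ℝ) + 1))) := by
        have : (1 + t) ^ (-((d : ℝ) + 1)) = ((1 + t) ^ (d + 1))⁻¹ := by
          rw [Real.rpow_neg hpos.le]
          norm_cast
        rw [this]
        field_simp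
        ring
    _ ≤ n * Real.exp (c * (K * D ^ d)) * (C * (1 + t) ^ (-((d : ℝ) + 1))) := by
        gcongr
    _ = _ := by ring

universe w

/-- The moments of the local fit, weighted by the rescaled distance to the farthest of the `K`
nearest neighbours, are bounded uniformly in the sample size. -/
theorem exists_lintegral_cellMoment_le (d L K p : ℕ) (hd : 1 ≤ d) (hK : 1 ≤ K)
    (hc : L = 0 ∨ groupCount d L * numMonomials d L + 2 ≤ K) (A : NNReal) {c : ℝ} (hc0 : 0 < c)
    (D : ℝ) :
    ∃ C : ℝ≥0∞, C ≠ ∞ ∧ ∀ (X : Type w) [MeasurableSpace X] (n : ℕ), K ≤ n → ∀ lam : ℝ, 0 < lam →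
      lam ^ d = n → ∀ (P : Measure X) [IsProbabilityMeasure P] (π : X → EuclideanSpace ℝ (Fin d)),
      Measurable π → P.map π ≤ A • volume → ∀ x : EuclideanSpace ℝ (Fin d),
      (∀ᵐ a ∂P, π a ≠ x ∧ ‖π a - x‖ ≤ D) →
      (∀ R, 0 ≤ R → R ≤ D → ENNReal.ofReal (c * R ^ d) ≤ P.map π (Metric.closedBall x R)) →
      ∫⁻ q, cellMoment L K (fun R => ENNReal.ofReal ((1 + lam * R) ^ p)) (fun i => π (q i)) x
        ∂(Measure.pi fun _ : Fin n => P) ≤ C := by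
  obtain ⟨C, hC, hle⟩ := radial_weight_le d K p hd hK (c := c) (D := D) hc0
  set I := groupIntegral d L ^ groupCount d L with hI
  set V := (volume (Metric.closedBall (0 : EuclideanSpace ℝ (Fin d)) 1) + 1) ^ K with hV
  have hVfin : V ≠ ∞ := by
    have : volume (Metric.closedBall (0 : EuclideanSpace ℝ (Fin d)) 1) ≠ ∞ :=
      measure_closedBall_lt_top.ne
    finiteness
  have hIfin : I ≠ ∞ := groupIntegral_pow_ne_top d L
  have hRfin : fitRiskConst d L + 1 ≠ ∞ := by unfold fitRiskConst; finiteness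
  have hrad := radialIntegral_ne_top d
  refine ⟨K * ((fitRiskConst d L + 1) * (I * V * (A ^ (K - 1) * (A * (ENNReal.ofReal C
    * radialIntegral d))))), by finiteness, ?_⟩
  intro X _ n hn lam hl hln P _ π hπ hν x hD hmass
  have hprob : IsProbabilityMeasure (P.map π) := Measure.isProbabilityMeasure_map hπ.aemeasurable
  set h : ℝ → ℝ≥0∞ := fun R => ENNReal.ofReal ((1 + lam * R) ^ p) with hh
  have hmh : Measurable h := by fun_prop
  have hn0 : (n : ℝ≥0∞) ≠ 0 := by
    have : n ≠ 0 := by omega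
    exact_mod_cast this
  set H := ∫⁻ a, h ‖π a - x‖ * ((A * ENNReal.ofReal (‖π a - x‖ ^ d)) ^ (K - 1) *
          (P.map π) (Metric.closedBall x ‖π a - x‖)ᶜ ^ (n - K)) ∂P with hH
  have hbound := lintegral_mul_cellMoment_le P hπ hK hc hmh (ψ := 1) measurable_one
    (⟨0, by omega⟩ : Fin n) x (hD.mono fun _ h => h.1) (I * V * H)
    (fun J m e hJ hmJ he heJ hm _ => by
      have := lintegral_momentMajorant_le P hπ L hν hmh (⟨0, by omega⟩ : Fin n) hmJ e he heJ hm x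
        (hD.mono fun _ h => h.1)
      rwa [hJ] at this)
  simp only [Pi.one_apply, one_mul] at hbound
  refine hbound.trans ?_
  have hHle : (n : ℝ≥0∞) ^ K * H ≤ A ^ (K - 1) * (A * (ENNReal.ofReal C * radialIntegral d)) := by
    have hpt : ∀ᵐ a ∂P, (n : ℝ≥0∞) ^ K * (h ‖π a - x‖ *
        ((A * ENNReal.ofReal (‖π a - x‖ ^ d)) ^ (K - 1) *
          (P.map π) (Metric.closedBall x ‖π a - x‖)ᶜ ^ (n - K)))
        ≤ A ^ (K - 1) * (ENNReal.ofReal (n * C) *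
          ENNReal.ofReal ((1 + lam * ‖π a - x‖) ^ (-((d : ℝ) + 1)))) := by
      filter_upwards [hD] with a ha
      set R := ‖π a - x‖
      have hR : 0 ≤ R := norm_nonneg _
      -- The lower bound on the mass of balls combined with `1 - u ≤ exp (-u)`.
      have hcompl : (P.map π) (Metric.closedBall x R)ᶜ
          ≤ ENNReal.ofReal (Real.exp (-(c * R ^ d))) := by
        rw [prob_compl_eq_one_sub Metric.isClosed_closedBall.measurableSet]
        refine (tsub_le_tsub_left (hmass R hR ha.2) 1).trans ?_
        rw [← ENNReal.ofReal_one, ← ENNReal.ofReal_sub _ (by positivity)]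
        apply ENNReal.ofReal_le_ofReal
        linarith [Real.add_one_le_exp (-(c * R ^ d))]
      calc _ ≤ (n : ℝ≥0∞) ^ K * (h R * ((A * ENNReal.ofReal (R ^ d)) ^ (K - 1) *
            ENNReal.ofReal (Real.exp (-(c * R ^ d))) ^ (n - K))) := by gcongr
        _ = A ^ (K - 1) * ENNReal.ofReal ((n : ℝ) ^ K * ((1 + lam * R) ^ p * ((R ^ d) ^ (K - 1)
            * Real.exp (-(c * R ^ d)) ^ (n - K)))) := by
            rw [ENNReal.ofReal_mul (by positivity), ENNReal.ofReal_mul (by positivity),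
              ENNReal.ofReal_mul (by positivity), ENNReal.ofReal_pow (by positivity) K,
              ENNReal.ofReal_pow (by positivity) (K - 1),
              ENNReal.ofReal_pow (by positivity) (n - K), ENNReal.ofReal_natCast, mul_pow]
            simp only [hh]
            ring
        _ ≤ _ := by
            rw [← ENNReal.ofReal_mul (by positivity)]
            refine mul_le_mul' le_rfl (ENNReal.ofReal_le_ofReal ?_)
            refine (hle n hn lam R hl hln hR ha.2).trans (le_of_eq ?_)
            ring
    have hmr : Measurable fun y : EuclideanSpace ℝ (Fin d) =>
        ENNReal.ofReal ((1 + lam * ‖y - x‖) ^ (-((d : ℝ) + 1))) := by fun_prop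
    rw [hH, ← lintegral_const_mul' _ _ (by finiteness)]
    calc _ ≤ ∫⁻ a, A ^ (K - 1) * (ENNReal.ofReal (n * C) *
          ENNReal.ofReal ((1 + lam * ‖π a - x‖) ^ (-((d : ℝ) + 1)))) ∂P := lintegral_mono_ae hpt
      _ = A ^ (K - 1) * (ENNReal.ofReal (n * C) * ∫⁻ y,
          ENNReal.ofReal ((1 + lam * ‖y - x‖) ^ (-((d : ℝ) + 1))) ∂(P.map π)) := by
          rw [lintegral_const_mul' _ _ (by finiteness), lintegral_const_mul' _ _ (by finiteness),
            lintegral_map hmr hπ]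
      _ ≤ A ^ (K - 1) * (ENNReal.ofReal (n * C) * ∫⁻ y,
          ENNReal.ofReal ((1 + lam * ‖y - x‖) ^ (-((d : ℝ) + 1))) ∂(A • volume)) := by
          gcongr
      _ = _ := by
          rw [lintegral_smul_measure, lintegral_radial_rescale x hl, hln, ENNReal.smul_def,
            smul_eq_mul, ENNReal.ofReal_mul (by positivity), ENNReal.ofReal_natCast]
          congr 1
          -- Rescaling the radial integral produces `(lam ^ d)⁻¹ = n⁻¹`, which cancels the remaining
          -- factor `n`.
          calc _ = (n * (n : ℝ≥0∞)⁻¹) * (A * (ENNReal.ofReal C * radialIntegral d)) := by ring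
            _ = _ := by rw [ENNReal.mul_inv_cancel hn0 (by finiteness), one_mul]
  calc _ = K * ((fitRiskConst d L + 1) * (I * V * ((n : ℝ≥0∞) ^ K * H))) := by ring
    _ ≤ _ := by gcongr

/-! ### Consequences of the assumptions on the design -/

section Design

variable {d : ℕ} {ν : Measure (EuclideanSpace ℝ (Fin d))} {f : EuclideanSpace ℝ (Fin d) → ℝ}
  {S Sstar : Set (EuclideanSpace ℝ (Fin d))} {ρ ρbar diamS r vol : ℝ}

theorem IsDesign.measure_compl (h : IsDesign ν f S ρ ρbar diamS) : ν Sᶜ = 0 := by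
  rw [← h.support_eq]
  exact Measure.measure_compl_support

theorem IsDesign.apply_eq (h : IsDesign ν f S ρ ρbar diamS) {s : Set (EuclideanSpace ℝ (Fin d))}
    (hs : MeasurableSet s) : ν s = ∫⁻ x in s, ENNReal.ofReal (f x) := by
  nth_rewrite 1 [h.density]
  rw [withDensity_apply _ hs]

/-- The upper bound on the density is available on `S` only, but `ν` has no mass off its support. -/
theorem IsDesign.le_smul_volume (h : IsDesign ν f S ρ ρbar diamS) :
    ν ≤ ρbar.toNNReal • volume := by
  refine Measure.le_iff.2 fun s hs => ?_
  have hS : MeasurableSet S := h.isCompact.isClosed.measurableSet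
  have h1 : ν s ≤ ν (s ∩ S) := by
    calc ν s ≤ ν ((s ∩ S) ∪ Sᶜ) := measure_mono fun x hx => by
          by_cases hxS : x ∈ S
          · exact Or.inl ⟨hx, hxS⟩
          · exact Or.inr hxS
      _ ≤ ν (s ∩ S) + ν Sᶜ := measure_union_le _ _
      _ = ν (s ∩ S) := by rw [h.measure_compl, add_zero]
  refine h1.trans ?_
  rw [h.apply_eq (hs.inter hS), Measure.smul_apply]
  calc _ ≤ ∫⁻ _ in s ∩ S, ENNReal.ofReal ρbar := by
        refine setLIntegral_mono measurable_const fun x hx => ?_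
        exact ENNReal.ofReal_le_ofReal (h.upper x hx.2)
    _ = ENNReal.ofReal ρbar * volume (s ∩ S) := by rw [setLIntegral_const]
    _ ≤ _ := by
        rw [ENNReal.smul_def, smul_eq_mul]
        exact mul_le_mul' le_rfl (measure_mono Set.inter_subset_left)

theorem IsDesign.absolutelyContinuous (h : IsDesign ν f S ρ ρbar diamS) : ν ≪ volume :=
  (Measure.absolutelyContinuous_of_le h.le_smul_volume).trans
    (Measure.smul_absolutelyContinuous)

theorem IsDesign.ae_mem (h : IsDesign ν f S ρ ρbar diamS) : ∀ᵐ x ∂ν, x ∈ S := by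
  rw [ae_iff]; exact h.measure_compl

/-- The boundary of a convex set is a Lebesgue null set. The Hölder condition concerns the interior
only, so the design points have to avoid the boundary. -/
theorem IsDesign.ae_mem_interior (h : IsDesign ν f S ρ ρbar diamS) :
    ∀ᵐ x ∂ν, x ∈ interior S := by
  have h1 : ∀ᵐ x ∂ν, x ∉ frontier S := by
    rw [ae_iff]
    simp only [not_not, Set.ofPred_mem_eq]
    exact h.absolutelyContinuous (h.convex.addHaar_frontier volume)
  filter_upwards [h.ae_mem, h1] with x hx hx'
  by_contra hni
  exact hx' ⟨subset_closure hx, hni⟩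

theorem IsInnerSet.mem_interior (hr : 0 < r) (h : IsInnerSet S Sstar r vol)
    {x : EuclideanSpace ℝ (Fin d)} (hx : x ∈ Sstar) : x ∈ interior S :=
  _root_.mem_interior.2 ⟨_, h.ball_subset x hx, Metric.isOpen_ball, Metric.mem_ball_self hr⟩

theorem IsDesign.norm_sub_le (h : IsDesign ν f S ρ ρbar diamS) {x y : EuclideanSpace ℝ (Fin d)}
    (hx : x ∈ S) (hy : y ∈ S) : ‖x - y‖ ≤ diamS := by
  rw [← dist_eq_norm, ← h.diam_eq]
  exact Metric.dist_le_diam_of_mem h.isCompact.isBounded hx hy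

/-- A lower bound of the mass of balls, relative to the power `d` of the radius. -/
noncomputable def massConst (d : ℕ) (ρ r diamS : ℝ) : ℝ :=
  ρ * (min 1 (r / (|diamS| + 1))) ^ d
    * (volume : Measure (EuclideanSpace ℝ (Fin d))).real (Metric.ball 0 1)

theorem massConst_pos (d : ℕ) {ρ r : ℝ} (hρ : 0 < ρ) (hr : 0 < r) (diamS : ℝ) :
    0 < massConst d ρ r diamS := by
  have h1 : 0 < (volume : Measure (EuclideanSpace ℝ (Fin d))).real (Metric.ball 0 1) :=
    ENNReal.toReal_pos (Metric.measure_ball_pos _ _ one_pos).ne' measure_ball_lt_top.ne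
  have h2 : 0 < min 1 (r / (|diamS| + 1)) := lt_min one_pos (by positivity)
  unfold massConst
  positivity

/-- For large `R` the ball around `x` may leave `S`, but it can be shrunk by a fixed factor `κ` such
that `κ * R ≤ r`. The shrunken ball lies in `S`, where the density is at least `ρ`. The boundedness
`R ≤ diamS` makes `κ` independent of `R`. -/
theorem IsDesign.massConst_le (hd : 1 ≤ d) (h : IsDesign ν f S ρ ρbar diamS) (hi : IsInnerSet S Sstar r vol)
    (hρ : 0 < ρ) (hr : 0 < r) {x : EuclideanSpace ℝ (Fin d)} (hx : x ∈ Sstar) {R : ℝ}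
    (hR : 0 ≤ R) (hRD : R ≤ diamS) :
    ENNReal.ofReal (massConst d ρ r diamS * R ^ d) ≤ ν (Metric.closedBall x R) := by
  set κ := min 1 (r / (|diamS| + 1)) with hκ
  have hκ0 : 0 < κ := lt_min one_pos (by positivity)
  have hκR : κ * R ≤ R := mul_le_of_le_one_left hR (min_le_left _ _)
  have hκr : κ * R ≤ r := by
    calc κ * R ≤ (r / (|diamS| + 1)) * (|diamS| + 1) := by
          refine mul_le_mul (min_le_right _ _) ?_ hR (by positivity)
          linarith [le_abs_self diamS]
      _ = r := by field_simp
  have hsub : Metric.ball x (κ * R) ⊆ S :=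
    (Metric.ball_subset_ball hκr).trans (hi.ball_subset x hx)
  have hsub2 : Metric.ball x (κ * R) ⊆ Metric.closedBall x R :=
    Metric.ball_subset_closedBall.trans (Metric.closedBall_subset_closedBall hκR)
  refine le_trans ?_ (measure_mono hsub2)
  rw [h.apply_eq measurableSet_ball]
  calc ENNReal.ofReal (massConst d ρ r diamS * R ^ d)
      = ENNReal.ofReal ρ * (ENNReal.ofReal ((κ * R) ^ d)
          * volume (Metric.ball (0 : EuclideanSpace ℝ (Fin d)) 1)) := by
        have : volume (Metric.ball (0 : EuclideanSpace ℝ (Fin d)) 1)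
            = ENNReal.ofReal ((volume : Measure (EuclideanSpace ℝ (Fin d))).real
              (Metric.ball 0 1)) :=
          (ENNReal.ofReal_toReal measure_ball_lt_top.ne).symm
        rw [this, ← ENNReal.ofReal_mul (by positivity), ← ENNReal.ofReal_mul hρ.le]
        congr 1
        rw [massConst, mul_pow]
        ring
    _ ≤ ENNReal.ofReal ρ * volume (Metric.ball x (κ * R)) := by
        gcongr
        rcases (mul_nonneg hκ0.le hR).eq_or_lt with h0 | h0
        · rw [← h0, zero_pow (by omega)]; simp
        · rw [Measure.addHaar_ball_of_pos _ _ h0, finrank_euclideanSpace, Fintype.card_fin]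
    _ = ∫⁻ _ in Metric.ball x (κ * R), ENNReal.ofReal ρ := by rw [setLIntegral_const]
    _ ≤ _ := by
        refine setLIntegral_mono (ENNReal.measurable_ofReal.comp h.measurable) fun y hy => ?_
        exact ENNReal.ofReal_le_ofReal (h.lower y (hsub hy))

end Design

/-! ### Voronoi cells form a partition up to null sets -/

section Cells

variable {d n : ℕ}

theorem voronoiCell_eq_inter (Sstar : Set (EuclideanSpace ℝ (Fin d)))
    (z : Fin n → EuclideanSpace ℝ (Fin d)) (J : Finset (Fin n)) :
    voronoiCell Sstar z J = voronoiCell Set.univ z J ∩ Sstar := by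
  ext x
  simp [voronoiCell, and_comm]

/-- Cells of different index sets of the same size are disjoint. -/
theorem eq_of_mem_voronoiCell {s : Set (EuclideanSpace ℝ (Fin d))}
    {z : Fin n → EuclideanSpace ℝ (Fin d)} {J J' : Finset (Fin n)} (hJ : J.card = J'.card)
    {x : EuclideanSpace ℝ (Fin d)} (h : x ∈ voronoiCell s z J) (h' : x ∈ voronoiCell s z J') :
    J = J' := by
  by_contra hne
  have h1 : ¬ J ⊆ J' := fun hs => hne (Finset.eq_of_subset_of_card_le hs hJ.ge)
  have h2 : ¬ J' ⊆ J := fun hs => hne (Finset.eq_of_subset_of_card_le hs hJ.le).symm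
  -- An index in `J` but not in `J'`, and one in `J'` but not in `J`, would each have to be strictly
  -- closer to `x` than the other.
  obtain ⟨j, hj, hj'⟩ := Finset.not_subset.1 h1
  obtain ⟨k, hk, hk'⟩ := Finset.not_subset.1 h2
  exact lt_asymm (h.2 j hj k hk') (h'.2 k hk j hj')

theorem exists_finset_smallest {ι : Type*} [Fintype ι] (f : ι → ℝ) (hf : Function.Injective f)
    (K : ℕ) (hK : K ≤ Fintype.card ι) :
    ∃ J : Finset ι, J.card = K ∧ ∀ j ∈ J, ∀ k ∉ J, f j < f k := by
  classical
  induction K with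
  | zero => exact ⟨∅, by simp, by simp⟩
  | succ K ih =>
    obtain ⟨J, hJ, hlt⟩ := ih (by omega)
    have hne : (Jᶜ : Finset ι).Nonempty := by
      rw [← Finset.card_pos, Finset.card_compl]
      omega
    obtain ⟨k, hk, hmin⟩ := Finset.exists_min_image Jᶜ f hne
    rw [Finset.mem_compl] at hk
    refine ⟨insert k J, by rw [Finset.card_insert_of_notMem hk, hJ], fun j hj k' hk' => ?_⟩
    rw [Finset.mem_insert, not_or] at hk'
    rcases Finset.mem_insert.1 hj with rfl | hj
    · exact lt_of_le_of_ne (hmin k' (Finset.mem_compl.2 hk'.2)) fun h => hk'.1 (hf h).symm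
    · exact hlt j hj k' hk'.2

theorem exists_mem_voronoiCell {s : Set (EuclideanSpace ℝ (Fin d))}
    {z : Fin n → EuclideanSpace ℝ (Fin d)} {K : ℕ} (hK : K ≤ n) {x : EuclideanSpace ℝ (Fin d)}
    (hx : x ∈ s) (hinj : Function.Injective fun i => ‖x - z i‖) :
    ∃ J ∈ Finset.powersetCard K Finset.univ, x ∈ voronoiCell s z J := by
  obtain ⟨J, hJ, hlt⟩ := exists_finset_smallest _ hinj K (by simpa using hK)
  exact ⟨J, Finset.mem_powersetCard.2 ⟨Finset.subset_univ _, hJ⟩, hx, hlt⟩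

/-- For samples from a law with a density, almost surely there are no ties. -/
theorem ae_injective_norm_sub {X : Type*} [MeasurableSpace X] (hd : 1 ≤ d) (P : Measure X)
    [IsProbabilityMeasure P] {π : X → EuclideanSpace ℝ (Fin d)} (hπ : Measurable π)
    (hν : P.map π ≪ volume) (x : EuclideanSpace ℝ (Fin d)) :
    ∀ᵐ p ∂(Measure.pi fun _ : Fin n => P), Function.Injective fun i => ‖x - π (p i)‖ := by
  have hnt : Nontrivial (EuclideanSpace ℝ (Fin d)) := by
    have : Nonempty (Fin d) := ⟨⟨0, by omega⟩⟩
    infer_instance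
  have hpair : ∀ i j : Fin n, i ≠ j → ∀ᵐ p ∂(Measure.pi fun _ : Fin n => P),
      ‖x - π (p i)‖ ≠ ‖x - π (p j)‖ := by
    intro i j hij
    have hmz : ∀ c, Measurable fun p : Fin n → X => ‖x - π (p c)‖ := fun c =>
      ((hπ.comp (measurable_pi_apply c)).const_sub x).norm
    have hms : MeasurableSet {p : Fin n → X | ‖x - π (p i)‖ = ‖x - π (p j)‖} :=
      measurableSet_eq_fun (hmz i) (hmz j)
    rw [ae_iff]
    simp only [not_not]
    -- Once the observation `i` is fixed, a tie forces the independent observation `j` onto a sphere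
    -- around `x`, which is a null set.
    rw [← lintegral_indicator_one hms, lintegral_pi_eq_lintegral_update P i _
      (measurable_one.indicator hms), lintegral_eq_zero_iff' ]
    · refine Filter.Eventually.of_forall fun a => ?_
      have hs : MeasurableSet {p : Fin n → X | ‖x - π a‖ = ‖x - π (p j)‖} :=
        measurableSet_eq_fun measurable_const (hmz j)
      have heq : ∀ p : Fin n → X, Set.indicator {p : Fin n → X | ‖x - π (p i)‖ = ‖x - π (p j)‖}
          (1 : (Fin n → X) → ℝ≥0∞) (Function.update p i a)
          = Set.indicator {p : Fin n → X | ‖x - π a‖ = ‖x - π (p j)‖} 1 p := by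
        intro p
        classical
        simp [Set.indicator_apply, Function.update_of_ne hij.symm]
      refine (lintegral_congr heq).trans ?_
      rw [lintegral_indicator_one hs]
      have hsp : P.map π (Metric.sphere x ‖x - π a‖) = 0 :=
        hν (Measure.addHaar_sphere _ _ _)
      rw [Measure.map_apply hπ Metric.isClosed_sphere.measurableSet] at hsp
      have := (measurePreserving_eval (fun _ : Fin n => P) j).measure_preimage
        (hπ Metric.isClosed_sphere.measurableSet).nullMeasurableSet (s := π ⁻¹' Metric.sphere x ‖x - π a‖)
      rw [hsp] at this
      refine Eq.trans (congrArg _ ?_) this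
      ext p
      simp [norm_sub_rev x, eq_comm]
    · have := (measurePreserving_update P i).measurable
      exact ((measurable_one.indicator hms).comp this).lintegral_prod_left'.aemeasurable
  have hall : ∀ᵐ p ∂(Measure.pi fun _ : Fin n => P), ∀ i j : Fin n, i ≠ j →
      ‖x - π (p i)‖ ≠ ‖x - π (p j)‖ := by
    rw [ae_all_iff]; intro i
    rw [ae_all_iff]; intro j
    by_cases hij : i = j
    · simp [hij]
    · filter_upwards [hpair i j hij] with p hp _ using hp
  filter_upwards [hall] with p hp i j hij
  by_contra hne
  exact hp i j hne hij

end Cells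

/-! ### Joint measurability in the sample and the point -/

section Measurability

variable {Y : Type*} [MeasurableSpace Y] {d n : ℕ}

theorem Matrix.measurable_det {m : Type*} [Fintype m] [DecidableEq m] {M : Y → Matrix m m ℝ}
    (hM : ∀ i j, Measurable fun y => M y i j) : Measurable fun y => (M y).det := by
  simp only [Matrix.det_apply]
  refine Finset.measurable_sum _ fun σ _ => ?_
  exact (Finset.measurable_prod _ fun i _ => hM _ _).const_smul _

theorem Matrix.measurable_inv_apply {m : Type*} [Fintype m] [DecidableEq m] {M : Y → Matrix m m ℝ}
    (hM : ∀ i j, Measurable fun y => M y i j) (i j : m) : Measurable fun y => (M y)⁻¹ i j := by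
  simp only [Matrix.inv_def, Matrix.smul_apply, Ring.inverse_eq_inv', smul_eq_mul,
    Matrix.adjugate_apply]
  refine (Matrix.measurable_det hM).inv.mul (Matrix.measurable_det fun a b => ?_)
  simp only [Matrix.updateRow_apply]
  split_ifs
  · exact measurable_const
  · exact hM a b

theorem measurable_monomialVector (L : ℕ) {x w : Y → EuclideanSpace ℝ (Fin d)} (hx : Measurable x)
    (hw : Measurable w) (κ : MultiIndex d L) :
    Measurable fun y => monomialVector L (x y) (w y) κ := by
  unfold monomialVector
  refine Finset.measurable_prod _ fun k _ => ?_
  have h1 : Measurable fun y => w y k := by fun_prop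
  have h2 : Measurable fun y => x y k := by fun_prop
  exact (h1.sub h2).pow_const _

variable {z : Y → Fin n → EuclideanSpace ℝ (Fin d)} {x : Y → EuclideanSpace ℝ (Fin d)}

theorem measurable_designMatrix_apply (L : ℕ) (hz : Measurable z) (hx : Measurable x)
    (J : Finset (Fin n)) (a b : MultiIndex d L) :
    Measurable fun y => designMatrix L (z y) J (x y) a b := by
  simp only [designMatrix, Matrix.sum_apply, Matrix.vecMulVec_apply]
  refine Finset.measurable_sum _ fun j _ => ?_
  have hzj : Measurable fun y => z y j := (measurable_pi_apply j).comp hz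
  exact (measurable_monomialVector L hx hzj a).mul (measurable_monomialVector L hx hzj b)

theorem measurable_fitWeight (L : ℕ) (hz : Measurable z) (hx : Measurable x)
    (J : Finset (Fin n)) (j : Fin n) : Measurable fun y => fitWeight L (z y) J (x y) j := by
  simp only [fitWeight, Matrix.mulVec, dotProduct]
  refine Finset.measurable_sum _ fun κ _ => ?_
  exact (Matrix.measurable_inv_apply (measurable_designMatrix_apply L hz hx J) _ _).mul
    (measurable_monomialVector L hx ((measurable_pi_apply j).comp hz) κ)

theorem measurable_fitRisk (L : ℕ) (hz : Measurable z) (hx : Measurable x)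
    (J : Finset (Fin n)) : Measurable fun y => fitRisk L (z y) J (x y) := by
  unfold fitRisk
  refine Measurable.ite ?_ ?_ measurable_const
  · simp only [isUnit_iff_ne_zero]
    exact (Matrix.measurable_det (measurable_designMatrix_apply L hz hx J))
      (measurableSet_singleton (0 : ℝ)).compl
  · exact (Finset.measurable_sum _ fun j _ =>
      (measurable_fitWeight L hz hx J j).pow_const 2).ennreal_ofReal

theorem measurable_cellRadius (hz : Measurable z) (hx : Measurable x) (J : Finset (Fin n)) :
    Measurable fun y => cellRadius (z y) J (x y) := by
  unfold cellRadius
  refine measurable_coe_nnreal_real.comp ?_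
  classical
  induction J using Finset.induction_on with
  | empty => simp
  | insert a J _ ih =>
    simp only [Finset.sup_insert]
    exact (((measurable_pi_apply a).comp hz).sub hx).nnnorm.sup ih

theorem measurableSet_voronoiCell (hz : Measurable z) (hx : Measurable x) (J : Finset (Fin n)) :
    MeasurableSet {y | x y ∈ voronoiCell Set.univ (z y) J} := by
  have : {y | x y ∈ voronoiCell Set.univ (z y) J}
      = ⋂ j ∈ J, ⋂ k ∈ Jᶜ, {y | ‖x y - z y j‖ < ‖x y - z y k‖} := by
    ext y
    simp [voronoiCell]
  rw [this]
  refine Finset.measurableSet_biInter _ fun j _ => Finset.measurableSet_biInter _ fun k _ => ?_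
  have hzj : ∀ j, Measurable fun y => ‖x y - z y j‖ := fun j =>
    (hx.sub ((measurable_pi_apply j).comp hz)).norm
  exact measurableSet_lt (hzj j) (hzj k)

theorem measurable_cell_indicator {β : Type*} [MeasurableSpace β] [Zero β] (hz : Measurable z)
    (hx : Measurable x) (J : Finset (Fin n)) {F : Y → EuclideanSpace ℝ (Fin d) → β}
    (hF : Measurable fun y => F y (x y)) :
    Measurable fun y => (voronoiCell Set.univ (z y) J).indicator (F y) (x y) := by
  classical
  simp only [Set.indicator_apply]
  exact Measurable.ite (measurableSet_voronoiCell hz hx J) hF measurable_const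

theorem measurable_cellMoment (L K : ℕ) {h : ℝ → ℝ≥0∞} (hh : Measurable h) (hz : Measurable z)
    (hx : Measurable x) : Measurable fun y => cellMoment L K h (z y) (x y) := by
  unfold cellMoment
  refine Finset.measurable_sum _ fun J _ => ?_
  exact measurable_cell_indicator hz hx J ((measurable_fitRisk L hz hx J).mul
    (hh.comp (measurable_cellRadius hz hx J)))

end Measurability

/-! ### Weights of the estimator -/

section Weights

variable {d n : ℕ}

open Classical in
/-- The absolute value of the weight of the `j`-th response in the fit at `x`. -/
noncomputable def localWeight (L K : ℕ) (z : Fin n → EuclideanSpace ℝ (Fin d)) (j : Fin n)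
    (x : EuclideanSpace ℝ (Fin d)) : ℝ≥0∞ :=
  ∑ J ∈ Finset.powersetCard K Finset.univ, (voronoiCell Set.univ z J).indicator
    (fun y => if j ∈ J then ‖fitWeight L z J y j‖ₑ else 0) x

open Classical in
/-- The weight of the `j`-th response in the estimator. -/
noncomputable def estimatorWeight (Sstar : Set (EuclideanSpace ℝ (Fin d))) (L K : ℕ)
    (z : Fin n → EuclideanSpace ℝ (Fin d)) (j : Fin n) : ℝ :=
  ∑ J ∈ Finset.powersetCard K Finset.univ,
    if j ∈ J then ∫ x in voronoiCell Sstar z J, fitWeight L z J x j else 0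

theorem measurable_localWeight {Y : Type*} [MeasurableSpace Y] (L K : ℕ)
    {z : Y → Fin n → EuclideanSpace ℝ (Fin d)} {x : Y → EuclideanSpace ℝ (Fin d)}
    (hz : Measurable z) (hx : Measurable x) (j : Fin n) :
    Measurable fun y => localWeight L K (z y) j (x y) := by
  unfold localWeight
  refine Finset.measurable_sum _ fun J _ => measurable_cell_indicator hz hx J ?_
  split_ifs
  · exact (measurable_fitWeight L hz hx J j).enorm
  · exact measurable_const

theorem measurableSet_voronoiCell_of {Sstar : Set (EuclideanSpace ℝ (Fin d))}
    (hS : MeasurableSet Sstar) (z : Fin n → EuclideanSpace ℝ (Fin d)) (J : Finset (Fin n)) :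
    MeasurableSet (voronoiCell Sstar z J) := by
  rw [voronoiCell_eq_inter]
  exact (measurableSet_voronoiCell (z := fun _ => z) measurable_const measurable_id J).inter hS

theorem measurable_estimatorWeight {Sstar : Set (EuclideanSpace ℝ (Fin d))}
    (hS : MeasurableSet Sstar) (L K : ℕ) (j : Fin n) :
    Measurable fun z : Fin n → EuclideanSpace ℝ (Fin d) => estimatorWeight Sstar L K z j := by
  unfold estimatorWeight
  refine Finset.measurable_sum _ fun J _ => ?_
  split_ifs
  · have h1 : Measurable fun q : (Fin n → EuclideanSpace ℝ (Fin d)) × EuclideanSpace ℝ (Fin d) =>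
        Sstar.indicator ((voronoiCell Set.univ q.1 J).indicator
          fun x => fitWeight L q.1 J x j) q.2 := by
      classical
      simp only [Set.indicator_apply (s := Sstar)]
      exact Measurable.ite (measurable_snd hS) (measurable_cell_indicator measurable_fst
        measurable_snd J (measurable_fitWeight L measurable_fst measurable_snd J j))
        measurable_const
    have h2 := h1.stronglyMeasurable.integral_prod_right' (ν := volume)
    convert h2.measurable using 2 with z
    rw [← integral_indicator (measurableSet_voronoiCell_of hS z J)]
    refine integral_congr_ae (Filter.Eventually.of_forall fun x => ?_)
    rw [voronoiCell_eq_inter, Set.inter_comm, ← Set.indicator_indicator]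
  · exact measurable_const

theorem enorm_estimatorWeight_le (Sstar : Set (EuclideanSpace ℝ (Fin d))) (L K : ℕ)
    (z : Fin n → EuclideanSpace ℝ (Fin d)) (j : Fin n) :
    ‖estimatorWeight Sstar L K z j‖ₑ ≤ ∫⁻ x in Sstar, localWeight L K z j x := by
  unfold estimatorWeight localWeight
  have hm : ∀ J : Finset (Fin n), MeasurableSet (voronoiCell Set.univ z J) := fun J =>
    measurableSet_voronoiCell_of MeasurableSet.univ z J
  rw [lintegral_finsetSum]
  swap
  · intro J _
    refine Measurable.indicator ?_ (hm J)
    split_ifs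
    · exact (measurable_fitWeight (z := fun _ => z) L measurable_const measurable_id J j).enorm
    · exact measurable_const
  refine (enorm_sum_le _ _).trans (Finset.sum_le_sum fun J _ => ?_)
  split_ifs
  · refine (enorm_integral_le_lintegral_enorm _).trans (le_of_eq ?_)
    rw [voronoiCell_eq_inter, setLIntegral_indicator (hm J)]
  · simp

theorem sum_enorm_fitWeight_sq_le (L : ℕ) (z : Fin n → EuclideanSpace ℝ (Fin d))
    (J : Finset (Fin n)) (x : EuclideanSpace ℝ (Fin d)) :
    ∑ j ∈ J, ‖fitWeight L z J x j‖ₑ ^ 2 ≤ fitRisk L z J x := by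
  unfold fitRisk
  split_ifs
  · rw [ENNReal.ofReal_sum_of_nonneg fun _ _ => sq_nonneg _]
    refine Finset.sum_le_sum fun j _ => le_of_eq ?_
    rw [← ofReal_norm, ← ENNReal.ofReal_pow (norm_nonneg _), Real.norm_eq_abs, sq_abs]
  · exact le_top

/-- The squared weights, multiplied by a monotone function of the distance, sum up to at most the
moment of the local fit. -/
theorem sum_localWeight_sq_mul_le (L K : ℕ) {h : ℝ → ℝ≥0∞}
    (hh : ∀ s t, 0 ≤ s → s ≤ t → h s ≤ h t) (z : Fin n → EuclideanSpace ℝ (Fin d))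
    (x : EuclideanSpace ℝ (Fin d)) :
    ∑ j, localWeight L K z j x ^ 2 * h ‖x - z j‖ ≤ cellMoment L K h z x := by
  classical
  by_cases hx : ∃ J ∈ Finset.powersetCard K Finset.univ, x ∈ voronoiCell Set.univ z J
  · obtain ⟨J, hJ, hxJ⟩ := hx
    -- At most one cell contains `x`, so the sums over `J` collapse to one term and squaring
    -- produces no cross terms.
    have huniq : ∀ J' ∈ Finset.powersetCard K Finset.univ, J' ≠ J →
        x ∉ voronoiCell Set.univ z J' := fun J' hJ' hne hx' => hne
      (eq_of_mem_voronoiCell ((Finset.mem_powersetCard.1 hJ').2.trans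
        (Finset.mem_powersetCard.1 hJ).2.symm) hx' hxJ)
    have hloc : ∀ j, localWeight L K z j x = if j ∈ J then ‖fitWeight L z J x j‖ₑ else 0 := by
      intro j
      unfold localWeight
      rw [Finset.sum_eq_single J]
      · rw [Set.indicator_of_mem hxJ]
      · intro J' hJ' hne
        rw [Set.indicator_of_notMem (huniq J' hJ' hne)]
      · exact fun h => absurd hJ h
    have hcell : fitRisk L z J x * h (cellRadius z J x) ≤ cellMoment L K h z x := by
      unfold cellMoment
      refine le_trans (le_of_eq ?_) (Finset.single_le_sum (f := fun J =>
        (voronoiCell Set.univ z J).indicator (fun y => fitRisk L z J y * h (cellRadius z J y)) x)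
        (fun _ _ => zero_le) hJ)
      rw [Set.indicator_of_mem hxJ]
    refine le_trans ?_ hcell
    have hrisk := sum_enorm_fitWeight_sq_le L z J x
    calc ∑ j, localWeight L K z j x ^ 2 * h ‖x - z j‖
        = ∑ j ∈ J, ‖fitWeight L z J x j‖ₑ ^ 2 * h ‖x - z j‖ := by
          rw [← Finset.sum_subset (Finset.subset_univ J)]
          · exact Finset.sum_congr rfl fun j hj => by rw [hloc, if_pos hj]
          · intro j _ hj
            rw [hloc, if_neg hj]; simp
      _ ≤ ∑ j ∈ J, ‖fitWeight L z J x j‖ₑ ^ 2 * h (cellRadius z J x) := by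
          refine Finset.sum_le_sum fun j hj => mul_le_mul' le_rfl (hh _ _ (norm_nonneg _) ?_)
          rw [norm_sub_rev]
          exact norm_sub_le_cellRadius z x hj
      _ ≤ _ := by
          rw [← Finset.sum_mul]
          exact mul_le_mul' hrisk le_rfl
  · push Not at hx
    have : ∀ j, localWeight L K z j x = 0 := by
      intro j
      unfold localWeight
      exact Finset.sum_eq_zero fun J hJ => Set.indicator_of_notMem (hx J hJ) _
    simp [this]

/-- Cauchy–Schwarz for `a = φ ^ (-1/2) * (a * φ ^ (1/2))`. A growing `φ` yields a small first factor
when `a` is concentrated; `φ = 1` gives the plain version on a set of finite volume. -/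
theorem lintegral_sq_le_mul {E : Type*} [MeasurableSpace E] (μ : Measure E) {a φ : E → ℝ≥0∞}
    (ha : Measurable a) (hφ : Measurable φ) (h0 : ∀ x, φ x ≠ 0) (h1 : ∀ x, φ x ≠ ∞) :
    (∫⁻ x, a x ∂μ) ^ 2 ≤ (∫⁻ x, (φ x)⁻¹ ∂μ) * ∫⁻ x, a x ^ 2 * φ x ∂μ := by
  have h := ENNReal.lintegral_mul_le_Lp_mul_Lq μ (Real.HolderConjugate.two_two)
    (f := fun x => (φ x)⁻¹ ^ (1 / 2 : ℝ)) (g := fun x => a x * φ x ^ (1 / 2 : ℝ))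
    (by fun_prop) (by fun_prop)
  have hp : ∀ q : ℝ≥0∞, (q ^ (1 / 2 : ℝ)) ^ (2 : ℝ) = q := by
    intro q
    rw [← ENNReal.rpow_mul]; norm_num
  have hprod : ∀ x, (φ x)⁻¹ ^ (1 / 2 : ℝ) * (a x * φ x ^ (1 / 2 : ℝ)) = a x := by
    intro x
    calc (φ x)⁻¹ ^ (1 / 2 : ℝ) * (a x * φ x ^ (1 / 2 : ℝ))
        = a x * ((φ x)⁻¹ ^ (1 / 2 : ℝ) * φ x ^ (1 / 2 : ℝ)) := by ring
      _ = a x := by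
          rw [← ENNReal.mul_rpow_of_nonneg _ _ (by norm_num), ENNReal.inv_mul_cancel (h0 x) (h1 x),
            ENNReal.one_rpow, mul_one]
  simp only [Pi.mul_apply, hprod, hp] at h
  have hg : ∀ x, (a x * φ x ^ (1 / 2 : ℝ)) ^ (2 : ℝ) = a x ^ 2 * φ x := by
    intro x
    rw [ENNReal.mul_rpow_of_nonneg _ _ (by norm_num), hp]
    norm_cast
  simp only [hg] at h
  calc (∫⁻ x, a x ∂μ) ^ 2 ≤ ((∫⁻ x, (φ x)⁻¹ ∂μ) ^ (1 / 2 : ℝ) *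
        (∫⁻ x, a x ^ 2 * φ x ∂μ) ^ (1 / 2 : ℝ)) ^ 2 := by gcongr
    _ = _ := by
        rw [mul_pow, ← ENNReal.rpow_natCast, ← ENNReal.rpow_natCast]
        push_cast
        rw [hp, hp]

/-- The squared weights of the estimator are of the order of the inverse square of the sample
size. -/
theorem sum_estimatorWeight_sq_le (Sstar : Set (EuclideanSpace ℝ (Fin d))) (L K : ℕ) {lam : ℝ} (hl : 0 < lam)
    (z : Fin n → EuclideanSpace ℝ (Fin d)) :
    ∑ j, ‖estimatorWeight Sstar L K z j‖ₑ ^ 2 ≤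
      (ENNReal.ofReal (lam ^ d))⁻¹ * radialIntegral d *
        ∫⁻ x in Sstar, cellMoment L K (fun R => ENNReal.ofReal ((1 + lam * R) ^ (d + 1))) z x := by
  have hmw : ∀ j, Measurable fun x => localWeight L K z j x := fun j =>
    measurable_localWeight (z := fun _ => z) L K measurable_const measurable_id j
  -- The observation `j` matters essentially for `x` within distance of order `lam⁻¹`. The weight
  -- `(1 + lam * ‖x - z j‖) ^ (d + 1)` encodes this: its reciprocal has an integral of order `(lam ^
  -- d)⁻¹`, and summed over `j` the other factor is a moment of the local fit, because neighbours
  -- lie within the cell radius.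
  have hj : ∀ j, ‖estimatorWeight Sstar L K z j‖ₑ ^ 2 ≤
      (ENNReal.ofReal (lam ^ d))⁻¹ * radialIntegral d * ∫⁻ x in Sstar,
        localWeight L K z j x ^ 2 * ENNReal.ofReal ((1 + lam * ‖x - z j‖) ^ (d + 1)) := by
    intro j
    calc _ ≤ (∫⁻ x in Sstar, localWeight L K z j x) ^ 2 := by
          gcongr
          exact enorm_estimatorWeight_le Sstar L K z j
      _ ≤ _ := by
          refine (lintegral_sq_le_mul (φ := fun x =>
            ENNReal.ofReal ((1 + lam * ‖x - z j‖) ^ (d + 1))) _ (hmw j) (by fun_prop) (fun x => ?_)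
            fun x => ENNReal.ofReal_ne_top).trans (mul_le_mul' ?_ le_rfl)
          · rw [Ne, ENNReal.ofReal_eq_zero, not_le]
            positivity
          · rw [← lintegral_radial_rescale (z j) hl]
            refine (setLIntegral_le_lintegral _ _).trans (le_of_eq (lintegral_congr fun x => ?_))
            have hpos : 0 < 1 + lam * ‖x - z j‖ := by positivity
            rw [← ENNReal.ofReal_inv_of_pos (by positivity), Real.rpow_neg hpos.le]
            norm_cast
  refine (Finset.sum_le_sum fun j _ => hj j).trans ?_
  rw [← Finset.mul_sum, ← lintegral_finsetSum]
  · refine mul_le_mul' le_rfl (lintegral_mono fun x => ?_)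
    refine sum_localWeight_sq_mul_le L K
      (h := fun R => ENNReal.ofReal ((1 + lam * R) ^ (d + 1))) (fun s t hs hst => ?_) z x
    apply ENNReal.ofReal_le_ofReal
    gcongr
  · intro j _
    exact ((hmw j).pow_const 2).mul (by fun_prop)

/-- A bound without the rate, for a single weight. It serves to show that second moments are finite,
also after multiplication by `‖g‖ₑ ^ 2`. -/
theorem estimatorWeight_sq_le (Sstar : Set (EuclideanSpace ℝ (Fin d))) (L K : ℕ)
    (z : Fin n → EuclideanSpace ℝ (Fin d)) (j : Fin n) :
    ‖estimatorWeight Sstar L K z j‖ₑ ^ 2 ≤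
      volume Sstar * ∫⁻ x in Sstar, cellMoment L K 1 z x := by
  have hmw : Measurable fun x => localWeight L K z j x :=
    measurable_localWeight (z := fun _ => z) L K measurable_const measurable_id j
  calc _ ≤ (∫⁻ x in Sstar, localWeight L K z j x) ^ 2 := by
        gcongr
        exact enorm_estimatorWeight_le Sstar L K z j
    _ ≤ _ := by
        refine (lintegral_sq_le_mul (φ := fun _ => 1) _ hmw measurable_const (by simp)
          (by simp)).trans (mul_le_mul' (by simp) (lintegral_mono fun x => ?_))
        have h1 := sum_localWeight_sq_mul_le L K (h := 1) (fun _ _ _ _ => le_rfl) z x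
        refine le_trans ?_ h1
        exact Finset.single_le_sum (f := fun j => localWeight L K z j x ^ 2 * 1)
          (fun _ _ => zero_le) (Finset.mem_univ j)

end Weights

/-! ### Existence of the estimator and its linear form -/

section WellDefined

variable {d n : ℕ}

theorem setLIntegral_fitRisk_le {Sstar : Set (EuclideanSpace ℝ (Fin d))} {L K : ℕ}
    {h : ℝ → ℝ≥0∞} {z : Fin n → EuclideanSpace ℝ (Fin d)} {J : Finset (Fin n)}
    (hJ : J ∈ Finset.powersetCard K Finset.univ) :
    ∫⁻ x in voronoiCell Sstar z J, fitRisk L z J x * h (cellRadius z J x)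
      ≤ ∫⁻ x in Sstar, cellMoment L K h z x := by
  have hm : MeasurableSet (voronoiCell Set.univ z J) :=
    measurableSet_voronoiCell_of MeasurableSet.univ z J
  rw [voronoiCell_eq_inter, ← setLIntegral_indicator hm]
  refine lintegral_mono fun x => ?_
  unfold cellMoment
  exact Finset.single_le_sum (f := fun J => (voronoiCell Set.univ z J).indicator
    (fun y => fitRisk L z J y * h (cellRadius z J y)) x) (fun _ _ => zero_le) hJ

/-- The risk is infinite where the design matrix is singular, so a finite integral forces
invertibility almost everywhere. Integrability of the weights follows from `|a| ≤ 1 + a²` and the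
finite volume. -/
theorem fit_exists_of_cellMoment_ne_top {Sstar : Set (EuclideanSpace ℝ (Fin d))}
    (hvol : volume Sstar ≠ ∞) {L K : ℕ} {z : Fin n → EuclideanSpace ℝ (Fin d)}
    (hfin : ∫⁻ x in Sstar, cellMoment L K 1 z x ≠ ∞) {J : Finset (Fin n)}
    (hJ : J ∈ Finset.powersetCard K Finset.univ) :
    (∀ᵐ x ∂((volume : Measure (EuclideanSpace ℝ (Fin d))).restrict (voronoiCell Sstar z J)),
      IsUnit (designMatrix L z J x).det) ∧
    ∀ j ∈ J, IntegrableOn (fun x => fitWeight L z J x j) (voronoiCell Sstar z J) volume := by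
  have hle := setLIntegral_fitRisk_le (Sstar := Sstar) (L := L) (h := 1) (z := z) hJ
  simp only [Pi.one_apply, mul_one] at hle
  have hlt : ∫⁻ x in voronoiCell Sstar z J, fitRisk L z J x ≠ ∞ :=
    ne_top_of_le_ne_top hfin hle
  have hmr : Measurable fun x => fitRisk L z J x :=
    measurable_fitRisk (z := fun _ => z) L measurable_const measurable_id J
  refine ⟨?_, fun j hj => ⟨?_, ?_⟩⟩
  · filter_upwards [ae_lt_top hmr hlt] with x hx
    by_contra hu
    rw [fitRisk, if_neg hu] at hx
    exact lt_irrefl _ hx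
  · exact (measurable_fitWeight (z := fun _ => z) L measurable_const measurable_id J
      j).aestronglyMeasurable
  · rw [hasFiniteIntegral_iff_enorm]
    have hpt : ∀ x, ‖fitWeight L z J x j‖ₑ ≤ 1 + fitRisk L z J x := by
      intro x
      have h1 : ‖fitWeight L z J x j‖ₑ ^ 2 ≤ fitRisk L z J x :=
        (Finset.single_le_sum (f := fun j => ‖fitWeight L z J x j‖ₑ ^ 2)
          (fun _ _ => zero_le) hj).trans (sum_enorm_fitWeight_sq_le L z J x)
      rcases le_total ‖fitWeight L z J x j‖ₑ 1 with h | h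
      · exact h.trans le_self_add
      · exact ((le_self_pow₀ h two_ne_zero).trans h1).trans le_add_self
    refine lt_of_le_of_lt (lintegral_mono hpt) ?_
    rw [lintegral_add_left measurable_const, setLIntegral_const, one_mul]
    refine ENNReal.add_lt_top.2 ⟨lt_of_le_of_lt (measure_mono fun x hx => hx.1)
      (lt_top_iff_ne_top.2 hvol), lt_top_iff_ne_top.2 hlt⟩

theorem estimator_eq_sum {Sstar : Set (EuclideanSpace ℝ (Fin d))} {L K : ℕ}
    {z : Fin n → EuclideanSpace ℝ (Fin d)}
    (hInt : ∀ J ∈ Finset.powersetCard K (Finset.univ : Finset (Fin n)), ∀ j ∈ J,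
      IntegrableOn (fun x => fitWeight L z J x j) (voronoiCell Sstar z J) volume)
    (y : Fin n → ℝ) :
    estimator Sstar L K z y = ∑ j, y j * estimatorWeight Sstar L K z j := by
  classical
  unfold estimator estimatorWeight
  simp_rw [Finset.mul_sum]
  rw [Finset.sum_comm]
  refine Finset.sum_congr rfl fun J hJ => ?_
  simp_rw [localFit_eq_sum]
  rw [integral_finsetSum _ fun j hj => (hInt J hJ j hj).const_mul (y j)]
  rw [← Finset.sum_subset (Finset.subset_univ J)]
  · refine Finset.sum_congr rfl fun j hj => ?_
    rw [if_pos hj, integral_const_mul]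
  · intro j _ hj
    rw [if_neg hj, mul_zero]

end WellDefined

/-! ### Moments under the law of the population -/

section Population

variable {d : ℕ} {𝒰 : Type u} [MeasurableSpace 𝒰] {P : Measure (𝒰 × EuclideanSpace ℝ (Fin d))}
  {g : 𝒰 × EuclideanSpace ℝ (Fin d) → ℝ} {f G : EuclideanSpace ℝ (Fin d) → ℝ}
  {S Sstar : Set (EuclideanSpace ℝ (Fin d))} {ρ ρbar r diamS vol CV : ℝ}

theorem IsPopulation.volume_eq (h : IsPopulation P g f G S Sstar ρ ρbar r diamS vol CV) :
    volume Sstar = ENNReal.ofReal vol := by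
  rw [← h.inner.volume_eq, Measure.real, ENNReal.ofReal_toReal]
  exact ne_top_of_le_ne_top h.design.isCompact.measure_lt_top.ne (measure_mono h.inner.subset)

theorem IsPopulation.ae_ne_and_norm_sub_le (hd : 1 ≤ d)
    (h : IsPopulation P g f G S Sstar ρ ρbar r diamS vol CV) {x : EuclideanSpace ℝ (Fin d)}
    (hx : x ∈ Sstar) : ∀ᵐ a ∂P, a.2 ≠ x ∧ ‖a.2 - x‖ ≤ diamS := by
  have hnt : Nontrivial (EuclideanSpace ℝ (Fin d)) := by
    have : Nonempty (Fin d) := ⟨⟨0, by omega⟩⟩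
    infer_instance
  have h1 : ∀ᵐ y ∂(P.map Prod.snd), y ≠ x ∧ ‖y - x‖ ≤ diamS := by
    have h2 : ∀ᵐ y ∂(P.map Prod.snd), y ≠ x := by
      rw [ae_iff]
      simp only [not_not, Set.ofPred_eq_eq_singleton]
      exact h.design.absolutelyContinuous (measure_singleton x)
    filter_upwards [h2, h.design.ae_mem] with y hy hyS
    exact ⟨hy, h.design.norm_sub_le hyS (h.inner.subset hx)⟩
  exact ae_of_ae_map measurable_snd.aemeasurable h1

theorem IsPopulation.map_le (h : IsPopulation P g f G S Sstar ρ ρbar r diamS vol CV) :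
    P.map Prod.snd ≤ ρbar.toNNReal • (volume : Measure (EuclideanSpace ℝ (Fin d))) :=
  h.design.le_smul_volume

theorem measurable_cellMoment_sample {n : ℕ} (L K : ℕ) {h : ℝ → ℝ≥0∞} (hh : Measurable h) :
    Measurable fun q : (Fin n → 𝒰 × EuclideanSpace ℝ (Fin d)) × EuclideanSpace ℝ (Fin d) =>
      cellMoment L K h (fun i => (q.1 i).2) q.2 :=
  measurable_cellMoment L K hh (by fun_prop) measurable_snd

/-- The integrated moments of the local fit are bounded uniformly in the sample size. -/
theorem exists_population_moment_le (d l K p : ℕ) (hd : 1 ≤ d) (hK : 1 ≤ K)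
    (hc : l = 0 ∨ groupCount d l * numMonomials d l + 2 ≤ K) (ρ ρbar r diamS vol : ℝ)
    (hρ : 0 < ρ) (hr : 0 < r) :
    ∃ C : ℝ≥0∞, C ≠ ∞ ∧ ∀ (𝒰 : Type u) [MeasurableSpace 𝒰]
      (P : Measure (𝒰 × EuclideanSpace ℝ (Fin d)))
      (g : 𝒰 × EuclideanSpace ℝ (Fin d) → ℝ) (f G : EuclideanSpace ℝ (Fin d) → ℝ)
      (S Sstar : Set (EuclideanSpace ℝ (Fin d))) (CV : ℝ),
      IsPopulation P g f G S Sstar ρ ρbar r diamS vol CV → ∀ n : ℕ, K ≤ n →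
      ∀ lam : ℝ, 0 < lam → lam ^ d = n →
      ∫⁻ q, (∫⁻ x in Sstar, cellMoment l K (fun R => ENNReal.ofReal ((1 + lam * R) ^ p))
        (fun i => (q i).2) x) ∂(Measure.pi fun _ : Fin n => P) ≤ C := by
  obtain ⟨C, hC, hle⟩ := exists_lintegral_cellMoment_le.{u} d l K p hd hK hc ρbar.toNNReal
    (massConst_pos d hρ hr diamS) diamS
  refine ⟨C * ENNReal.ofReal vol, by finiteness, ?_⟩
  intro 𝒰 _ P g f G S Sstar CV h n hn lam hl hln
  have hprob := h.isProbabilityMeasure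
  have hmeas := measurable_cellMoment_sample (𝒰 := 𝒰) (d := d) (n := n) l K
    (h := fun R => ENNReal.ofReal ((1 + lam * R) ^ p)) (by fun_prop)
  rw [lintegral_lintegral_swap hmeas.aemeasurable]
  calc _ ≤ ∫⁻ _ in Sstar, C := by
        refine setLIntegral_mono' h.inner.measurableSet fun x hx => ?_
        exact hle _ n hn lam hl hln P Prod.snd measurable_snd h.map_le x
          (h.ae_ne_and_norm_sub_le hd hx) fun R hR hRD =>
            h.design.massConst_le hd h.inner hρ hr hx hR hRD
    _ = _ := by rw [setLIntegral_const, h.volume_eq]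

/-- The integrated moments are finite, also with a weight that depends on one observation. -/
theorem IsPopulation.lintegral_mul_moment_ne_top (hd : 1 ≤ d)
    (h : IsPopulation P g f G S Sstar ρ ρbar r diamS vol CV) {l K : ℕ} (hK : 1 ≤ K)
    (hc : l = 0 ∨ groupCount d l * numMonomials d l + 2 ≤ K) {n : ℕ}
    {ψ : 𝒰 × EuclideanSpace ℝ (Fin d) → ℝ≥0∞} (hψ : Measurable ψ) (hψfin : ∫⁻ a, ψ a ∂P ≠ ∞)
    (j : Fin n) :
    ∫⁻ q, (ψ (q j) * ∫⁻ x in Sstar, cellMoment l K 1 (fun i => (q i).2) x)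
      ∂(Measure.pi fun _ : Fin n => P) ≠ ∞ := by
  have hprob := h.isProbabilityMeasure
  have hmeas := measurable_cellMoment_sample (𝒰 := 𝒰) (d := d) (n := n) l K
    (h := 1) measurable_one
  have hmq : ∀ q : Fin n → 𝒰 × EuclideanSpace ℝ (Fin d),
      Measurable fun x => cellMoment l K 1 (fun i => (q i).2) x := fun q =>
    measurable_cellMoment l K (z := fun _ i => (q i).2) measurable_one measurable_const
      measurable_id
  have hψj : Measurable fun q : Fin n → 𝒰 × EuclideanSpace ℝ (Fin d) => ψ (q j) :=
    hψ.comp (measurable_pi_apply j)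
  have h1 : ∀ q : Fin n → 𝒰 × EuclideanSpace ℝ (Fin d),
      ψ (q j) * ∫⁻ x in Sstar, cellMoment l K 1 (fun i => (q i).2) x
      = ∫⁻ x in Sstar, ψ (q j) * cellMoment l K 1 (fun i => (q i).2) x := fun q =>
    (lintegral_const_mul _ (hmq q)).symm
  rw [lintegral_congr h1, lintegral_lintegral_swap]
  swap
  · exact ((hψj.comp measurable_fst).mul hmeas).aemeasurable
  have hgi := groupIntegral_pow_ne_top d l
  have hRfin : fitRiskConst d l + 1 ≠ ∞ := by unfold fitRiskConst; finiteness
  refine ne_top_of_le_ne_top ?_ (setLIntegral_mono' h.inner.measurableSet fun x hx =>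
    lintegral_mul_cellMoment_le_crude P measurable_snd hK hc h.map_le hψ j x
      (h.ae_ne_and_norm_sub_le hd hx))
  rw [setLIntegral_const, h.volume_eq]
  have hB : ((ρbar.toNNReal * ENNReal.ofReal (diamS ^ d)) ^ numMonomials d l * groupIntegral d l)
      ^ groupCount d l ≠ ∞ := by
    rw [mul_pow]
    exact ENNReal.mul_ne_top (by finiteness) hgi
  refine ENNReal.mul_ne_top (ENNReal.mul_ne_top (ENNReal.pow_ne_top (ENNReal.natCast_ne_top n))
    (ENNReal.mul_ne_top (ENNReal.natCast_ne_top K) (ENNReal.mul_ne_top hRfin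
      (ENNReal.mul_ne_top hB hψfin)))) ENNReal.ofReal_ne_top

end Population

/-! ### Regression residuals and orthogonality -/

section Residual

variable {𝒰 E : Type*} [MeasurableSpace 𝒰] [MeasurableSpace E] {P : Measure (𝒰 × E)}

/-- The `σ`-field generated by the second component. -/
abbrev sndField (𝒰 E : Type*) [MeasurableSpace E] : MeasurableSpace (𝒰 × E) :=
  MeasurableSpace.comap (Prod.snd : 𝒰 × E → E) inferInstance

/-- Factorisation of a function that is measurable with respect to the covariate field
(Doob–Dynkin). It supplies a Borel version `G'` of the regression function, with equality
everywhere; the given `G` agrees with the conditional expectation almost surely only and need not be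
measurable. -/
theorem exists_measurable_regression (P : Measure (𝒰 × E)) (g : 𝒰 × E → ℝ) :
    ∃ G' : E → ℝ, Measurable G' ∧
      P[g | sndField 𝒰 E] = fun p => G' p.2 := by
  have h : StronglyMeasurable[sndField 𝒰 E]
      (P[g | sndField 𝒰 E]) :=
    stronglyMeasurable_condExp
  obtain ⟨G', hG', he⟩ := h.exists_eq_measurable_comp
  exact ⟨G', hG'.measurable, he⟩

/-- `ε` is the error of a regression on the second component, with conditional variance at most
`CV`. -/
structure IsResidual (P : Measure (𝒰 × E)) (ε : 𝒰 × E → ℝ) (CV : ℝ) : Prop where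
  measurable : Measurable ε
  integral_mul_eq_zero : ∀ h : E → ℝ, Measurable h → ∫ p, h p.2 * ε p ∂P = 0
  lintegral_mul_sq_le : ∀ h : E → ℝ≥0∞, Measurable h →
    ∫⁻ p, h p.2 * ‖ε p‖ₑ ^ 2 ∂P ≤ ENNReal.ofReal CV * ∫⁻ p, h p.2 ∂P

/-- Orthogonality holds since a function of the covariate can be pulled out of the conditional
expectation; a non-integrable product has Bochner integral zero by convention. The second-moment
bound is the one on the conditional variance, integrated over events of the covariate field. As a
comparison of measures on `E` it extends from sets to all `h`. -/
theorem isResidual_sub [IsProbabilityMeasure P] {g : 𝒰 × E → ℝ} {CV : ℝ} (hCV : 0 ≤ CV)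
    (hg : Measurable g) (hg2 : MemLp g 2 P)
    (hvar : ∀ᵐ p ∂P, condVar (sndField 𝒰 E)
      g P p ≤ CV) {G' : E → ℝ} (hG' : Measurable G')
    (he : P[g | sndField 𝒰 E] = fun p => G' p.2) :
    IsResidual P (fun p => g p - G' p.2) CV := by
  have hm : sndField 𝒰 E ≤ Prod.instMeasurableSpace := measurable_snd.comap_le
  have hsnd : Measurable[sndField 𝒰 E] (Prod.snd : 𝒰 × E → E) := comap_measurable _
  have hG2 : MemLp (fun p : 𝒰 × E => G' p.2) 2 P := by
    rw [← he]; exact hg2.condExp one_le_two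
  have hε2 : MemLp (fun p => g p - G' p.2) 2 P := hg2.sub hG2
  have hεm : Measurable fun p : 𝒰 × E => g p - G' p.2 := hg.sub (hG'.comp measurable_snd)
  refine ⟨hεm, fun h hh => ?_, fun h hh => ?_⟩
  · by_cases hInt : Integrable (fun p => h p.2 * (g p - G' p.2)) P
    · have h1 := condExp_mul_of_stronglyMeasurable_left (m := sndField 𝒰 E) (μ := P) (f := fun p => h p.2)
        (g := fun p => g p - G' p.2) (hh.comp hsnd).stronglyMeasurable hInt
        (hε2.integrable one_le_two)
      have h2 : P[fun p => g p - G' p.2 | sndField 𝒰 E] =ᵐ[P] 0 := by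
        have h3 := condExp_sub (m := sndField 𝒰 E) (hg2.integrable one_le_two) (hG2.integrable one_le_two)
        have h4 : P[fun p : 𝒰 × E => G' p.2 | sndField 𝒰 E] = fun p => G' p.2 :=
          condExp_of_stronglyMeasurable hm (hG'.comp hsnd).stronglyMeasurable
            (hG2.integrable one_le_two)
        filter_upwards [h3] with p hp
        have : (P[g - fun p : 𝒰 × E => G' p.2 | sndField 𝒰 E]) p = 0 := by
          rw [hp, Pi.sub_apply, h4, he, sub_self]
        exact this
      rw [← integral_condExp hm]
      refine (integral_congr_ae ?_).trans (integral_zero _ _)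
      filter_upwards [h1, h2] with p hp hp'
      have : (P[(fun p => h p.2) * (fun p => g p - G' p.2) | sndField 𝒰 E]) p = 0 := by
        rw [hp, Pi.mul_apply, hp']; simp
      exact this
    · exact integral_undef hInt
  · have hsqm : Measurable fun p : 𝒰 × E => ‖g p - G' p.2‖ₑ ^ 2 := hεm.enorm.pow_const 2
    have hle : (P.withDensity fun p => ‖g p - G' p.2‖ₑ ^ 2).map Prod.snd
        ≤ ENNReal.ofReal CV • P.map Prod.snd := by
      refine Measure.le_iff.2 fun s hs => ?_
      have hs' : MeasurableSet (Prod.snd ⁻¹' s : Set (𝒰 × E)) := measurable_snd hs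
      rw [Measure.map_apply measurable_snd hs, withDensity_apply _ hs', Measure.smul_apply,
        Measure.map_apply measurable_snd hs, smul_eq_mul]
      have hInt : Integrable ((g - P[g | sndField 𝒰 E]) ^ 2) P := by
        rw [he]; exact hε2.integrable_sq
      have h1 := setIntegral_condVar (hm := hm) (X := g) (μ := P) hInt
        (s := Prod.snd ⁻¹' s) (hsnd hs)
      rw [he] at h1
      have h2 : ∫⁻ p in Prod.snd ⁻¹' s, ‖g p - G' p.2‖ₑ ^ 2 ∂P
          = ENNReal.ofReal (∫ p in Prod.snd ⁻¹' s, (g p - G' p.2) ^ 2 ∂P) := by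
        rw [ofReal_integral_eq_lintegral_ofReal hε2.integrable_sq.integrableOn
          (Filter.Eventually.of_forall fun _ => sq_nonneg _)]
        refine lintegral_congr fun p => ?_
        rw [← ofReal_norm, ← ENNReal.ofReal_pow (norm_nonneg _), Real.norm_eq_abs, sq_abs]
      rw [h2, ← h1]
      calc _ ≤ ENNReal.ofReal (∫ p in Prod.snd ⁻¹' s, CV ∂P) := by
            refine ENNReal.ofReal_le_ofReal (integral_mono_ae integrable_condVar.integrableOn
              (integrable_const _) (ae_restrict_of_ae hvar))
        _ = _ := by
            rw [setIntegral_const, smul_eq_mul, mul_comm, ENNReal.ofReal_mul hCV, Measure.real,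
              ENNReal.ofReal_toReal (measure_ne_top _ _)]
    have h3 := lintegral_mono' hle (le_refl h)
    have hhs : Measurable fun p : 𝒰 × E => h p.2 := hh.comp measurable_snd
    rw [lintegral_map hh measurable_snd, lintegral_withDensity_eq_lintegral_mul _ hsqm hhs,
      lintegral_smul_measure, lintegral_map hh measurable_snd, smul_eq_mul] at h3
    refine le_trans (le_of_eq (lintegral_congr fun p => ?_)) h3
    rw [Pi.mul_apply, mul_comm]

variable {ε : 𝒰 × E → ℝ} {CV : ℝ} {n : ℕ}

/-- Coordinate `j` is replaced by an independent copy. With the other coordinates fixed, `k` depends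
on the copy only through its second component, so the inner integral vanishes by orthogonality. -/
theorem IsResidual.integral_pi_mul_eq_zero [IsProbabilityMeasure P] (h : IsResidual P ε CV)
    (j : Fin n) {k : (Fin n → 𝒰 × E) → ℝ} (hk : Measurable k) {κ : (Fin n → 𝒰 × E) → E → ℝ}
    (hκ : ∀ q, Measurable (κ q)) (hkκ : ∀ q a, k (Function.update q j a) = κ q a.2) :
    ∫ q, k q * ε (q j) ∂(Measure.pi fun _ : Fin n => P) = 0 := by
  have hF : Measurable fun q : Fin n → 𝒰 × E => k q * ε (q j) :=
    hk.mul (h.measurable.comp (measurable_pi_apply j))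
  by_cases hInt : Integrable (fun q : Fin n → 𝒰 × E => k q * ε (q j)) (Measure.pi fun _ => P)
  · have hmp := measurePreserving_update P j
    rw [← hmp.map_eq, integral_map hmp.measurable.aemeasurable hF.aestronglyMeasurable]
    have hInt' := (hmp.integrable_comp hF.aestronglyMeasurable).2 hInt
    simp only [Function.comp_def] at hInt'
    rw [integral_prod _ hInt']
    refine (integral_congr_ae (Filter.Eventually.of_forall fun q => ?_)).trans
      (integral_zero _ _)
    simp only [hkκ, Function.update_self]
    exact h.integral_mul_eq_zero _ (hκ q)
  · exact integral_undef hInt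

theorem IsResidual.lintegral_pi_mul_sq_le [IsProbabilityMeasure P] (h : IsResidual P ε CV)
    (j : Fin n) {k : (Fin n → 𝒰 × E) → ℝ≥0∞} (hk : Measurable k)
    {κ : (Fin n → 𝒰 × E) → E → ℝ≥0∞}
    (hκ : ∀ q, Measurable (κ q)) (hkκ : ∀ q a, k (Function.update q j a) = κ q a.2) :
    ∫⁻ q, k q * ‖ε (q j)‖ₑ ^ 2 ∂(Measure.pi fun _ : Fin n => P)
      ≤ ENNReal.ofReal CV * ∫⁻ q, k q ∂(Measure.pi fun _ : Fin n => P) := by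
  have hF : Measurable fun q : Fin n → 𝒰 × E => k q * ‖ε (q j)‖ₑ ^ 2 :=
    hk.mul ((h.measurable.comp (measurable_pi_apply j)).enorm.pow_const 2)
  have hmp := measurePreserving_update P j
  have hF' := hF.comp hmp.measurable
  have hk' := hk.comp hmp.measurable
  simp only [Function.comp_def] at hF' hk'
  rw [← hmp.lintegral_comp hF, ← hmp.lintegral_comp hk,
    lintegral_prod _ hF'.aemeasurable, lintegral_prod _ hk'.aemeasurable, ← lintegral_const_mul']
  swap
  · exact ENNReal.ofReal_ne_top
  refine lintegral_mono fun q => ?_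
  simp only [hkκ, Function.update_self]
  exact h.lintegral_mul_sq_le _ (hκ q)

variable {w : Fin n → (Fin n → E) → ℝ}

theorem update_snd {𝒰 E : Type*} (q : Fin n → 𝒰 × E) (j : Fin n) (a : 𝒰 × E) :
    (fun i => (Function.update q j a i).2) = Function.update (fun i => (q i).2) j a.2 := by
  ext i
  rcases eq_or_ne i j with rfl | h
  · simp
  · simp [h]

theorem IsResidual.memLp_weighted [IsProbabilityMeasure P] (h : IsResidual P ε CV)
    (hw : ∀ j, Measurable (w j))
    (hfin : ∀ j, ∫⁻ q, ‖w j fun i => (q i).2‖ₑ ^ 2 ∂(Measure.pi fun _ : Fin n => P) ≠ ∞)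
    (j : Fin n) :
    MemLp (fun q : Fin n → 𝒰 × E => ε (q j) * w j fun i => (q i).2) 2
      (Measure.pi fun _ : Fin n => P) := by
  have hz : Measurable fun (q : Fin n → 𝒰 × E) (i : Fin n) => (q i).2 := by fun_prop
  have hm : Measurable fun q : Fin n → 𝒰 × E => ε (q j) * w j fun i => (q i).2 :=
    (h.measurable.comp (measurable_pi_apply j)).mul ((hw j).comp hz)
  refine ⟨hm.aestronglyMeasurable, ?_⟩
  rw [eLpNorm_lt_top_iff_lintegral_rpow_enorm_lt_top two_ne_zero ENNReal.ofNat_ne_top]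
  have := h.lintegral_pi_mul_sq_le j (k := fun q => ‖w j fun i => (q i).2‖ₑ ^ 2)
    (((hw j).comp hz).enorm.pow_const 2)
    (κ := fun q e => ‖w j (Function.update (fun i => (q i).2) j e)‖ₑ ^ 2)
    (fun q => ((hw j).comp (measurable_update _)).enorm.pow_const 2)
    (fun q a => by simp only [update_snd])
  refine lt_of_le_of_lt (le_of_eq ?_) (lt_of_le_of_lt this
    (ENNReal.mul_lt_top ENNReal.ofReal_lt_top (lt_top_iff_ne_top.2 (hfin j))))
  refine lintegral_congr fun q => ?_
  rw [enorm_mul, mul_comm]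
  norm_num [mul_pow]

/-- The weighted sum of independent residuals has variance at most the sum of squared weights. -/
theorem IsResidual.integral_sq_sum_le [IsProbabilityMeasure P] (h : IsResidual P ε CV)
    (hw : ∀ j, Measurable (w j))
    (hfin : ∀ j, ∫⁻ q, ‖w j fun i => (q i).2‖ₑ ^ 2 ∂(Measure.pi fun _ : Fin n => P) ≠ ∞) :
    ENNReal.ofReal (∫ q, (∑ j, ε (q j) * w j fun i => (q i).2) ^ 2
        ∂(Measure.pi fun _ : Fin n => P))
      ≤ ENNReal.ofReal CV *
        ∫⁻ q, (∑ j, ‖w j fun i => (q i).2‖ₑ ^ 2) ∂(Measure.pi fun _ : Fin n => P) := by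
  have hz : Measurable fun (q : Fin n → 𝒰 × E) (i : Fin n) => (q i).2 := by fun_prop
  have hmem := h.memLp_weighted hw hfin
  have hwz : ∀ j, Measurable fun q : Fin n → 𝒰 × E => w j fun i => (q i).2 := fun j =>
    (hw j).comp hz
  have hεj : ∀ j, Measurable fun q : Fin n → 𝒰 × E => ε (q j) := fun j =>
    h.measurable.comp (measurable_pi_apply j)
  have hwu : ∀ i j, ∀ q : Fin n → 𝒰 × E,
      Measurable fun e => w i (Function.update (fun i => (q i).2) j e) := fun i j q =>
    (hw i).comp (measurable_update _)
  -- The weights involve the covariates only, so when coordinate `j` is resampled, all factors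
  -- except `ε (q j)` depend on it through the covariate.
  have hcross : ∀ i j, i ≠ j → ∫ q, (ε (q i) * w i fun l => (q l).2) *
      (ε (q j) * w j fun l => (q l).2) ∂(Measure.pi fun _ : Fin n => P) = 0 := by
    intro i j hij
    have := h.integral_pi_mul_eq_zero j
      (k := fun q => ε (q i) * (w i fun l => (q l).2) * w j fun l => (q l).2)
      (((hεj i).mul (hwz i)).mul (hwz j))
      (κ := fun q e => ε (q i) * w i (Function.update (fun i => (q i).2) j e)
        * w j (Function.update (fun i => (q i).2) j e))
      (fun q => ((hwu i j q).const_mul _).mul (hwu j j q))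
      (fun q a => by simp only [update_snd, Function.update_of_ne hij])
    rw [← this]
    refine integral_congr_ae (Filter.Eventually.of_forall fun q => ?_)
    ring
  have hexp : ∀ q : Fin n → 𝒰 × E, (∑ j, ε (q j) * w j fun i => (q i).2) ^ 2
      = ∑ i, ∑ j, (ε (q i) * w i fun l => (q l).2) * (ε (q j) * w j fun l => (q l).2) := by
    intro q
    rw [sq, Finset.sum_mul_sum]
  have hInt : ∀ i j, Integrable (fun q => (ε (q i) * w i fun l => (q l).2) *
      (ε (q j) * w j fun l => (q l).2)) (Measure.pi fun _ : Fin n => P) := fun i j =>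
    (hmem i).integrable_mul (hmem j)
  simp_rw [hexp]
  rw [integral_finsetSum _ fun i _ => integrable_finsetSum _ fun j _ => hInt i j]
  have hdiag : ∀ i, ∫ q, (∑ j, (ε (q i) * w i fun l => (q l).2) * (ε (q j) * w j fun l => (q l).2))
      ∂(Measure.pi fun _ : Fin n => P)
      = ∫ q, (ε (q i) * w i fun l => (q l).2) ^ 2 ∂(Measure.pi fun _ : Fin n => P) := by
    intro i
    rw [integral_finsetSum _ fun j _ => hInt i j,
      Finset.sum_eq_single i (fun j _ hji => hcross i j hji.symm) (by simp)]
    simp only [sq]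
  rw [Finset.sum_congr rfl fun i _ => hdiag i, lintegral_finsetSum _ fun j _ =>
    (hwz j).enorm.pow_const 2, Finset.mul_sum,
    ENNReal.ofReal_sum_of_nonneg fun i _ => integral_nonneg fun _ => sq_nonneg _]
  refine Finset.sum_le_sum fun j _ => ?_
  have := h.lintegral_pi_mul_sq_le j (k := fun q => ‖w j fun i => (q i).2‖ₑ ^ 2)
    ((hwz j).enorm.pow_const 2)
    (κ := fun q e => ‖w j (Function.update (fun i => (q i).2) j e)‖ₑ ^ 2)
    (fun q => (hwu j j q).enorm.pow_const 2)
    (fun q a => by simp only [update_snd])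
  refine le_trans (le_of_eq ?_) this
  rw [ofReal_integral_eq_lintegral_ofReal (hmem j).integrable_sq
    (Filter.Eventually.of_forall fun _ => sq_nonneg _)]
  refine lintegral_congr fun q => ?_
  rw [← mul_pow, ← enorm_mul, ← ofReal_norm, ← ENNReal.ofReal_pow (norm_nonneg _),
    Real.norm_eq_abs, sq_abs, mul_comm]

end Residual

/-! ### Conditional moments of weighted sums -/

section Sample

variable {𝒰 E Ω : Type*} [MeasurableSpace 𝒰] [MeasurableSpace E] {P : Measure (𝒰 × E)}
  [mΩ : MeasurableSpace Ω] {μ : Measure Ω} {ε : 𝒰 × E → ℝ} {CV : ℝ} {n : ℕ}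
  {w : Fin n → (Fin n → E) → ℝ} {X : Ω → Fin n → 𝒰 × E}

/-- The `σ`-field generated by the second components of a sample. -/
abbrev covariateField (X : Ω → Fin n → 𝒰 × E) : MeasurableSpace Ω :=
  MeasurableSpace.comap (fun ω j => (X ω j).2) inferInstance

/-- The indicator of an event of the covariate field can be absorbed into the weights, and the
unconditional orthogonality then applies to each summand. -/
theorem IsResidual.condExp_sum_eq_zero [IsProbabilityMeasure P] [IsProbabilityMeasure μ]
    (h : IsResidual P ε CV) (hw : ∀ j, Measurable (w j))
    (hfin : ∀ j, ∫⁻ q, ‖w j fun i => (q i).2‖ₑ ^ 2 ∂(Measure.pi fun _ : Fin n => P) ≠ ∞)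
    (hX : MeasurePreserving X μ (Measure.pi fun _ : Fin n => P)) :
    μ[fun ω => ∑ j, ε (X ω j) * w j (fun i => (X ω i).2) |
      covariateField X] =ᵐ[μ] 0 := by
  have hz : Measurable fun (q : Fin n → 𝒰 × E) (i : Fin n) => (q i).2 := by fun_prop
  have hm : covariateField X
      ≤ mΩ := (hz.comp hX.measurable).comap_le
  have hInt : ∀ j, Integrable (fun ω => ε (X ω j) * w j (fun i => (X ω i).2)) μ := fun j =>
    hX.integrable_comp_of_integrable ((h.memLp_weighted hw hfin j).integrable one_le_two)
  refine (ae_eq_condExp_of_forall_setIntegral_eq hm (integrable_finsetSum _ fun j _ => hInt j)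
    (fun _ _ _ => integrableOn_zero) ?_ aestronglyMeasurable_zero).symm
  rintro _ ⟨t, ht, rfl⟩ _
  have hs : MeasurableSet ((fun ω j => (X ω j).2) ⁻¹' t) := hz.comp hX.measurable ht
  rw [integral_finsetSum _ fun j _ => (hInt j).integrableOn]
  simp only [integral_zero]
  refine (Finset.sum_eq_zero fun j _ => ?_).symm
  have hti : Measurable (t.indicator fun _ => (1 : ℝ)) := measurable_const.indicator ht
  have hwj := hw j
  have h0 := h.integral_pi_mul_eq_zero j
    (k := fun q => t.indicator (fun _ => (1 : ℝ)) (fun i => (q i).2) * w j fun i => (q i).2)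
    ((hti.comp hz).mul (hwj.comp hz))
    (κ := fun q e => t.indicator (fun _ => (1 : ℝ)) (Function.update (fun i => (q i).2) j e)
      * w j (Function.update (fun i => (q i).2) j e))
    (fun q => (hti.comp (measurable_update _)).mul (hwj.comp (measurable_update _)))
    (fun q a => by simp only [update_snd])
  have hmeas : Measurable fun q : Fin n → 𝒰 × E =>
      t.indicator (fun _ => (1 : ℝ)) (fun i => (q i).2) * (w j fun i => (q i).2) * ε (q j) :=
    ((hti.comp hz).mul (hwj.comp hz)).mul (h.measurable.comp (measurable_pi_apply j))
  rw [← hX.map_eq, integral_map hX.measurable.aemeasurable hmeas.aestronglyMeasurable] at h0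
  rw [← h0, ← integral_indicator hs]
  refine integral_congr_ae (Filter.Eventually.of_forall fun ω => ?_)
  by_cases hω : (fun j => (X ω j).2) ∈ t
  · simp only [Set.indicator_of_mem hω]
    rw [Set.indicator_of_mem (by exact hω)]
    ring
  · simp only [Set.indicator_of_notMem hω]
    rw [Set.indicator_of_notMem (by exact hω)]
    ring

/-- Moments of a weighted sum of responses, conditionally on the covariates. -/
theorem weighted_sum_moments [IsProbabilityMeasure P] [IsProbabilityMeasure μ]
    {g : 𝒰 × E → ℝ} {G' : E → ℝ} (hg : Measurable g) (hG' : Measurable G')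
    (h : IsResidual P (fun p => g p - G' p.2) CV) (hw : ∀ j, Measurable (w j))
    (hfin : ∀ j, ∫⁻ q, ‖w j fun i => (q i).2‖ₑ ^ 2 ∂(Measure.pi fun _ : Fin n => P) ≠ ∞)
    (hgfin : ∀ j, ∫⁻ q, ‖g (q j)‖ₑ ^ 2 * ‖w j fun i => (q i).2‖ₑ ^ 2
      ∂(Measure.pi fun _ : Fin n => P) ≠ ∞)
    (hX : MeasurePreserving X μ (Measure.pi fun _ : Fin n => P)) {T : Ω → ℝ}
    (hT : T =ᵐ[μ] fun ω => ∑ j, g (X ω j) * w j (fun i => (X ω i).2)) :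
    MemLp T 2 μ ∧
    μ[T | covariateField X] =ᵐ[μ]
      (fun ω => ∑ j, G' (X ω j).2 * w j (fun i => (X ω i).2)) ∧
    ENNReal.ofReal (∫ ω, condVar (covariateField X)
      T μ ω ∂μ) ≤ ENNReal.ofReal CV *
        ∫⁻ q, (∑ j, ‖w j fun i => (q i).2‖ₑ ^ 2) ∂(Measure.pi fun _ : Fin n => P) := by
  have hz : Measurable fun (q : Fin n → 𝒰 × E) (i : Fin n) => (q i).2 := by fun_prop
  have hm : covariateField X ≤ mΩ := (hz.comp hX.measurable).comap_le
  have hgm : ∀ j, MemLp (fun q : Fin n → 𝒰 × E => g (q j) * w j fun i => (q i).2) 2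
      (Measure.pi fun _ : Fin n => P) := by
    intro j
    refine ⟨((hg.comp (measurable_pi_apply j)).mul ((hw j).comp hz)).aestronglyMeasurable, ?_⟩
    rw [eLpNorm_lt_top_iff_lintegral_rpow_enorm_lt_top two_ne_zero ENNReal.ofNat_ne_top]
    refine lt_of_le_of_lt (le_of_eq (lintegral_congr fun q => ?_))
      (lt_top_iff_ne_top.2 (hgfin j))
    rw [enorm_mul]
    norm_num [mul_pow]
  have hεm := h.memLp_weighted hw hfin
  have hT2 : MemLp T 2 μ := by
    rw [memLp_congr_ae hT]
    exact memLp_finsetSum _ fun j _ => (hgm j).comp_measurePreserving hX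
  have hεX : ∀ j, MemLp (fun ω => (g (X ω j) - G' (X ω j).2) * w j (fun i => (X ω i).2)) 2 μ :=
    fun j => (hεm j).comp_measurePreserving hX
  -- Square-integrability is inherited as a difference: the weighted response minus the weighted
  -- residual.
  have hGX : ∀ j, MemLp (fun ω => G' (X ω j).2 * w j (fun i => (X ω i).2)) 2 μ := by
    intro j
    have := ((hgm j).comp_measurePreserving hX).sub (hεX j)
    refine (memLp_congr_ae (Filter.Eventually.of_forall fun ω => ?_)).1 this
    simp only [Pi.sub_apply, Function.comp_apply]
    ring
  have hGm : StronglyMeasurable[covariateField X] fun ω => ∑ j, G' (X ω j).2 * w j (fun i => (X ω i).2) := by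
    have hcm : Measurable[covariateField X] fun ω j => (X ω j).2 := comap_measurable _
    have : Measurable fun z : Fin n → E => ∑ j, G' (z j) * w j z :=
      Finset.measurable_sum _ fun j _ => (hG'.comp (measurable_pi_apply j)).mul (hw j)
    exact (this.comp hcm).stronglyMeasurable
  have hGint : Integrable (fun ω => ∑ j, G' (X ω j).2 * w j (fun i => (X ω i).2)) μ :=
    integrable_finsetSum _ fun j _ => (hGX j).integrable one_le_two
  have hεint : Integrable (fun ω => ∑ j, (g (X ω j) - G' (X ω j).2) * w j (fun i => (X ω i).2)) μ :=
    integrable_finsetSum _ fun j _ => (hεX j).integrable one_le_two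
  have hdec : T =ᵐ[μ] (fun ω => ∑ j, G' (X ω j).2 * w j (fun i => (X ω i).2))
      + fun ω => ∑ j, (g (X ω j) - G' (X ω j).2) * w j (fun i => (X ω i).2) := by
    filter_upwards [hT] with ω hω
    rw [hω, Pi.add_apply, ← Finset.sum_add_distrib]
    exact Finset.sum_congr rfl fun j _ => by ring
  have hce : μ[T | covariateField X] =ᵐ[μ] (fun ω => ∑ j, G' (X ω j).2 * w j (fun i => (X ω i).2)) := by
    refine (condExp_congr_ae hdec).trans ((condExp_add hGint hεint _).trans ?_)
    rw [condExp_of_stronglyMeasurable hm hGm hGint]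
    filter_upwards [h.condExp_sum_eq_zero hw hfin hX] with ω hω
    rw [Pi.add_apply, hω]
    simp
  refine ⟨hT2, hce, ?_⟩
  -- Subtracting the conditional mean leaves exactly the weighted sum of residuals.
  have h1 : ∫ ω, condVar (covariateField X) T μ ω ∂μ = ∫ q, (∑ j, (g (q j) - G' (q j).2) * w j fun i => (q i).2) ^ 2
      ∂(Measure.pi fun _ : Fin n => P) := by
    have hmV : Measurable fun q : Fin n → 𝒰 × E =>
        (∑ j, (g (q j) - G' (q j).2) * w j fun i => (q i).2) ^ 2 :=
      (Finset.measurable_sum _ fun j _ => (h.measurable.comp (measurable_pi_apply j)).mul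
        ((hw j).comp hz)).pow_const 2
    rw [condVar, integral_condExp hm, ← hX.map_eq,
      integral_map hX.measurable.aemeasurable hmV.aestronglyMeasurable]
    refine integral_congr_ae ?_
    filter_upwards [hdec, hce] with ω h1 h2
    simp only [Pi.pow_apply, Pi.sub_apply, h2, h1, Pi.add_apply, add_sub_cancel_left]
  rw [h1]
  exact h.integral_sq_sum_le hw hfin

end Sample

theorem IsSample.measurePreserving {Ω 𝒰 : Type*} [MeasurableSpace Ω] [MeasurableSpace 𝒰]
    {d n : ℕ} {μ : Measure Ω} [IsProbabilityMeasure μ] {U : Fin n → Ω → 𝒰}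
    {Z : Fin n → Ω → EuclideanSpace ℝ (Fin d)} {P : Measure (𝒰 × EuclideanSpace ℝ (Fin d))}
    (h : IsSample μ U Z P) :
    MeasurePreserving (fun ω j => (U j ω, Z j ω)) μ (Measure.pi fun _ : Fin n => P) := by
  have hm : ∀ j, Measurable fun ω => (U j ω, Z j ω) := fun j =>
    (h.measurable_U j).prodMk (h.measurable_Z j)
  refine ⟨measurable_pi_lambda _ hm, ?_⟩
  rw [(iIndepFun_iff_map_fun_eq_pi_map fun j => (hm j).aemeasurable).1 h.indep]
  simp only [h.law]

/-! ### Taylor expansion and the error of the local fit -/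

section Taylor

/-- Taylor's theorem for a chain of derivatives whose last member varies by at most `M`. -/
theorem abs_sub_taylor_le (l : ℕ) {M : ℝ} (hM : 0 ≤ M) : ∀ φ : ℕ → ℝ → ℝ,
    (∀ i < l, ∀ t ∈ Set.Icc (0 : ℝ) 1, HasDerivAt (φ i) (φ (i + 1) t) t) →
    (∀ t ∈ Set.Icc (0 : ℝ) 1, |φ l t - φ l 0| ≤ M) →
    ∀ t ∈ Set.Icc (0 : ℝ) 1,
      |φ 0 t - ∑ i ∈ Finset.range (l + 1), φ i 0 / (i.factorial : ℝ) * t ^ i| ≤ M := by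
  induction l with
  | zero =>
    intro φ _ h t ht
    simpa using h t ht
  | succ l ih =>
    intro φ hder h t ht
    -- The shifted chain bounds the derivative of the remainder by `M`. The mean value inequality on
    -- `[0, t]` with `t ≤ 1` returns the same `M`; no factorial is gained, and none is needed.
    have h1 := ih (fun i => φ (i + 1)) (fun i hi => hder (i + 1) (by omega)) h
    have hF : ∀ s ∈ Set.Icc (0 : ℝ) 1, HasDerivWithinAt
        (fun s => φ 0 s - ∑ i ∈ Finset.range (l + 2), φ i 0 / (i.factorial : ℝ) * s ^ i)
        (φ 1 s - ∑ i ∈ Finset.range (l + 1), φ (i + 1) 0 / (i.factorial : ℝ) * s ^ i)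
        (Set.Icc 0 1) s := by
      intro s hs
      refine HasDerivAt.hasDerivWithinAt ((hder 0 (by omega) s hs).sub ?_)
      have h2 : HasDerivAt (fun s : ℝ => ∑ i ∈ Finset.range (l + 2),
          φ i 0 / (i.factorial : ℝ) * s ^ i)
          (∑ i ∈ Finset.range (l + 2), φ i 0 / (i.factorial : ℝ) * ((i : ℝ) * s ^ (i - 1))) s :=
        HasDerivAt.fun_sum fun i _ => (hasDerivAt_pow i s).const_mul _
      refine h2.congr_deriv ?_
      rw [Finset.sum_range_succ']
      simp only [Nat.cast_zero, zero_mul, mul_zero, add_zero, Nat.add_sub_cancel]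
      refine Finset.sum_congr rfl fun i _ => ?_
      rw [Nat.factorial_succ]
      push_cast
      have : (i.factorial : ℝ) ≠ 0 := by positivity
      field_simp
    have h3 := (convex_Icc (0 : ℝ) 1).norm_image_sub_le_of_norm_hasDerivWithin_le hF
      (fun s hs => by rw [Real.norm_eq_abs]; exact h1 s hs) (x := 0) (y := t) (by simp) ht
    have h0 : φ 0 0 - ∑ i ∈ Finset.range (l + 2), φ i 0 / (i.factorial : ℝ) * (0 : ℝ) ^ i = 0 := by
      rw [Finset.sum_range_succ']
      simp
    rw [h0, sub_zero, sub_zero, Real.norm_eq_abs, Real.norm_eq_abs, abs_of_nonneg ht.1] at h3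
    exact h3.trans (mul_le_of_le_one_right hM ht.2)

variable {d : ℕ}

theorem EuclideanSpace.sum_smul_single (v : EuclideanSpace ℝ (Fin d)) :
    ∑ k, v k • EuclideanSpace.single k (1 : ℝ) = v := by
  ext i
  simp [Finset.sum_apply, Pi.single_apply]

theorem ContinuousMultilinearMap.map_diagonal_eq_sum {i : ℕ}
    (M : ContinuousMultilinearMap ℝ (fun _ : Fin i => EuclideanSpace ℝ (Fin d)) ℝ)
    (v : EuclideanSpace ℝ (Fin d)) :
    M (fun _ => v) = ∑ s : Fin i → Fin d, (∏ a, v (s a)) *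
      M fun a => EuclideanSpace.single (s a) (1 : ℝ) := by
  conv_lhs => rw [← EuclideanSpace.sum_smul_single v]
  rw [ContinuousMultilinearMap.map_sum]
  refine Finset.sum_congr rfl fun s _ => ?_
  rw [ContinuousMultilinearMap.map_smul_univ, smul_eq_mul]

/-- The multi-index that counts how often each coordinate occurs in a sequence. -/
def MultiIndex.ofSequence {l i : ℕ} (hi : i ≤ l) (s : Fin i → Fin d) : MultiIndex d l :=
  ⟨fun k => ⟨(Finset.univ.filter fun a => s a = k).card, by
    have := Finset.card_le_univ (Finset.univ.filter fun a => s a = k)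
    rw [Fintype.card_fin] at this
    omega⟩, by
    have := Finset.card_eq_sum_card_fiberwise (f := s) (s := Finset.univ) (t := Finset.univ)
      (by simp)
    simp only [Finset.card_univ, Fintype.card_fin] at this
    exact (this.symm.le).trans hi⟩

theorem monomialVector_ofSequence {l i : ℕ} (hi : i ≤ l) (s : Fin i → Fin d)
    (x y : EuclideanSpace ℝ (Fin d)) :
    monomialVector l x y (MultiIndex.ofSequence hi s) = ∏ a, (y - x) (s a) := by
  rw [Finset.prod_comp (fun k => (y - x) k) s, monomialVector, ← Finset.prod_subset
    (Finset.subset_univ (Finset.univ.image s))]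
  · rfl
  · intro k _ hk
    have : (Finset.univ.filter fun a => s a = k) = ∅ := by
      rw [Finset.filter_eq_empty_iff]
      rintro a _ rfl
      exact hk (Finset.mem_image_of_mem s (Finset.mem_univ a))
    simp [MultiIndex.ofSequence, this]

theorem MultiIndex.ofSequence_ne_zero {l i : ℕ} (hi : i ≤ l) (h0 : i ≠ 0) (s : Fin i → Fin d) :
    MultiIndex.ofSequence hi s ≠ MultiIndex.zero d l := by
  intro h
  have h1 := congrArg (fun κ : MultiIndex d l => (κ.1 (s ⟨0, by omega⟩) : ℕ)) h
  simp only [MultiIndex.ofSequence, MultiIndex.zero, Fin.val_zero,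
    Finset.card_eq_zero, Finset.filter_eq_empty_iff] at h1
  exact h1 (Finset.mem_univ _) rfl

/-- Weights that reproduce polynomials annihilate the homogeneous terms of positive degree. -/
theorem sum_mul_multilinear_eq_zero {ι : Type*} {J : Finset ι} {a : ι → ℝ}
    {z : ι → EuclideanSpace ℝ (Fin d)} {x : EuclideanSpace ℝ (Fin d)} {l : ℕ}
    (ha : ∀ κ, ∑ j ∈ J, a j * monomialVector l x (z j) κ
      = if κ = MultiIndex.zero d l then 1 else 0) {i : ℕ} (hi : i ≤ l) (h0 : i ≠ 0)
    (M : ContinuousMultilinearMap ℝ (fun _ : Fin i => EuclideanSpace ℝ (Fin d)) ℝ) :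
    ∑ j ∈ J, a j * M (fun _ => z j - x) = 0 := by
  simp_rw [M.map_diagonal_eq_sum, Finset.mul_sum]
  rw [Finset.sum_comm]
  refine Finset.sum_eq_zero fun s _ => ?_
  have h1 := ha (MultiIndex.ofSequence hi s)
  rw [if_neg (MultiIndex.ofSequence_ne_zero hi h0 s)] at h1
  simp_rw [monomialVector_ofSequence, ← mul_assoc] at h1 ⊢
  rw [← Finset.sum_mul, h1, zero_mul]

variable {V : Set (EuclideanSpace ℝ (Fin d))} {l : ℕ} {β CH : ℝ}
  {G : EuclideanSpace ℝ (Fin d) → ℝ}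

/-- One-dimensional Taylor along the segment from `x` to `y`, which convexity keeps in `V`. The
`l`-th directional derivative is a sum over `d ^ l` sequences of coordinates; each partial
derivative varies by at most `CH * ‖v‖ ^ β` and has a coefficient of size at most `‖v‖ ^ l`. -/
theorem HolderClass.abs_sub_taylor_le (h : HolderClass V l β CH G) (hV : IsOpen V)
    (hconv : Convex ℝ V) (hβ : 0 < β) (hCH : 0 < CH) {x y : EuclideanSpace ℝ (Fin d)}
    (hx : x ∈ V) (hy : y ∈ V) :
    |G y - ∑ i ∈ Finset.range (l + 1), iteratedFDeriv ℝ i G x (fun _ => y - x)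
      / (i.factorial : ℝ)| ≤ (d : ℝ) ^ l * CH * ‖y - x‖ ^ ((l : ℝ) + β) := by
  set v := y - x with hv
  have hline : ∀ t ∈ Set.Icc (0 : ℝ) 1, x + t • v ∈ V := fun t ht =>
    hconv.add_smul_sub_mem hx hy ht
  have hder : ∀ i < l, ∀ t ∈ Set.Icc (0 : ℝ) 1,
      HasDerivAt (fun t : ℝ => iteratedFDeriv ℝ i G (x + t • v) fun _ => v)
        (iteratedFDeriv ℝ (i + 1) G (x + t • v) fun _ => v) t := by
    intro i hi t ht
    have hcd : ContDiffAt ℝ l G (x + t • v) := h.1.contDiffAt (hV.mem_nhds (hline t ht))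
    have hdiff : DifferentiableAt ℝ (iteratedFDeriv ℝ i G) (x + t • v) :=
      hcd.differentiableAt_iteratedFDeriv (by exact_mod_cast hi)
    have hl : HasDerivAt (fun t : ℝ => x + t • v) v t := by
      simpa using ((hasDerivAt_id t).smul_const v).const_add x
    have h1 := hdiff.hasFDerivAt.comp_hasDerivAt t hl
    have h2 := (ContinuousMultilinearMap.apply ℝ (fun _ : Fin i => EuclideanSpace ℝ (Fin d)) ℝ
      fun _ => v).hasFDerivAt.comp_hasDerivAt t h1
    rw [iteratedFDeriv_succ_apply_left]
    exact h2
  have hlast : ∀ t ∈ Set.Icc (0 : ℝ) 1,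
      |(iteratedFDeriv ℝ l G (x + t • v) fun _ => v)
        - (iteratedFDeriv ℝ l G (x + (0 : ℝ) • v) fun _ => v)|
        ≤ (d : ℝ) ^ l * CH * ‖v‖ ^ ((l : ℝ) + β) := by
    intro t ht
    rw [zero_smul, add_zero, ContinuousMultilinearMap.map_diagonal_eq_sum,
      ContinuousMultilinearMap.map_diagonal_eq_sum, ← Finset.sum_sub_distrib]
    have hterm : ∀ s : Fin l → Fin d,
        |(∏ a, v (s a)) * (iteratedFDeriv ℝ l G (x + t • v)
            fun a => EuclideanSpace.single (s a) (1 : ℝ))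
          - (∏ a, v (s a)) * (iteratedFDeriv ℝ l G x
            fun a => EuclideanSpace.single (s a) (1 : ℝ))|
          ≤ CH * ‖v‖ ^ ((l : ℝ) + β) := by
      intro s
      rw [← mul_sub, abs_mul, Finset.abs_prod]
      have h1 : ∏ a, |v (s a)| ≤ ‖v‖ ^ l := by
        calc _ ≤ ∏ _a : Fin l, ‖v‖ := Finset.prod_le_prod (fun _ _ => abs_nonneg _) fun a _ => by
              rw [← Real.norm_eq_abs]; exact PiLp.norm_apply_le v (s a)
          _ = _ := by simp
      have h2 := h.2 s _ (hline t ht) _ hx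
      have h3 : ‖x + t • v - x‖ ^ β ≤ ‖v‖ ^ β := by
        refine Real.rpow_le_rpow (norm_nonneg _) ?_ hβ.le
        rw [add_sub_cancel_left, norm_smul, Real.norm_eq_abs, abs_of_nonneg ht.1]
        exact mul_le_of_le_one_left (norm_nonneg _) ht.2
      rw [Real.rpow_add_of_nonneg (norm_nonneg _) (Nat.cast_nonneg _) hβ.le, Real.rpow_natCast]
      calc _ ≤ ‖v‖ ^ l * (CH * ‖v‖ ^ β) := by
            refine mul_le_mul h1 (h2.trans (mul_le_mul_of_nonneg_left h3 hCH.le))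
              (abs_nonneg _) (by positivity)
        _ = _ := by ring
    refine (Finset.abs_sum_le_sum_abs _ _).trans ((Finset.sum_le_sum fun s _ => hterm s).trans
      (le_of_eq ?_))
    simp
    ring
  have h1 := _root_.abs_sub_taylor_le l (M := (d : ℝ) ^ l * CH * ‖v‖ ^ ((l : ℝ) + β))
    (by positivity) (fun i t => iteratedFDeriv ℝ i G (x + t • v) fun _ => v) hder hlast 1 (by simp)
  simpa [hv] using h1

variable {n : ℕ} {z : Fin n → EuclideanSpace ℝ (Fin d)} {J : Finset (Fin n)}

/-- The error of the local fit to the values of a function of the Hölder class. -/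
theorem HolderClass.localFit_sub_sq_le (h : HolderClass V l β CH G) (hV : IsOpen V)
    (hconv : Convex ℝ V) (hβ : 0 < β) (hCH : 0 < CH) {x : EuclideanSpace ℝ (Fin d)}
    (hx : x ∈ V) (hz : ∀ j, z j ∈ V) (hu : IsUnit (designMatrix l z J x).det) :
    ‖localFit l z (fun j => G (z j)) J x - G x‖ₑ ^ 2 ≤
      ENNReal.ofReal (((d : ℝ) ^ l * CH) ^ 2 * J.card) *
        (fitRisk l z J x * ENNReal.ofReal (cellRadius z J x ^ (2 * ((l : ℝ) + β)))) := by
  rw [fitRisk, if_pos hu, localFit_eq_sum]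
  set a := fitWeight l z J x with ha
  have hrep := sum_fitWeight_mul_monomialVector hu
  set R := cellRadius z J x with hR
  have hR0 : 0 ≤ R := cellRadius_nonneg z J x
  have hsum1 : ∑ j ∈ J, a j = 1 := by
    have h1 := hrep (MultiIndex.zero d l)
    rw [if_pos rfl] at h1
    simpa [monomialVector, MultiIndex.zero] using h1
  -- The weights reproduce the Taylor polynomial at its centre `x`: the homogeneous terms of
  -- positive degree are annihilated, and the constant term is `G x`. Only the remainders at the
  -- neighbours are left.
  have hT : ∑ j ∈ J, a j * (∑ i ∈ Finset.range (l + 1),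
      iteratedFDeriv ℝ i G x (fun _ => z j - x) / (i.factorial : ℝ)) = G x := by
    simp_rw [Finset.mul_sum]
    rw [Finset.sum_comm, Finset.sum_range_succ', Finset.sum_eq_zero, zero_add]
    · simp [← Finset.sum_mul, hsum1]
    · intro i hi
      have h1 := sum_mul_multilinear_eq_zero hrep (i := i + 1)
        (by rw [Finset.mem_range] at hi; omega) (by omega) (iteratedFDeriv ℝ (i + 1) G x)
      simp_rw [← mul_div_assoc]
      rw [← Finset.sum_div, h1, zero_div]
  have herr : |∑ j ∈ J, G (z j) * a j - G x|
      ≤ ((d : ℝ) ^ l * CH * R ^ ((l : ℝ) + β)) * ∑ j ∈ J, |a j| := by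
    rw [← hT, ← Finset.sum_sub_distrib, Finset.mul_sum]
    refine (Finset.abs_sum_le_sum_abs _ _).trans (Finset.sum_le_sum fun j hj => ?_)
    rw [mul_comm (G (z j)), ← mul_sub, abs_mul, mul_comm]
    refine mul_le_mul_of_nonneg_right ((h.abs_sub_taylor_le hV hconv hβ hCH hx (hz j)).trans ?_)
      (abs_nonneg _)
    refine mul_le_mul_of_nonneg_left (Real.rpow_le_rpow (norm_nonneg _) ?_ (by positivity))
      (by positivity)
    exact norm_sub_le_cellRadius z x hj
  have hcs : (∑ j ∈ J, |a j|) ^ 2 ≤ J.card * ∑ j ∈ J, a j ^ 2 := by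
    have := sq_sum_le_card_mul_sum_sq (s := J) (f := fun j => |a j|)
    simpa using this
  have hR2 : (R ^ ((l : ℝ) + β)) ^ 2 = R ^ (2 * ((l : ℝ) + β)) := by
    rw [← Real.rpow_natCast, ← Real.rpow_mul hR0]
    congr 1
    push_cast
    ring
  rw [← ENNReal.ofReal_mul (Finset.sum_nonneg fun _ _ => sq_nonneg _),
    ← ENNReal.ofReal_mul (by positivity), ← ofReal_norm, ← ENNReal.ofReal_pow (norm_nonneg _),
    Real.norm_eq_abs]
  refine ENNReal.ofReal_le_ofReal ?_
  calc _ ≤ (((d : ℝ) ^ l * CH * R ^ ((l : ℝ) + β)) * ∑ j ∈ J, |a j|) ^ 2 := by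
        exact pow_le_pow_left₀ (abs_nonneg _) herr 2
    _ = ((d : ℝ) ^ l * CH) ^ 2 * R ^ (2 * ((l : ℝ) + β)) * (∑ j ∈ J, |a j|) ^ 2 := by
        rw [← hR2]; ring
    _ ≤ ((d : ℝ) ^ l * CH) ^ 2 * R ^ (2 * ((l : ℝ) + β)) * (J.card * ∑ j ∈ J, a j ^ 2) :=
        mul_le_mul_of_nonneg_left hcs (by positivity)
    _ = _ := by ring

end Taylor

/-! ### The bias for given design points -/

section Bias

variable {d n : ℕ} {V Sstar : Set (EuclideanSpace ℝ (Fin d))} {l K : ℕ} {β CH : ℝ}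
  {G G' : EuclideanSpace ℝ (Fin d) → ℝ} {z : Fin n → EuclideanSpace ℝ (Fin d)}

/-- The integral over a set is the sum of the integrals over the cells that partition it. -/
theorem setIntegral_eq_sum_voronoiCell (hS : MeasurableSet Sstar)
    (hpart : ∀ᵐ x ∂(volume.restrict Sstar), ∃ J ∈ Finset.powersetCard K Finset.univ,
      x ∈ voronoiCell Set.univ z J) (hG : IntegrableOn G' Sstar) :
    ∫ x in Sstar, G' x = ∑ J ∈ Finset.powersetCard K Finset.univ,
      ∫ x in voronoiCell Sstar z J, G' x := by
  rw [← integral_biUnion_finset]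
  · refine setIntegral_congr_set ?_
    rw [ae_restrict_iff' hS] at hpart
    filter_upwards [hpart] with x hx
    refine propext ⟨fun hxS => ?_, fun hxU => ?_⟩
    · obtain ⟨J, hJ, hxJ⟩ := hx hxS
      exact Set.mem_biUnion hJ (by rw [voronoiCell_eq_inter]; exact ⟨hxJ, hxS⟩)
    · obtain ⟨J, _, hxJ⟩ := Set.mem_iUnion₂.1 hxU
      exact hxJ.1
  · exact fun J _ => measurableSet_voronoiCell_of hS z J
  · intro J hJ J' hJ' hne
    refine Set.disjoint_left.2 fun x hx hx' => hne (eq_of_mem_voronoiCell ?_ hx hx')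
    rw [(Finset.mem_powersetCard.1 hJ).2, (Finset.mem_powersetCard.1 hJ').2]
  · exact fun J _ => hG.mono_set fun x hx => hx.1

/-- The squared bias, given the design points, is bounded by a moment of the local fit. -/
theorem bias_sq_le (hV : IsOpen V) (hconv : Convex ℝ V) (hβ : 0 < β) (hCH : 0 < CH)
    (h : HolderClass V l β CH G) (hS : MeasurableSet Sstar) (hSV : Sstar ⊆ V)
    (hvol : volume Sstar ≠ ∞) (hfin : ∫⁻ x in Sstar, cellMoment l K 1 z x ≠ ∞)
    (hpart : ∀ᵐ x ∂(volume.restrict Sstar), ∃ J ∈ Finset.powersetCard K Finset.univ,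
      x ∈ voronoiCell Set.univ z J)
    (hG' : Measurable G') (hGint : IntegrableOn G' Sstar)
    (hGG : ∀ᵐ x ∂(volume.restrict Sstar), G' x = G x)
    (hz : ∀ j, z j ∈ V) (hzG : ∀ j, G' (z j) = G (z j)) {h' : ℝ → ℝ≥0∞}
    (hh' : ∀ R, 0 ≤ R → ENNReal.ofReal (R ^ (2 * ((l : ℝ) + β))) ≤ h' R) :
    ‖∑ j, G' (z j) * estimatorWeight Sstar l K z j - ∫ x in Sstar, G' x‖ₑ ^ 2 ≤
      volume Sstar * (ENNReal.ofReal (((d : ℝ) ^ l * CH) ^ 2 * K) *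
        ∫⁻ x in Sstar, cellMoment l K h' z x) := by
  set A := ENNReal.ofReal (((d : ℝ) ^ l * CH) ^ 2 * K) with hA
  have hex := fun J (hJ : J ∈ Finset.powersetCard K (Finset.univ : Finset (Fin n))) =>
    fit_exists_of_cellMoment_ne_top hvol hfin hJ
  have hcell : ∀ J : Finset (Fin n), MeasurableSet (voronoiCell Set.univ z J) := fun J =>
    measurableSet_voronoiCell_of MeasurableSet.univ z J
  -- The weighted sum is the estimator applied to the noise-free responses `G' (z j)`, which makes
  -- the cellwise fitting error accessible.
  rw [← estimator_eq_sum fun J hJ => (hex J hJ).2]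
  rw [setIntegral_eq_sum_voronoiCell hS hpart hGint]
  unfold estimator
  rw [← Finset.sum_sub_distrib]
  have hfitm : ∀ J, Measurable fun x => localFit l z (fun j => G' (z j)) J x := by
    intro J
    simp_rw [localFit_eq_sum]
    exact Finset.measurable_sum _ fun j _ => (measurable_fitWeight (z := fun _ => z) l
      measurable_const measurable_id J j).const_mul _
  have hsub : ∀ J ∈ Finset.powersetCard K (Finset.univ : Finset (Fin n)),
      (∫ x in voronoiCell Sstar z J, localFit l z (fun j => G' (z j)) J x)
        - ∫ x in voronoiCell Sstar z J, G' x
      = ∫ x in voronoiCell Sstar z J, (localFit l z (fun j => G' (z j)) J x - G' x) := by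
    intro J hJ
    have hI : IntegrableOn (fun x => localFit l z (fun j => G' (z j)) J x)
        (voronoiCell Sstar z J) := by
      simp_rw [localFit_eq_sum]
      exact integrable_finsetSum _ fun j hj => ((hex J hJ).2 j hj).const_mul _
    exact (integral_sub hI (hGint.mono_set fun x hx => hx.1)).symm
  rw [Finset.sum_congr rfl hsub]
  set e : EuclideanSpace ℝ (Fin d) → ℝ≥0∞ := fun x =>
    ∑ J ∈ Finset.powersetCard K (Finset.univ : Finset (Fin n)), (voronoiCell Set.univ z J).indicator
      (fun x => ‖localFit l z (fun j => G' (z j)) J x - G' x‖ₑ) x with he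
  have hem : ∀ J, Measurable ((voronoiCell Set.univ z J).indicator
      (fun x => ‖localFit l z (fun j => G' (z j)) J x - G' x‖ₑ)) := fun J =>
    ((hfitm J).sub hG').enorm.indicator (hcell J)
  have hle : ‖∑ J ∈ Finset.powersetCard K (Finset.univ : Finset (Fin n)),
      ∫ x in voronoiCell Sstar z J, (localFit l z (fun j => G' (z j)) J x - G' x)‖ₑ
      ≤ ∫⁻ x in Sstar, e x := by
    rw [he, lintegral_finsetSum _ fun J _ => hem J]
    refine (enorm_sum_le _ _).trans (Finset.sum_le_sum fun J _ => ?_)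
    refine (enorm_integral_le_lintegral_enorm _).trans (le_of_eq ?_)
    rw [voronoiCell_eq_inter, setLIntegral_indicator (hcell J)]
  have hunit : ∀ᵐ x ∂(volume.restrict Sstar),
      ∀ J ∈ Finset.powersetCard K (Finset.univ : Finset (Fin n)),
        x ∈ voronoiCell Set.univ z J → IsUnit (designMatrix l z J x).det := by
    rw [ae_restrict_iff' hS]
    have h1 : ∀ J ∈ Finset.powersetCard K (Finset.univ : Finset (Fin n)),
        ∀ᵐ x, x ∈ voronoiCell Sstar z J → IsUnit (designMatrix l z J x).det := fun J hJ =>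
      (ae_restrict_iff' (measurableSet_voronoiCell_of hS z J)).1 (hex J hJ).1
    have h2 := (Filter.eventually_all_finset _).2 h1
    filter_upwards [h2] with x hx hxS J hJ hxJ
    exact hx J hJ (by rw [voronoiCell_eq_inter]; exact ⟨hxJ, hxS⟩)
  -- Almost every `x` lies in exactly one cell, where the error is that of a single local fit.
  have hsq : ∀ᵐ x ∂(volume.restrict Sstar), e x ^ 2 ≤ A * cellMoment l K h' z x := by
    filter_upwards [hunit, hpart, hGG, ae_restrict_mem hS] with x hx ⟨J, hJ, hxJ⟩ hGx hxS
    have huniq : ∀ J' ∈ Finset.powersetCard K Finset.univ, J' ≠ J →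
        x ∉ voronoiCell Set.univ z J' := fun J' hJ' hne hx' => hne
      (eq_of_mem_voronoiCell ((Finset.mem_powersetCard.1 hJ').2.trans
        (Finset.mem_powersetCard.1 hJ).2.symm) hx' hxJ)
    have hex : e x = ‖localFit l z (fun j => G' (z j)) J x - G' x‖ₑ := by
      rw [he]
      dsimp only
      rw [Finset.sum_eq_single J, Set.indicator_of_mem hxJ]
      · exact fun J' hJ' hne => Set.indicator_of_notMem (huniq J' hJ' hne) _
      · exact fun h => absurd hJ h
    have hmom : fitRisk l z J x * h' (cellRadius z J x) ≤ cellMoment l K h' z x := by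
      unfold cellMoment
      refine le_trans (le_of_eq ?_) (Finset.single_le_sum (f := fun J =>
        (voronoiCell Set.univ z J).indicator (fun y => fitRisk l z J y * h' (cellRadius z J y)) x)
        (fun _ _ => zero_le) hJ)
      rw [Set.indicator_of_mem hxJ]
    have hfit := h.localFit_sub_sq_le (J := J) (z := z) hV hconv hβ hCH (hSV hxS) hz (hx J hJ hxJ)
    rw [(Finset.mem_powersetCard.1 hJ).2] at hfit
    rw [hex, hGx]
    simp_rw [hzG]
    refine hfit.trans (mul_le_mul' le_rfl (le_trans (mul_le_mul' le_rfl ?_) hmom))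
    exact hh' _ (cellRadius_nonneg z J x)
  have hemeas : Measurable e := Finset.measurable_sum _ fun J _ => hem J
  calc _ ≤ (∫⁻ x in Sstar, e x) ^ 2 := by gcongr
    _ ≤ volume Sstar * ∫⁻ x in Sstar, e x ^ 2 := by
        refine (lintegral_sq_le_mul (φ := fun _ => 1) _ hemeas measurable_const (by simp)
          (by simp)).trans (by simp)
    _ ≤ volume Sstar * ∫⁻ x in Sstar, A * cellMoment l K h' z x :=
        mul_le_mul' le_rfl (lintegral_mono_ae hsq)
    _ = _ := by rw [lintegral_const_mul' _ _ ENNReal.ofReal_ne_top]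

end Bias

/-! ### The mean squared bias -/

section PopulationBias

variable {d : ℕ} {𝒰 : Type u} [MeasurableSpace 𝒰] {P : Measure (𝒰 × EuclideanSpace ℝ (Fin d))}
  {g : 𝒰 × EuclideanSpace ℝ (Fin d) → ℝ} {f G G' : EuclideanSpace ℝ (Fin d) → ℝ}
  {S Sstar : Set (EuclideanSpace ℝ (Fin d))} {ρ ρbar r diamS vol CV : ℝ} {n : ℕ}

/-- The density is at least `ρ` on `Sstar`. This transfers identities for the regression function
from the law of the covariate to Lebesgue measure. -/
theorem IsPopulation.restrict_absolutelyContinuous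
    (h : IsPopulation P g f G S Sstar ρ ρbar r diamS vol CV) (hρ : 0 < ρ) :
    (volume.restrict Sstar) ≪ P.map Prod.snd := by
  refine Measure.AbsolutelyContinuous.mk fun s hs h0 => ?_
  rw [Measure.restrict_apply hs]
  have h1 : ENNReal.ofReal ρ * volume (s ∩ Sstar) ≤ 0 := by
    calc _ = ∫⁻ _ in s ∩ Sstar, ENNReal.ofReal ρ := by rw [setLIntegral_const]
      _ ≤ ∫⁻ x in s ∩ Sstar, ENNReal.ofReal (f x) :=
          setLIntegral_mono (ENNReal.measurable_ofReal.comp h.design.measurable) fun x hx =>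
            ENNReal.ofReal_le_ofReal (h.design.lower x (h.inner.subset hx.2))
      _ = P.map Prod.snd (s ∩ Sstar) := (h.design.apply_eq (hs.inter h.inner.measurableSet)).symm
      _ ≤ P.map Prod.snd s := measure_mono Set.inter_subset_left
      _ = 0 := h0
  rw [le_zero_iff, mul_eq_zero] at h1
  exact h1.resolve_left (by simpa using hρ)

theorem IsPopulation.ae_regression_eq
    (h : IsPopulation P g f G S Sstar ρ ρbar r diamS vol CV)
    (he : P[g | sndField 𝒰 (EuclideanSpace ℝ (Fin d))] = fun p => G' p.2) :
    ∀ᵐ p ∂P, G' p.2 = G p.2 := by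
  have := h.regression.condExp_eq
  rw [he] at this
  exact this

/-- Passing to the image measure requires a measurable exceptional set. Nothing is known on the
measurability of `G` off the interior of `S`, so the statement is first restricted to the interior,
where `G` is continuous. -/
theorem IsPopulation.ae_restrict_regression_eq
    (h : IsPopulation P g f G S Sstar ρ ρbar r diamS vol CV) (hρ : 0 < ρ) (hr : 0 < r)
    (hG' : Measurable G') (hG : ContinuousOn G (interior S))
    (he : P[g | sndField 𝒰 (EuclideanSpace ℝ (Fin d))] = fun p => G' p.2) :
    ∀ᵐ x ∂(volume.restrict Sstar), G' x = G x := by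
  have hiS : MeasurableSet (interior S) := isOpen_interior.measurableSet
  have hms : MeasurableSet {x | x ∈ interior S → G' x = G x} := by
    classical
    have hGm : Measurable ((interior S).indicator G) :=
      hG.measurable_piecewise continuousOn_const hiS
    have : {x | x ∈ interior S → G' x = G x}
        = (interior S)ᶜ ∪ {x | G' x = (interior S).indicator G x} := by
      ext x
      by_cases hx : x ∈ interior S
      · simp [hx]
      · simp [hx]
    rw [this]
    exact hiS.compl.union (measurableSet_eq_fun hG' hGm)
  have h1 : ∀ᵐ x ∂(P.map Prod.snd), x ∈ interior S → G' x = G x := by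
    rw [ae_map_iff measurable_snd.aemeasurable hms]
    filter_upwards [h.ae_regression_eq he] with p hp _ using hp
  filter_upwards [(h.restrict_absolutelyContinuous hρ).ae_le h1,
    ae_restrict_mem h.inner.measurableSet] with x hx hxS
  exact hx (h.inner.mem_interior hr hxS)

/-- Since the density is at least `ρ` on `Sstar`, the integral of `|G'|` there is at most `ρ⁻¹`
times the expectation of `|G'(Z)|`. -/
theorem IsPopulation.integrableOn_regression
    (h : IsPopulation P g f G S Sstar ρ ρbar r diamS vol CV) (hρ : 0 < ρ)
    (hG' : Measurable G')
    (he : P[g | sndField 𝒰 (EuclideanSpace ℝ (Fin d))] = fun p => G' p.2) :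
    IntegrableOn G' Sstar := by
  refine ⟨hG'.aestronglyMeasurable, ?_⟩
  have hInt : Integrable (fun p : 𝒰 × EuclideanSpace ℝ (Fin d) => G' p.2) P := by
    rw [← he]; exact integrable_condExp
  have hfm : Measurable fun x => ENNReal.ofReal (f x) := h.design.measurable.ennreal_ofReal
  have h1 := hInt.2
  rw [hasFiniteIntegral_iff_enorm] at h1 ⊢
  rw [← lintegral_map (f := fun x => ‖G' x‖ₑ) hG'.enorm measurable_snd, h.design.density,
    lintegral_withDensity_eq_lintegral_mul _ hfm hG'.enorm] at h1
  have h2 : ENNReal.ofReal ρ * ∫⁻ x in Sstar, ‖G' x‖ₑ < ∞ := by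
    refine lt_of_le_of_lt ?_ h1
    rw [← lintegral_const_mul' _ _ ENNReal.ofReal_ne_top]
    refine le_trans (setLIntegral_mono' h.inner.measurableSet fun x hx => ?_)
      (setLIntegral_le_lintegral Sstar _)
    exact mul_le_mul' (ENNReal.ofReal_le_ofReal (h.design.lower x (h.inner.subset hx))) le_rfl
  by_contra hc
  rw [not_lt, top_le_iff] at hc
  rw [hc, ENNReal.mul_top (by simpa using hρ)] at h2
  exact lt_irrefl _ h2

/-- The target is the integral of the regression function. -/
theorem IsPopulation.targetFunctional_eq
    (h : IsPopulation P g f G S Sstar ρ ρbar r diamS vol CV) (hρ : 0 < ρ)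
    (hG' : Measurable G')
    (he : P[g | sndField 𝒰 (EuclideanSpace ℝ (Fin d))] = fun p => G' p.2) :
    targetFunctional P g f Sstar = ∫ x in Sstar, G' x := by
  have hprob := h.isProbabilityMeasure
  set ψ : EuclideanSpace ℝ (Fin d) → ℝ := fun x => Sstar.indicator (fun _ => (1 : ℝ)) x / f x
    with hψ
  have hψm : Measurable ψ := (measurable_const.indicator h.inner.measurableSet).div
    h.design.measurable
  -- The bounded factor `ψ` depends on the covariate only, so the conditional expectation replaces
  -- `g` by `G'`; the density then cancels on `Sstar`.
  have hψb : ∀ x, ‖ψ x‖ ≤ ρ⁻¹ := by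
    intro x
    by_cases hx : x ∈ Sstar
    · have := h.design.lower x (h.inner.subset hx)
      rw [hψ]
      simp only [Set.indicator_of_mem hx, one_div]
      rw [Real.norm_eq_abs, abs_of_pos (inv_pos.2 (hρ.trans_le this))]
      exact inv_anti₀ hρ this
    · simp [hψ, Set.indicator_of_notMem hx, hρ.le]
  have hm : sndField 𝒰 (EuclideanSpace ℝ (Fin d)) ≤ Prod.instMeasurableSpace :=
    measurable_snd.comap_le
  have hsnd : Measurable[sndField 𝒰 (EuclideanSpace ℝ (Fin d))]
    (Prod.snd : 𝒰 × EuclideanSpace ℝ (Fin d) → _) := comap_measurable _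
  have hgint : Integrable g P := h.regression.memLp.integrable one_le_two
  have hgψ : Integrable (fun p => g p * ψ p.2) P :=
    hgint.mul_bdd (hψm.comp measurable_snd).aestronglyMeasurable
      (Filter.Eventually.of_forall fun p => hψb p.2)
  have h1 := condExp_mul_of_stronglyMeasurable_right (m := sndField 𝒰 (EuclideanSpace ℝ (Fin d)))
    (μ := P) (f := g) (g := fun p => ψ p.2) (hψm.comp hsnd).stronglyMeasurable hgψ hgint
  have h2 : targetFunctional P g f Sstar = ∫ p, G' p.2 * ψ p.2 ∂P := by
    unfold targetFunctional
    rw [← integral_condExp hm]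
    refine integral_congr_ae ?_
    filter_upwards [h1] with p hp
    rw [he] at hp
    exact hp
  have hfm : AEMeasurable (fun x => (f x).toNNReal) volume :=
    h.design.measurable.real_toNNReal.aemeasurable
  rw [h2, ← integral_map (φ := Prod.snd) (f := fun x => G' x * ψ x) measurable_snd.aemeasurable
    (hG'.mul hψm).aestronglyMeasurable, h.design.density]
  have h3 := integral_withDensity_eq_integral_smul₀ hfm (fun x => G' x * ψ x)
  have h4 : (fun x => ((f x).toNNReal : ℝ≥0∞)) = fun x => ENNReal.ofReal (f x) := rfl
  rw [h4] at h3
  rw [h3, ← integral_indicator h.inner.measurableSet]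
  refine integral_congr_ae (Filter.Eventually.of_forall fun x => ?_)
  by_cases hx : x ∈ Sstar
  · have := hρ.trans_le (h.design.lower x (h.inner.subset hx))
    simp only [hψ, Set.indicator_of_mem hx, NNReal.smul_def, Real.coe_toNNReal _ this.le,
      smul_eq_mul]
    field_simp
  · simp [hψ, Set.indicator_of_notMem hx]

/-- For a fixed point, ties among the distances have probability zero. Tonelli exchanges the order:
for almost every sample, almost every point is free of ties and thus lies in a cell. -/
theorem IsPopulation.ae_partition (hd : 1 ≤ d)
    (h : IsPopulation P g f G S Sstar ρ ρbar r diamS vol CV) {K : ℕ} (hK : K ≤ n) :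
    ∀ᵐ q ∂(Measure.pi fun _ : Fin n => P), ∀ᵐ x ∂(volume.restrict Sstar),
      ∃ J ∈ Finset.powersetCard K Finset.univ,
        x ∈ voronoiCell Set.univ (fun i => (q i).2) J := by
  have hprob := h.isProbabilityMeasure
  have hms : MeasurableSet {p : (Fin n → 𝒰 × EuclideanSpace ℝ (Fin d)) × EuclideanSpace ℝ (Fin d) |
      Function.Injective fun i => ‖p.2 - (p.1 i).2‖} := by
    have : {p : (Fin n → 𝒰 × EuclideanSpace ℝ (Fin d)) × EuclideanSpace ℝ (Fin d) |
      Function.Injective fun i => ‖p.2 - (p.1 i).2‖} =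
      ⋂ i, ⋂ j, {p | ‖p.2 - (p.1 i).2‖ = ‖p.2 - (p.1 j).2‖ → i = j} := by
      ext p
      simp [Function.Injective]
    rw [this]
    refine MeasurableSet.iInter fun i => MeasurableSet.iInter fun j => ?_
    by_cases hij : i = j
    · simp [hij]
    · simp only [hij, imp_false]
      have hm : ∀ i, Measurable fun p : (Fin n → 𝒰 × EuclideanSpace ℝ (Fin d)) ×
          EuclideanSpace ℝ (Fin d) => ‖p.2 - (p.1 i).2‖ := fun i => by fun_prop
      exact (measurableSet_eq_fun (hm i) (hm j)).compl
  have h1 : ∀ᵐ q ∂(Measure.pi fun _ : Fin n => P), ∀ᵐ x ∂(volume.restrict Sstar),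
      Function.Injective fun i => ‖x - (q i).2‖ := by
    rw [Measure.ae_ae_comm hms]
    exact Filter.Eventually.of_forall fun x =>
      ae_injective_norm_sub hd P measurable_snd h.design.absolutelyContinuous x
  filter_upwards [h1] with q hq
  filter_upwards [hq] with x hx
  exact exists_mem_voronoiCell hK (Set.mem_univ x) hx

theorem IsPopulation.ae_pi (h : IsPopulation P g f G S Sstar ρ ρbar r diamS vol CV)
    {p : 𝒰 × EuclideanSpace ℝ (Fin d) → Prop} (hp : ∀ᵐ a ∂P, p a) :
    ∀ᵐ q ∂(Measure.pi fun _ : Fin n => P), ∀ j, p (q j) := by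
  have hprob := h.isProbabilityMeasure
  rw [ae_all_iff]
  exact fun j => (measurePreserving_eval (fun _ : Fin n => P) j).quasiMeasurePreserving.ae hp

theorem IsPopulation.ae_moment_ne_top (hd : 1 ≤ d)
    (h : IsPopulation P g f G S Sstar ρ ρbar r diamS vol CV) {l K : ℕ} (hK : 1 ≤ K)
    (hc : l = 0 ∨ groupCount d l * numMonomials d l + 2 ≤ K) (hn : K ≤ n) :
    ∀ᵐ q ∂(Measure.pi fun _ : Fin n => P),
      ∫⁻ x in Sstar, cellMoment l K 1 (fun i => (q i).2) x ≠ ∞ := by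
  have hprob := h.isProbabilityMeasure
  have h1 := h.lintegral_mul_moment_ne_top hd hK hc (ψ := fun _ => 1) measurable_const (by simp)
    (⟨0, by omega⟩ : Fin n)
  simp only [one_mul] at h1
  have hm := (measurable_cellMoment_sample (𝒰 := 𝒰) (d := d) (n := n) l K
    (h := 1) measurable_one).lintegral_prod_right' (ν := volume.restrict Sstar)
  filter_upwards [ae_lt_top hm h1] with q hq using hq.ne

/-- The mean squared bias is bounded by a moment of the local fit. -/
theorem IsPopulation.lintegral_bias_sq_le (hd : 1 ≤ d)
    (h : IsPopulation P g f G S Sstar ρ ρbar r diamS vol CV) (hρ : 0 < ρ) (hr : 0 < r)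
    {l K : ℕ} (hK : 1 ≤ K)
    (hc : l = 0 ∨ groupCount d l * numMonomials d l + 2 ≤ K) (hn : K ≤ n) {β CH : ℝ}
    (hβ : 0 < β) (hβ1 : β ≤ 1) (hCH : 0 < CH) (hG : HolderClass (interior S) l β CH G)
    (hG' : Measurable G')
    (he : P[g | sndField 𝒰 (EuclideanSpace ℝ (Fin d))] = fun p => G' p.2)
    {lam : ℝ} (hl : 0 < lam) :
    ∫⁻ q, ‖∑ j, G' (q j).2 * estimatorWeight Sstar l K (fun i => (q i).2) j
        - targetFunctional P g f Sstar‖ₑ ^ 2 ∂(Measure.pi fun _ : Fin n => P) ≤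
      volume Sstar * (ENNReal.ofReal (((d : ℝ) ^ l * CH) ^ 2 * K) *
        (ENNReal.ofReal (lam ^ (-(2 * ((l : ℝ) + β)))) *
        ∫⁻ q, (∫⁻ x in Sstar, cellMoment l K (fun R => ENNReal.ofReal ((1 + lam * R) ^ (2 * l + 2)))
          (fun i => (q i).2) x) ∂(Measure.pi fun _ : Fin n => P))) := by
  have hprob := h.isProbabilityMeasure
  have hvol : volume Sstar ≠ ∞ := by rw [h.volume_eq]; exact ENNReal.ofReal_ne_top
  -- The rate is split off by `R = lam⁻¹ * (lam * R)`. As `β ≤ 1`, the exponent `2 * (l + β)` is at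
  -- most `2 * l + 2`, so the moment that remains, and hence the constant, does not depend on `β`.
  have hpt : ∀ R : ℝ, 0 ≤ R → ENNReal.ofReal (R ^ (2 * ((l : ℝ) + β))) ≤
      ENNReal.ofReal (lam ^ (-(2 * ((l : ℝ) + β)))) *
        ENNReal.ofReal ((1 + lam * R) ^ (2 * l + 2)) := by
    intro R hR
    rw [← ENNReal.ofReal_mul (by positivity)]
    refine ENNReal.ofReal_le_ofReal ?_
    have h1 : R = lam⁻¹ * (lam * R) := by field_simp
    have h2 : (lam * R) ^ (2 * ((l : ℝ) + β)) ≤ (1 + lam * R) ^ (2 * l + 2) := by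
      have hlR : 0 ≤ lam * R := by positivity
      calc _ ≤ (1 + lam * R) ^ (2 * ((l : ℝ) + β)) :=
            Real.rpow_le_rpow hlR (by linarith) (by positivity)
        _ ≤ (1 + lam * R) ^ (((2 * l + 2 : ℕ)) : ℝ) := by
            refine Real.rpow_le_rpow_of_exponent_le (by linarith) ?_
            push_cast
            linarith
        _ = _ := Real.rpow_natCast _ _
    calc R ^ (2 * ((l : ℝ) + β)) = lam ^ (-(2 * ((l : ℝ) + β))) * (lam * R) ^ (2 * ((l : ℝ) + β)) := by
          nth_rewrite 1 [h1]
          rw [Real.mul_rpow (by positivity) (by positivity), Real.inv_rpow hl.le,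
            Real.rpow_neg hl.le]
      _ ≤ _ := mul_le_mul_of_nonneg_left h2 (by positivity)
  have hInt : ∀ᵐ p ∂P, p.2 ∈ interior S :=
    ae_of_ae_map measurable_snd.aemeasurable h.design.ae_mem_interior
  have hcm : ∀ q : Fin n → 𝒰 × EuclideanSpace ℝ (Fin d), ∀ x,
      cellMoment l K (fun R => ENNReal.ofReal (lam ^ (-(2 * ((l : ℝ) + β)))) *
        ENNReal.ofReal ((1 + lam * R) ^ (2 * l + 2))) (fun i => (q i).2) x
      = ENNReal.ofReal (lam ^ (-(2 * ((l : ℝ) + β)))) *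
        cellMoment l K (fun R => ENNReal.ofReal ((1 + lam * R) ^ (2 * l + 2)))
          (fun i => (q i).2) x := by
    intro q x
    unfold cellMoment
    rw [Finset.mul_sum]
    refine Finset.sum_congr rfl fun J _ => ?_
    by_cases hx : x ∈ voronoiCell Set.univ (fun i => (q i).2) J
    · rw [Set.indicator_of_mem hx, Set.indicator_of_mem hx]; ring
    · rw [Set.indicator_of_notMem hx, Set.indicator_of_notMem hx, mul_zero]
  rw [h.targetFunctional_eq hρ hG' he]
  have hG0 : ContinuousOn G (interior S) := hG.1.continuousOn
  have hpw : ∀ᵐ q ∂(Measure.pi fun _ : Fin n => P),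
      ‖∑ j, G' (q j).2 * estimatorWeight Sstar l K (fun i => (q i).2) j
        - ∫ x in Sstar, G' x‖ₑ ^ 2 ≤
      volume Sstar * (ENNReal.ofReal (((d : ℝ) ^ l * CH) ^ 2 * K) *
        (ENNReal.ofReal (lam ^ (-(2 * ((l : ℝ) + β)))) *
        (∫⁻ x in Sstar, cellMoment l K (fun R => ENNReal.ofReal ((1 + lam * R) ^ (2 * l + 2)))
          (fun i => (q i).2) x))) := by
    filter_upwards [h.ae_partition hd hn, h.ae_pi (h.ae_regression_eq he), h.ae_pi hInt,
      h.ae_moment_ne_top hd hK hc hn] with q hq1 hq2 hq3 hq4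
    refine (bias_sq_le isOpen_interior h.design.convex.interior hβ hCH hG h.inner.measurableSet
      (fun x hx => h.inner.mem_interior hr hx) hvol hq4 hq1 hG'
      (h.integrableOn_regression hρ hG' he) (h.ae_restrict_regression_eq hρ hr hG' hG0 he)
      hq3 hq2 hpt).trans (le_of_eq ?_)
    rw [lintegral_congr (hcm q), lintegral_const_mul' _ _ ENNReal.ofReal_ne_top]
  refine (lintegral_mono_ae hpw).trans (le_of_eq ?_)
  rw [lintegral_const_mul' _ _ hvol, lintegral_const_mul' _ _ ENNReal.ofReal_ne_top,
    lintegral_const_mul' _ _ ENNReal.ofReal_ne_top]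

end PopulationBias

/-! ### Variance, bias and mean squared error -/

section Final

theorem estimatorWellDefined_of_ae {d n : ℕ} {𝒰 : Type u} {g : 𝒰 × EuclideanSpace ℝ (Fin d) → ℝ}
  {Sstar : Set (EuclideanSpace ℝ (Fin d))} {Ω : Type v} [MeasurableSpace Ω] {μ : Measure Ω} {l K : ℕ}
    {U : Fin n → Ω → 𝒰} {Z : Fin n → Ω → EuclideanSpace ℝ (Fin d)} (hvol : volume Sstar ≠ ∞)
    (h : ∀ᵐ ω ∂μ, ∫⁻ x in Sstar, cellMoment l K 1 (fun i => Z i ω) x ≠ ∞) :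
    EstimatorWellDefined μ Sstar l K g U Z := by
  filter_upwards [h] with ω hω J hJ
  obtain ⟨h1, h2⟩ := fit_exists_of_cellMoment_ne_top hvol hω hJ
  refine ⟨h1, ?_⟩
  have : localFit l (fun j => Z j ω) (fun j => g (U j ω, Z j ω)) J = fun x =>
      ∑ j ∈ J, g (U j ω, Z j ω) * fitWeight l (fun j => Z j ω) J x j :=
    funext fun x => localFit_eq_sum _ _ _ _ _
  rw [this]
  exact integrable_finsetSum _ fun j hj => (h2 j hj).const_mul _

theorem integral_sq_le_toReal {Ω : Type*} [MeasurableSpace Ω] {μ : Measure Ω} {F : Ω → ℝ}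
    (hF : AEStronglyMeasurable F μ) {B : ℝ≥0∞} (hB : B ≠ ∞) (h : ∫⁻ ω, ‖F ω‖ₑ ^ 2 ∂μ ≤ B) :
    ∫ ω, F ω ^ 2 ∂μ ≤ B.toReal := by
  rw [integral_eq_lintegral_of_nonneg_ae (Filter.Eventually.of_forall fun _ => sq_nonneg _)
    (hF.pow 2)]
  refine ENNReal.toReal_mono hB (le_trans (le_of_eq (lintegral_congr fun ω => ?_)) h)
  rw [← ofReal_norm, ← ENNReal.ofReal_pow (norm_nonneg _), Real.norm_eq_abs, sq_abs]

/-- The error is split at the conditional mean and `(a + b)² ≤ 2a² + 2b²` is applied pointwise; the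
factor two only affects the constant. -/
theorem integral_sq_sub_le {Ω : Type*} {m : MeasurableSpace Ω} [mΩ : MeasurableSpace Ω]
    (hm : m ≤ mΩ) {μ : Measure Ω} [IsProbabilityMeasure μ] {T : Ω → ℝ} (hT : MemLp T 2 μ) (c : ℝ) :
    ∫ ω, (T ω - c) ^ 2 ∂μ ≤
      2 * ∫ ω, condVar m T μ ω ∂μ + 2 * ∫ ω, ((μ[T | m]) ω - c) ^ 2 ∂μ := by
  have hE : MemLp (μ[T | m]) 2 μ := hT.condExp one_le_two
  have h1 : Integrable (fun ω => (T ω - (μ[T | m]) ω) ^ 2) μ := (hT.sub hE).integrable_sq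
  have h2 : Integrable (fun ω => ((μ[T | m]) ω - c) ^ 2) μ :=
    (hE.sub (memLp_const c)).integrable_sq
  have h3 : ∫ ω, condVar m T μ ω ∂μ = ∫ ω, (T ω - (μ[T | m]) ω) ^ 2 ∂μ := by
    rw [condVar, integral_condExp hm]
    rfl
  rw [h3, ← integral_const_mul, ← integral_const_mul,
    ← integral_add (h1.const_mul 2) (h2.const_mul 2)]
  refine integral_mono ((hT.sub (memLp_const c)).integrable_sq)
    ((h1.const_mul 2).add (h2.const_mul 2)) fun ω => ?_
  nlinarith [sq_nonneg (T ω - (μ[T | m]) ω - ((μ[T | m]) ω - c))]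

/-- Bounds of the conditional variance and of the conditional bias of the estimator. -/
theorem exists_variance_and_bias_le (d l K : ℕ) (hd : 1 ≤ d) (hK : 1 ≤ K)
    (hc : l = 0 ∨ groupCount d l * numMonomials d l + 2 ≤ K)
    (ρ ρbar r diamS vol : ℝ) (hρ : 0 < ρ) (hr : 0 < r) :
    ∃ C₁ C₂ : ℝ, 0 ≤ C₁ ∧ 0 ≤ C₂ ∧ ∀ β CH CV : ℝ, 0 < β → β ≤ 1 → 0 < CH → 0 < CV →
      ∀ n : ℕ, K ≤ n →
        ∀ (𝒰 : Type u) [MeasurableSpace 𝒰] (P : Measure (𝒰 × EuclideanSpace ℝ (Fin d)))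
          (g : 𝒰 × EuclideanSpace ℝ (Fin d) → ℝ) (f G : EuclideanSpace ℝ (Fin d) → ℝ)
          (S Sstar : Set (EuclideanSpace ℝ (Fin d)))
          (Ω : Type v) [MeasurableSpace Ω] (μ : Measure Ω) [IsProbabilityMeasure μ]
          (U : Fin n → Ω → 𝒰) (Z : Fin n → Ω → EuclideanSpace ℝ (Fin d)),
          IsPopulation P g f G S Sstar ρ ρbar r diamS vol CV →
          IsSample μ U Z P →
          EstimatorWellDefined μ Sstar l K g U Z ∧
          MemLp (sampleEstimator Sstar l K g U Z) 2 μ ∧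
          (∫ ω, condVar (sigmaZ Z) (sampleEstimator Sstar l K g U Z) μ ω ∂μ
            ≤ CV * C₁ * (n : ℝ)⁻¹) ∧
          (HolderClass (interior S) l β CH G →
            ∫ ω, ((μ[sampleEstimator Sstar l K g U Z | sigmaZ Z]) ω
                - targetFunctional P g f Sstar) ^ 2 ∂μ
              ≤ CH ^ 2 * C₂ * (n : ℝ) ^ (-(2 * ((l : ℝ) + β) / (d : ℝ)))) := by
  -- The power `d + 1` is the one of the weight in the Cauchy–Schwarz step for the variance; the
  -- power `2 * l + 2` below comes from the squared Taylor remainder.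
  obtain ⟨M₁, hM₁, hle₁⟩ := exists_population_moment_le.{u} d l K (d + 1) hd hK hc ρ ρbar r diamS
    vol hρ hr
  obtain ⟨M₂, hM₂, hle₂⟩ := exists_population_moment_le.{u} d l K (2 * l + 2) hd hK hc ρ ρbar r
    diamS vol hρ hr
  have hrad : radialIntegral d ≠ ∞ := radialIntegral_ne_top d
  refine ⟨(radialIntegral d * M₁).toReal, (ENNReal.ofReal vol).toReal * ((d : ℝ) ^ l) ^ 2 * K *
    M₂.toReal, ENNReal.toReal_nonneg, by positivity, ?_⟩
  intro β CH CV hβ hβ1 hCH hCV n hn 𝒰 _ P g f G S Sstar Ω _ μ _ U Z hpop hsample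
  have hprob := hpop.isProbabilityMeasure
  have hn0 : (0 : ℝ) < n := by exact_mod_cast (by omega : 0 < n)
  have hd0 : (d : ℝ) ≠ 0 := by exact_mod_cast (by omega : d ≠ 0)
  set lam : ℝ := (n : ℝ) ^ ((d : ℝ)⁻¹) with hlam
  have hl : 0 < lam := Real.rpow_pos_of_pos hn0 _
  have hln : lam ^ d = n := by
    rw [hlam, ← Real.rpow_natCast, ← Real.rpow_mul hn0.le, inv_mul_cancel₀ hd0, Real.rpow_one]
  have hvol : volume Sstar ≠ ∞ := by rw [hpop.volume_eq]; exact ENNReal.ofReal_ne_top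
  have hX := hsample.measurePreserving
  have hS := hpop.inner.measurableSet
  have hz : Measurable fun (q : Fin n → 𝒰 × EuclideanSpace ℝ (Fin d)) (i : Fin n) => (q i).2 := by
    fun_prop
  have hw : ∀ j, Measurable fun z : Fin n → EuclideanSpace ℝ (Fin d) =>
      estimatorWeight Sstar l K z j := fun j => measurable_estimatorWeight hS l K j
  -- Used with `ψ = 1` and with `ψ = ‖g‖ₑ ^ 2`. In the second case the response `j` is not
  -- independent of the weight `j`, which is why the majorants carry a weight on one observation.
  have hfinψ : ∀ ψ : 𝒰 × EuclideanSpace ℝ (Fin d) → ℝ≥0∞, Measurable ψ → ∫⁻ a, ψ a ∂P ≠ ∞ →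
      ∀ j, ∫⁻ q, ψ (q j) * ‖estimatorWeight Sstar l K (fun i => (q i).2) j‖ₑ ^ 2
        ∂(Measure.pi fun _ : Fin n => P) ≠ ∞ := by
    intro ψ hψ hψfin j
    have h1 := hpop.lintegral_mul_moment_ne_top hd hK hc hψ hψfin j
    refine ne_top_of_le_ne_top (ENNReal.mul_ne_top hvol h1) ?_
    rw [← lintegral_const_mul' _ _ hvol]
    refine lintegral_mono fun q => ?_
    rw [mul_left_comm]
    exact mul_le_mul' le_rfl (estimatorWeight_sq_le Sstar l K _ j)
  have hfin : ∀ j, ∫⁻ q, ‖estimatorWeight Sstar l K (fun i => (q i).2) j‖ₑ ^ 2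
      ∂(Measure.pi fun _ : Fin n => P) ≠ ∞ := fun j => by
    simpa using hfinψ (fun _ => 1) measurable_const (by simp) j
  have hg2 : ∫⁻ a, ‖g a‖ₑ ^ 2 ∂P ≠ ∞ := by
    have := hpop.regression.memLp.2
    rw [eLpNorm_lt_top_iff_lintegral_rpow_enorm_lt_top two_ne_zero ENNReal.ofNat_ne_top] at this
    simpa using this.ne
  have hgfin := hfinψ (fun a => ‖g a‖ₑ ^ 2) (hpop.regression.measurable.enorm.pow_const 2) hg2
  obtain ⟨G', hG', he⟩ := exists_measurable_regression P g
  have hres := isResidual_sub hCV.le hpop.regression.measurable hpop.regression.memLp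
    hpop.regression.condVar_le hG' he
  have hmom : ∀ᵐ ω ∂μ, ∫⁻ x in Sstar, cellMoment l K 1 (fun i => Z i ω) x ≠ ∞ :=
    hX.quasiMeasurePreserving.ae (hpop.ae_moment_ne_top hd hK hc hn)
  have hT : sampleEstimator Sstar l K g U Z =ᵐ[μ] fun ω => ∑ j, g (U j ω, Z j ω) *
      estimatorWeight Sstar l K (fun i => Z i ω) j := by
    filter_upwards [hmom] with ω hω
    exact estimator_eq_sum (fun J hJ => (fit_exists_of_cellMoment_ne_top hvol hω hJ).2) _
  obtain ⟨hmem, hce, hvar⟩ := weighted_sum_moments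
    (w := fun j z => estimatorWeight Sstar l K z j) hpop.regression.measurable hG' hres hw hfin
    hgfin hX hT
  refine ⟨estimatorWellDefined_of_ae hvol hmom, hmem, ?_, fun hG => ?_⟩
  · have h1 : ∫⁻ q, (∑ j, ‖estimatorWeight Sstar l K (fun i => (q i).2) j‖ₑ ^ 2)
        ∂(Measure.pi fun _ : Fin n => P) ≤ (ENNReal.ofReal n)⁻¹ * (radialIntegral d * M₁) := by
      refine (lintegral_mono fun q => sum_estimatorWeight_sq_le Sstar l K hl _).trans ?_
      rw [lintegral_const_mul', hln, mul_assoc]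
      · exact mul_le_mul' le_rfl (mul_le_mul' le_rfl
          (hle₁ 𝒰 P g f G S Sstar CV hpop n hn lam hl hln))
      · rw [hln]
        refine ENNReal.mul_ne_top (ENNReal.inv_ne_top.2 ?_) hrad
        simpa using (by omega : n ≠ 0)
    have h2 := hvar.trans (mul_le_mul' le_rfl h1)
    have h3 : ENNReal.ofReal CV * ((ENNReal.ofReal n)⁻¹ * (radialIntegral d * M₁))
        = ENNReal.ofReal (CV * (radialIntegral d * M₁).toReal * (n : ℝ)⁻¹) := by
      rw [ENNReal.ofReal_mul (by positivity), ENNReal.ofReal_mul hCV.le,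
        ENNReal.ofReal_toReal (ENNReal.mul_ne_top hrad hM₁), ENNReal.ofReal_inv_of_pos hn0]
      ring
    rw [h3] at h2
    exact (ENNReal.ofReal_le_ofReal_iff (by positivity)).1 h2
  · have hb := hpop.lintegral_bias_sq_le hd hρ hr hK hc hn hβ hβ1 hCH hG hG' he hl
    have hB := hb.trans (mul_le_mul' le_rfl (mul_le_mul' le_rfl (mul_le_mul' le_rfl
      (hle₂ 𝒰 P g f G S Sstar CV hpop n hn lam hl hln))))
    have hBm : Measurable fun q : Fin n → 𝒰 × EuclideanSpace ℝ (Fin d) =>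
        ∑ j, G' (q j).2 * estimatorWeight Sstar l K (fun i => (q i).2) j
          - targetFunctional P g f Sstar := by
      refine Measurable.sub_const (Finset.measurable_sum _ fun j _ => ?_) _
      exact (hG'.comp (measurable_snd.comp (measurable_pi_apply j))).mul ((hw j).comp hz)
    have h1 : ∫ ω, ((μ[sampleEstimator Sstar l K g U Z | sigmaZ Z]) ω
        - targetFunctional P g f Sstar) ^ 2 ∂μ
        = ∫ q, (∑ j, G' (q j).2 * estimatorWeight Sstar l K (fun i => (q i).2) j
          - targetFunctional P g f Sstar) ^ 2 ∂(Measure.pi fun _ : Fin n => P) := by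
      rw [← hX.map_eq, integral_map hX.measurable.aemeasurable
        (hBm.pow_const 2).aestronglyMeasurable]
      refine integral_congr_ae ?_
      filter_upwards [hce] with ω hω
      rw [hω]
    rw [h1]
    refine (integral_sq_le_toReal hBm.aestronglyMeasurable ?_ hB).trans (le_of_eq ?_)
    · finiteness
    · have hpow : lam ^ (-(2 * ((l : ℝ) + β))) = (n : ℝ) ^ (-(2 * ((l : ℝ) + β) / (d : ℝ))) := by
        rw [hlam, ← Real.rpow_mul hn0.le]
        congr 1
        field_simp
      rw [hpop.volume_eq, hpow, ENNReal.toReal_mul, ENNReal.toReal_mul, ENNReal.toReal_mul,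
        ENNReal.toReal_ofReal (r := ((d : ℝ) ^ l * CH) ^ 2 * K) (by positivity),
        ENNReal.toReal_ofReal (r := (n : ℝ) ^ (-(2 * ((l : ℝ) + β) / (d : ℝ)))) (by positivity)]
      ring

end Final

theorem theorem1
    (d l K : ℕ) (hd : 2 ≤ d) (hK : 1 ≤ K)
    (hKl : 1 ≤ l → 2 + (2 * degreeSum d l + 1) * numMonomials d l ≤ K)
    (ρ ρbar r diamS vol : ℝ) (hρ : 0 < ρ) (hr : 0 < r) :
    ∃ C : ℝ, 0 < C ∧
      ∀ β CH CV : ℝ, 0 < β → β ≤ 1 → 0 < CH → 0 < CV →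
        (∀ n : ℕ, K ≤ n →
          ∀ (𝒰 : Type u) [MeasurableSpace 𝒰] (P : Measure (𝒰 × EuclideanSpace ℝ (Fin d)))
            (g : 𝒰 × EuclideanSpace ℝ (Fin d) → ℝ) (f G : EuclideanSpace ℝ (Fin d) → ℝ)
            (S Sstar : Set (EuclideanSpace ℝ (Fin d)))
            (Ω : Type v) [MeasurableSpace Ω] (μ : Measure Ω) [IsProbabilityMeasure μ]
            (U : Fin n → Ω → 𝒰) (Z : Fin n → Ω → EuclideanSpace ℝ (Fin d)),
            IsPopulation P g f G S Sstar ρ ρbar r diamS vol CV →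
            IsSample μ U Z P →
            EstimatorWellDefined μ Sstar l K g U Z ∧
            MemLp (sampleEstimator Sstar l K g U Z) 2 μ ∧
            (∫ ω, condVar (sigmaZ Z) (sampleEstimator Sstar l K g U Z) μ ω ∂μ
              ≤ CV * C * (n : ℝ)⁻¹) ∧
            (HolderClass (interior S) l β CH G →
              (∫ ω, ((μ[sampleEstimator Sstar l K g U Z | sigmaZ Z]) ω
                  - targetFunctional P g f Sstar) ^ 2 ∂μ
                ≤ CH ^ 2 * C * (n : ℝ) ^ (-(2 * ((l : ℝ) + β) / (d : ℝ)))) ∧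
              ((d : ℝ) / 2 ≤ (l : ℝ) + β →
                ∫ ω, (sampleEstimator Sstar l K g U Z ω - targetFunctional P g f Sstar) ^ 2 ∂μ
                  ≤ (CV + CH ^ 2) * C * (n : ℝ)⁻¹))) ∧
        ((d : ℝ) / 2 < (l : ℝ) + β → ∀ ε : ℝ, 0 < ε → ∃ N : ℕ, ∀ n : ℕ, N ≤ n → K ≤ n →
          ∀ (𝒰 : Type u) [MeasurableSpace 𝒰] (P : Measure (𝒰 × EuclideanSpace ℝ (Fin d)))
            (g : 𝒰 × EuclideanSpace ℝ (Fin d) → ℝ) (f G : EuclideanSpace ℝ (Fin d) → ℝ)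
            (S Sstar : Set (EuclideanSpace ℝ (Fin d)))
            (Ω : Type v) [MeasurableSpace Ω] (μ : Measure Ω) [IsProbabilityMeasure μ]
            (U : Fin n → Ω → 𝒰) (Z : Fin n → Ω → EuclideanSpace ℝ (Fin d)),
            IsPopulation P g f G S Sstar ρ ρbar r diamS vol CV →
            IsSample μ U Z P →
            HolderClass (interior S) l β CH G →
            ∫ ω, ((μ[sampleEstimator Sstar l K g U Z | sigmaZ Z]) ω
                - targetFunctional P g f Sstar) ^ 2 ∂μ
              ≤ ε * (n : ℝ)⁻¹) := by
  have hc : l = 0 ∨ groupCount d l * numMonomials d l + 2 ≤ K := by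
    rcases Nat.eq_zero_or_pos l with h | h
    · exact Or.inl h
    · right
      have := hKl h
      rw [groupCount, if_neg (by omega)]
      omega
  obtain ⟨C₁, C₂, hC₁, hC₂, hmain⟩ := exists_variance_and_bias_le.{u, v} d l K (by omega) hK hc
    ρ ρbar r diamS vol hρ hr
  have hd0 : (0 : ℝ) < d := by exact_mod_cast (by omega : 0 < d)
  -- The factor two comes from splitting the squared error into variance and squared bias. The
  -- summand `1` makes the constant positive even if `C₁` and `C₂` vanish.
  refine ⟨2 * (C₁ + C₂) + 1, by positivity, fun β CH CV hβ hβ1 hCH hCV => ⟨?_, ?_⟩⟩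
  · intro n hn 𝒰 _ P g f G S Sstar Ω _ μ _ U Z hpop hsample
    obtain ⟨hwd, hmem, hvar, hbias⟩ :=
      hmain β CH CV hβ hβ1 hCH hCV n hn 𝒰 P g f G S Sstar Ω μ U Z hpop hsample
    have hn1 : (1 : ℝ) ≤ n := by exact_mod_cast hK.trans hn
    have hinv : 0 ≤ (n : ℝ)⁻¹ := by positivity
    refine ⟨hwd, hmem, hvar.trans ?_, fun hG => ⟨(hbias hG).trans ?_, fun hs => ?_⟩⟩
    · gcongr
      linarith
    · gcongr
      linarith
    · have hle : (n : ℝ) ^ (-(2 * ((l : ℝ) + β) / (d : ℝ))) ≤ (n : ℝ)⁻¹ := by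
        rw [← Real.rpow_neg_one]
        refine Real.rpow_le_rpow_of_exponent_le hn1 (neg_le_neg ?_)
        rw [le_div_iff₀ hd0]
        linarith
      have hm : sigmaZ Z ≤ (inferInstance : MeasurableSpace Ω) :=
        (measurable_pi_lambda _ hsample.measurable_Z).comap_le
      have h1 := integral_sq_sub_le hm hmem (targetFunctional P g f Sstar)
      have h2 := (hbias hG).trans (mul_le_mul_of_nonneg_left hle (by positivity))
      have h3 : 0 ≤ CV * C₂ * (n : ℝ)⁻¹ := by positivity
      have h4 : 0 ≤ CH ^ 2 * C₁ * (n : ℝ)⁻¹ := by positivity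
      have h5 : 0 ≤ (CV + CH ^ 2) * (n : ℝ)⁻¹ := by positivity
      calc _ ≤ 2 * (CV * C₁ * (n : ℝ)⁻¹) + 2 * (CH ^ 2 * C₂ * (n : ℝ)⁻¹) := by linarith
        _ ≤ _ := by linarith
  · intro hs ε hε
    -- The surplus of the bias exponent over `1`. The threshold `N` is determined from it, `CH`,
    -- `C₂` and `ε` before any population is introduced, so the convergence is uniform.
    have ha : 0 < 2 * ((l : ℝ) + β) / d - 1 := by
      rw [sub_pos, lt_div_iff₀ hd0]
      linarith
    have hlim := ((tendsto_rpow_neg_atTop ha).comp tendsto_natCast_atTop_atTop).const_mul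
      (CH ^ 2 * C₂)
    rw [mul_zero] at hlim
    obtain ⟨N, hN⟩ := Filter.eventually_atTop.1 (hlim.eventually_le_const hε)
    refine ⟨N, fun n hNn hn 𝒰 _ P g f G S Sstar Ω _ μ _ U Z hpop hsample hG => ?_⟩
    refine ((hmain β CH CV hβ hβ1 hCH hCV n hn 𝒰 P g f G S Sstar Ω μ U Z hpop
      hsample).2.2.2 hG).trans ?_
    have hn0 : (0 : ℝ) < n := by exact_mod_cast (by omega : 0 < n)
    have hsplit : (n : ℝ) ^ (-(2 * ((l : ℝ) + β) / (d : ℝ)))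
        = (n : ℝ) ^ (-(2 * ((l : ℝ) + β) / d - 1)) * (n : ℝ)⁻¹ := by
      rw [← Real.rpow_neg_one (n : ℝ), ← Real.rpow_add hn0]
      congr 1
      ring
    rw [hsplit, ← mul_assoc]
    exact mul_le_mul_of_nonneg_right (hN n hNn) (by positivity)
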